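/- **Setting.** Let $\Phi^{\alpha_0}$ be finitely many fields of Grassmann parities $\epsilon_{\alpha_0}$ (condensed notation: finitely many index values, repeated indices are summed), $I$ the real superspace with coordinates $\Phi^{\alpha_0}$, and $C^\infty(I)$ its algebra of complex superfunctions (the Grassmann algebra on the odd fields over the smooth complex functions of the even fields). Let $S_0\in C^\infty(I)$ be an even action whose body (its value at vanishing odd fields) is real, invariant under gauge transformations with generators $Z^{\alpha_0}{}_{\alpha_1}\in C^\infty(I)$ of parity $\epsilon_{\alpha_0}+\epsilon_{\alpha_1}$ (finitely many values of $\alpha_1$), that is, $\frac{\delta^R S_0}{\delta\Phi^{\alpha_0}}Z^{\alpha_0}{}_{\alpha_1}=0$. Assume: * (irreducibility) if $f^{\alpha_1}\in C^\infty(I)$ and $Z^{\alpha_0}{}_{\alpha_1}f^{\alpha_1}\approx0$ for all $\alpha_0$, then $f^{\alpha_1}=\frac{\delta^RS_0}{\delta\Phi^{\alpha_0}}f^{\alpha_0\alpha_1}$ for some $f^{\alpha_0\alpha_1}\in C^\infty(I)$, where $\approx 0$ means "is a combination of the field equations $\delta^RS_0/\delta\Phi^{\alpha_0}$ with coefficients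 in $C^\infty(I)$"; * (completeness and regularity) at every point of the body of the stationary surface $\Sigma:\delta^RS_0/\delta\Phi^{\alpha_0}=0$, every (complex) null vector of the body of the Hessian matrix $\delta^L\delta^RS_0/\delta\Phi^{\beta_0}\delta\Phi^{\alpha_0}$ is a linear combination of the bodies of the gauge generators. **Spectrum.** Here $a,b,c,d,e=1,2,3$. The collective fields $\Phi^A$ are the fields $\Phi^{\alpha_0}$ and the ghosts $\eta_a^{\alpha_1},\pi_a^{\alpha_1},\lambda^{\alpha_1}$ of parities $\epsilon_{\alpha_1}+1,\ \epsilon_{\alpha_1},\ \epsilon_{\alpha_1}+1$. Their ghost tridegrees $\mathrm{trigh}$ are $(0,0,0)$ for $\Phi^{\alpha_0}$, the unit vector $e_a$ for $\eta_a$, $(1,1,1)-e_a$ for $\pi_a$ and $(1,1,1)$ for $\lambda$. For each $A$ there are antifields $\Phi^{*(a)}_A$, bar variables $\bar\Phi^{(a)}_A$ and a tilde variable $\tilde\Phi_A$, of parities $\epsilon(\Phi^A)+1$, $\epsilon(\Phi^A)$, $\epsilon(\Phi^A)+1$ and resolution tridegrees $\mathrm{trires}$ equal to $\mathrm{trigh}(\Phi^A)+e_a$,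 $\mathrm{trigh}(\Phi^A)+(1,1,1)-e_a$, $\mathrm{trigh}(\Phi^A)+(1,1,1)$; their ghost tridegree is minus their resolution tridegree. Fields and ghosts have $\mathrm{trires}=(0,0,0)$, and the total resolution degree $\mathrm{res}$ is the sum of the three components of $\mathrm{trires}$. Let $\mathcal A$ be the supercommutative algebra of polynomials in the antifields, bar variables, tilde variables and ghosts with coefficients in $C^\infty(I)$. Let $\mathcal A_+$ (nonnegative ghost tridegree) be the set of sums of elements of $\mathcal A$ of ghost tridegrees $(i,j,k)$ with $i,j,k\ge0$, and $\mathcal A_{++}$ (positive ghost tridegree) the set of sums of those with moreover $i+j+k>0$. **Differential.** $\delta=\delta_1+\delta_2+\delta_3$ is the extended Koszul–Tate differential, where $\delta_a$ is the odd right derivation of $\mathcal A$ (so $\delta_a(FG)=F\,\delta_aG+(-1)^{\epsilon(G)}(\delta_aF)\,G$) that vanishes on $C^\infty(I)$ and on the ghosts and satisfies $$\delta_a\Phi^{*(b)}_{\alpha_0}=-\delta_{ab}\frac{\delta^LS_0}{\delta\Phi^{\alpha_0}},\qquad \delta_a\eta^{*(b)}_{c\alpha_1}=(-1)^{\epsilon_{\alpha_1}}\delta_{ab}\,\Phi^{*(c)}_{\alpha_0}Z^{\alpha_0}{}_{\alpha_1},$$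 $$\delta_a\pi^{*(b)}_{c\alpha_1}=(-1)^{\epsilon_{\alpha_1}+1}\delta_{ab}\big(\varepsilon_{cde}\,\eta^{*(d)}_{e\alpha_1}+\bar\Phi^{(c)}_{\alpha_0}Z^{\alpha_0}{}_{\alpha_1}\big),$$ $$\delta_a\lambda^{*(b)}_{\alpha_1}=(-1)^{\epsilon_{\alpha_1}+1}\delta_{ab}\big(\pi^{*(d)}_{d\alpha_1}+\bar\eta^{(d)}_{d\alpha_1}-\tilde\Phi_{\alpha_0}Z^{\alpha_0}{}_{\alpha_1}\big),$$ $$\delta_a\bar\Phi^{(b)}_A=(-1)^{\epsilon(\Phi^A)}\varepsilon_{abc}\,\Phi^{*(c)}_A,\qquad \delta_a\tilde\Phi_A=(-1)^{\epsilon(\Phi^A)+1}\,\bar\Phi^{(a)}_A .$$ **Theorem (positivity theorem).** Let $F\in\mathcal A_{++}$ be homogeneous of total resolution degree $m>0$ and satisfy $\delta F=0$. Then there exists $P\in\mathcal A_+$ such that $\delta P=F$. -/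

import Mathlib

open scoped ContDiff

namespace Sp3

noncomputable section

/-! ### Free supercommutative algebras -/

/-- The sign `(-1) ^ a` of a Grassmann parity `a`. -/
def sgn (a : ZMod 2) : ℤ := if a = 0 then 1 else -1

/-- Generators `g`, `h` of parities `p g`, `p h` satisfy `g h = (-1) ^ (p g * p h) h g`. -/
inductive SuperRel (B : Type*) [CommRing B] {G : Type*} (p : G → ZMod 2) :
    FreeAlgebra B G → FreeAlgebra B G → Prop
  | swap (g h : G) : SuperRel B p (FreeAlgebra.ι B g * FreeAlgebra.ι B h)
      (sgn (p g * p h) • (FreeAlgebra.ι B h * FreeAlgebra.ι B g))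

/-- The free supercommutative algebra over the commutative ring `B` (whose elements are even)
on generators `g : G` of Grassmann parity `p g`: polynomial in the even generators and exterior
in the odd ones (we only use it when `2` is invertible in `B`). -/
def SuperPoly (B : Type*) [CommRing B] {G : Type*} (p : G → ZMod 2) :=
  RingQuot (SuperRel B p)

instance (B : Type*) [CommRing B] {G : Type*} (p : G → ZMod 2) : Ring (SuperPoly B p) :=
  inferInstanceAs (Ring (RingQuot (SuperRel B p)))

instance (B : Type*) [CommRing B] {G : Type*} (p : G → ZMod 2) : Algebra B (SuperPoly B p) :=
  inferInstanceAs (Algebra B (RingQuot (SuperRel B p)))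

section SuperPoly

variable {B : Type*} [CommRing B] {G : Type*} {p : G → ZMod 2}

variable (B p) in
/-- The quotient map from the free algebra. -/
def proj : FreeAlgebra B G →ₐ[B] SuperPoly B p := RingQuot.mkAlgHom B (SuperRel B p)

variable (B p) in
/-- The generators. -/
def gen (g : G) : SuperPoly B p := proj B p (FreeAlgebra.ι B g)

theorem proj_surjective : Function.Surjective (proj B p) :=
  RingQuot.mkAlgHom_surjective B (SuperRel B p)

theorem gen_swap (g h : G) :
    gen B p g * gen B p h = sgn (p g * p h) • (gen B p h * gen B p g) := by
  have hr : proj B p _ = proj B p _ :=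
    RingQuot.mkAlgHom_rel B (SuperRel.swap (B := B) (p := p) g h)
  simpa only [map_mul, map_zsmul, gen] using hr

/-- The universal property. -/
def lift {X : Type*} [Ring X] [Algebra B X] (f : G → X)
    (hf : ∀ g h, f g * f h = sgn (p g * p h) • (f h * f g)) : SuperPoly B p →ₐ[B] X :=
  RingQuot.liftAlgHom B ⟨FreeAlgebra.lift B f, by
    rintro _ _ ⟨g, h⟩
    simpa only [map_mul, map_zsmul, FreeAlgebra.lift_ι_apply] using hf g h⟩

@[simp] theorem lift_gen {X : Type*} [Ring X] [Algebra B X] (f : G → X)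
    (hf : ∀ g h, f g * f h = sgn (p g * p h) • (f h * f g)) (g : G) :
    lift (B := B) (p := p) f hf (gen B p g) = f g := by
  exact (RingQuot.liftAlgHom_mkAlgHom_apply B _ _ _).trans (FreeAlgebra.lift_ι_apply f g)

variable (B p) in
/-- The part of weight `d`, when the generator `g` is given the weight `w g` and `B` the weight
`0`: the `B`-span of the monomials of total weight `d`. -/
def weightPart {M : Type*} [AddCommMonoid M] (w : G → M) (d : M) : Submodule B (SuperPoly B p) :=
  Submodule.span B {x | ∃ l : List G, (l.map w).sum = d ∧ x = (l.map (gen B p)).prod}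

variable (B p) in
/-- The elements of Grassmann parity `c`. -/
def parityPart (c : ZMod 2) : Submodule B (SuperPoly B p) := weightPart B p p c

theorem gen_mem (g : G) : gen B p g ∈ parityPart B p (p g) :=
  Submodule.subset_span ⟨[g], by simp, by simp⟩

theorem one_mem_parity : (1 : SuperPoly B p) ∈ parityPart B p 0 :=
  Submodule.subset_span ⟨[], by simp, by simp⟩

theorem mul_mem_parity {a b : ZMod 2} {x y : SuperPoly B p} (hx : x ∈ parityPart B p a)
    (hy : y ∈ parityPart B p b) : x * y ∈ parityPart B p (a + b) := by
  have h := Submodule.mul_mem_mul hx hy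
  rw [parityPart, parityPart, weightPart, weightPart, Submodule.span_mul_span] at h
  refine Submodule.span_mono ?_ h
  rintro _ ⟨_, ⟨l, rfl, rfl⟩, _, ⟨l', rfl, rfl⟩, rfl⟩
  exact ⟨l ++ l', by simp, by simp⟩

theorem zsmul_mem_parity {a : ZMod 2} (n : ℤ) {x : SuperPoly B p} (hx : x ∈ parityPart B p a) :
    n • x ∈ parityPart B p a := zsmul_mem hx n

theorem sgn_add (a b : ZMod 2) : sgn (a + b) = sgn a * sgn b := by
  revert a b; decide

theorem sgn_mul_self (a : ZMod 2) : sgn a * sgn a = 1 := by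
  revert a; decide

theorem swap_gen {a : ZMod 2} {x : SuperPoly B p} (hx : x ∈ parityPart B p a) (g : G) :
    x * gen B p g = sgn (a * p g) • (gen B p g * x) := by
  induction hx using Submodule.span_induction with
  | mem x h =>
    obtain ⟨l, rfl, rfl⟩ := h
    induction l with
    | nil => simp [sgn]
    | cons k l ih =>
      simp only [List.map_cons, List.prod_cons, List.sum_cons, mul_assoc, ih, add_mul, sgn_add]
      rw [mul_smul_comm, ← mul_assoc, gen_swap k g, smul_mul_assoc, smul_smul, mul_assoc,
        mul_comm (sgn _)]
  | zero => simp
  | add x y _ _ hx hy => simp [add_mul, mul_add, hx, hy]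
  | smul b x _ hx => simp [hx, smul_comm]

variable (B p) in
/-- The parity automorphism, `x ↦ (-1) ^ (parity of x) x`. -/
def parityAut : SuperPoly B p →ₐ[B] SuperPoly B p :=
  lift (fun g => sgn (p g) • gen B p g) (fun g h => by
    simp only [smul_mul_smul_comm, gen_swap g h, smul_smul]
    congr 1; ring)

theorem parityAut_of_mem {a : ZMod 2} {x : SuperPoly B p} (hx : x ∈ parityPart B p a) :
    parityAut B p x = sgn a • x := by
  induction hx using Submodule.span_induction with
  | mem x h =>
    obtain ⟨l, rfl, rfl⟩ := h
    induction l with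
    | nil => simp [sgn]
    | cons k l ih =>
      simp only [List.map_cons, List.prod_cons, List.sum_cons, map_mul, ih, sgn_add]
      rw [parityAut, lift_gen, smul_mul_smul_comm]
  | zero => simp
  | add x y _ _ hx hy => rw [map_add, hx, hy, smul_add]
  | smul b x _ hx => simp [hx, smul_comm]

/-- The homomorphism `x ↦ (x, D x; 0, (-1) ^ (parity of x) x)` that encodes the odd right
derivation `D` with given values on the generators. -/
def rightDerHom (X : G → SuperPoly B p) (hX : ∀ g, X g ∈ parityPart B p (p g + 1)) :
    SuperPoly B p →ₐ[B] Matrix (Fin 2) (Fin 2) (SuperPoly B p) :=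
  lift (fun g => !![gen B p g, X g; 0, sgn (p g) • gen B p g]) (fun g h => by
    have e1 : gen B p g * X h + X g * (sgn (p h) • gen B p h) =
        sgn (p g * p h) • (gen B p h * X g + X h * (sgn (p g) • gen B p g)) := by
      have h1 : sgn (p h) * (sgn (p g * p h) * sgn (p h)) = sgn (p g * p h) := by
        linear_combination sgn (p g * p h) * sgn_mul_self (p h)
      have h2 : sgn (p g * p h) * (sgn (p g) * (sgn (p g * p h) * sgn (p g))) = 1 := by
        linear_combination (sgn (p g * p h) * sgn (p g * p h)) * sgn_mul_self (p g) +
          sgn_mul_self (p g * p h)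
      simp only [mul_smul_comm, swap_gen (hX g) h, swap_gen (hX h) g, smul_add, smul_smul,
        add_mul, sgn_add, one_mul, mul_comm (p h) (p g), h1, h2, one_smul]
      exact add_comm _ _
    have e2 : (sgn (p g) • gen B p g) * (sgn (p h) • gen B p h) =
        sgn (p g * p h) • ((sgn (p h) • gen B p h) * (sgn (p g) • gen B p g)) := by
      simp only [smul_mul_smul_comm, gen_swap g h, smul_smul]
      congr 1; ring
    ext i j
    fin_cases i <;> fin_cases j
    · simpa [Matrix.mul_apply, Fin.sum_univ_two] using gen_swap g h
    · simpa [Matrix.mul_apply, Fin.sum_univ_two] using e1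
    · simp [Matrix.mul_apply, Fin.sum_univ_two]
    · simpa [Matrix.mul_apply, Fin.sum_univ_two] using e2)

/-- The odd right derivation over `B` with the values `X g` on the generators `g`. -/
def rightDer (X : G → SuperPoly B p) (hX : ∀ g, X g ∈ parityPart B p (p g + 1)) :
    SuperPoly B p →ₗ[B] SuperPoly B p where
  toFun x := rightDerHom X hX x 0 1
  map_add' x y := by simp
  map_smul' b x := by simp


theorem rightDer_gen (X : G → SuperPoly B p) (hX : ∀ g, X g ∈ parityPart B p (p g + 1)) (g : G) :
    rightDer X hX (gen B p g) = X g := by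
  simp [rightDer, rightDerHom]

theorem rightDerHom_zero_zero (X : G → SuperPoly B p)
    (hX : ∀ g, X g ∈ parityPart B p (p g + 1)) (x : SuperPoly B p) :
    rightDerHom X hX x 0 0 = x ∧ rightDerHom X hX x 1 0 = 0 ∧
      rightDerHom X hX x 1 1 = parityAut B p x := by
  obtain ⟨x, rfl⟩ := proj_surjective x
  induction x using FreeAlgebra.induction with
  | grade0 b => simp [Matrix.algebraMap_matrix_apply]
  | grade1 g =>
    change rightDerHom X hX (gen B p g) 0 0 = gen B p g ∧ rightDerHom X hX (gen B p g) 1 0 = 0 ∧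
      rightDerHom X hX (gen B p g) 1 1 = parityAut B p (gen B p g)
    simp [rightDerHom, parityAut]
  | mul x y hx hy => simp [Matrix.mul_apply, Fin.sum_univ_two, hx, hy]
  | add x y hx hy => simp [hx, hy]

/-- The Leibniz rule of an odd right derivation. -/
theorem rightDer_mul (X : G → SuperPoly B p) (hX : ∀ g, X g ∈ parityPart B p (p g + 1))
    (x y : SuperPoly B p) :
    rightDer X hX (x * y) = x * rightDer X hX y + rightDer X hX x * parityAut B p y := by
  change rightDerHom X hX (x * y) 0 1 = x * rightDerHom X hX y 0 1 +
    rightDerHom X hX x 0 1 * parityAut B p y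
  rw [map_mul, Matrix.mul_apply, Fin.sum_univ_two, (rightDerHom_zero_zero X hX x).1,
    (rightDerHom_zero_zero X hX y).2.2]

theorem rightDer_one (X : G → SuperPoly B p) (hX : ∀ g, X g ∈ parityPart B p (p g + 1)) :
    rightDer X hX 1 = 0 := by
  simp [rightDer]

theorem rightDer_mem_parity (X : G → SuperPoly B p) (hX : ∀ g, X g ∈ parityPart B p (p g + 1))
    {c : ZMod 2} {x : SuperPoly B p} (hx : x ∈ parityPart B p c) :
    rightDer X hX x ∈ parityPart B p (c + 1) := by
  induction hx using Submodule.span_induction with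
  | mem x h =>
    obtain ⟨l, rfl, rfl⟩ := h
    induction l with
    | nil => simp [rightDer_one]
    | cons k l ih =>
      have hl : (l.map (gen B p)).prod ∈ parityPart B p (l.map p).sum :=
        Submodule.subset_span ⟨l, rfl, rfl⟩
      simp only [List.map_cons, List.prod_cons, List.sum_cons]
      rw [rightDer_mul, rightDer_gen, parityAut_of_mem hl]
      refine add_mem ?_ ?_
      · rw [add_assoc]; exact mul_mem_parity (gen_mem k) ih
      · rw [add_right_comm]; exact mul_mem_parity (hX k) (zsmul_mem hl _)
  | zero => simp
  | add x y _ _ hx hy => rw [map_add]; exact add_mem hx hy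
  | smul b x _ hx => rw [map_smul]; exact Submodule.smul_mem _ _ hx

section BaseDer

variable [Algebra ℂ B]

/-- The homomorphism `b ↦ b + ε d b` into the dual numbers over the superalgebra. -/
def baseDerBase (d : Derivation ℂ B B) : B →+* DualNumber (SuperPoly B p) where
  toFun b := TrivSqZeroExt.inl (algebraMap B _ b) + TrivSqZeroExt.inr (algebraMap B _ (d b))
  map_one' := by ext <;> simp
  map_zero' := by ext <;> simp
  map_add' x y := by ext <;> simp [Algebra.algebraMap_eq_smul_one, add_smul]
  map_mul' x y := by
    ext
    · simp
    · simp [Algebra.algebraMap_eq_smul_one, add_smul, smul_smul, mul_comm]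

/-- The homomorphism `x ↦ x + ε D x` that encodes the extension `D` to the superalgebra of a
derivation `d` of the base ring that kills the generators. -/
def baseDerHom (d : Derivation ℂ B B) : SuperPoly B p →+* DualNumber (SuperPoly B p) :=
  letI : Algebra B (DualNumber (SuperPoly B p)) := (baseDerBase d).toAlgebra' (fun b x => by
    ext
    · simp [baseDerBase, Algebra.commutes]
    · simp [baseDerBase, Algebra.commutes, add_comm])
  (lift (B := B) (p := p) (X := DualNumber (SuperPoly B p))
    (fun g => TrivSqZeroExt.inl (gen B p g)) (fun g h => by
      ext <;> simp [gen_swap g h])).toRingHom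

/-- The even derivation that extends a derivation of the base ring and kills the generators. -/
def baseDer (d : Derivation ℂ B B) : SuperPoly B p →+ SuperPoly B p where
  toFun x := (baseDerHom d x).snd
  map_zero' := by simp
  map_add' x y := by simp

theorem baseDerHom_gen (d : Derivation ℂ B B) (g : G) :
    baseDerHom d (gen B p g) = TrivSqZeroExt.inl (gen B p g) := by
  let : Algebra B (DualNumber (SuperPoly B p)) := (baseDerBase d).toAlgebra' (fun b x => by
    ext
    · simp [baseDerBase, Algebra.commutes]
    · simp [baseDerBase, Algebra.commutes, add_comm])
  exact lift_gen (B := B) (p := p) (X := DualNumber (SuperPoly B p)) _ _ g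

theorem baseDerHom_algebraMap (d : Derivation ℂ B B) (b : B) :
    baseDerHom d (algebraMap B (SuperPoly B p) b) = baseDerBase d b := by
  let : Algebra B (DualNumber (SuperPoly B p)) := (baseDerBase d).toAlgebra' (fun b x => by
    ext
    · simp [baseDerBase, Algebra.commutes]
    · simp [baseDerBase, Algebra.commutes, add_comm])
  exact AlgHom.commutes (lift (B := B) (p := p) (X := DualNumber (SuperPoly B p)) _ _) b

theorem baseDer_gen (d : Derivation ℂ B B) (g : G) : baseDer d (gen B p g) = 0 := by
  simp [baseDer, baseDerHom_gen]

theorem baseDer_algebraMap (d : Derivation ℂ B B) (b : B) :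
    baseDer d (algebraMap B (SuperPoly B p) b) = algebraMap B _ (d b) := by
  change (baseDerHom d (algebraMap B (SuperPoly B p) b)).snd = _
  rw [baseDerHom_algebraMap]
  simp [baseDerBase, Algebra.algebraMap_eq_smul_one]

theorem baseDerHom_fst (d : Derivation ℂ B B) (x : SuperPoly B p) :
    (baseDerHom d x).fst = x := by
  obtain ⟨x, rfl⟩ := proj_surjective x
  induction x using FreeAlgebra.induction with
  | grade0 b => rw [AlgHom.commutes, baseDerHom_algebraMap]; simp [baseDerBase]
  | grade1 g =>
    change (baseDerHom d (gen B p g)).fst = gen B p g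
    simp [baseDerHom_gen]
  | mul x y hx hy => simp [hx, hy]
  | add x y hx hy => simp [hx, hy]

theorem baseDer_mul (d : Derivation ℂ B B) (x y : SuperPoly B p) :
    baseDer d (x * y) = x * baseDer d y + baseDer d x * y := by
  change (baseDerHom d (x * y)).snd = x * (baseDerHom d y).snd + (baseDerHom d x).snd * y
  rw [map_mul, TrivSqZeroExt.snd_mul, baseDerHom_fst, baseDerHom_fst]
  simp

theorem baseDer_mem_parity (d : Derivation ℂ B B) {c : ZMod 2} {x : SuperPoly B p}
    (hx : x ∈ parityPart B p c) : baseDer d x ∈ parityPart B p c := by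
  induction hx using Submodule.span_induction with
  | mem x h =>
    obtain ⟨l, rfl, rfl⟩ := h
    have : baseDer d (l.map (gen B p)).prod = 0 := by
      induction l with
      | nil => simp [baseDer]
      | cons k l ih => simp [baseDer_mul, baseDer_gen, ih]
    rw [this]; exact zero_mem _
  | zero => simp
  | add x y _ _ hx hy => rw [map_add]; exact add_mem hx hy
  | smul b x hx' hx =>
    rw [Algebra.smul_def, baseDer_mul, ← Algebra.smul_def, baseDer_algebraMap,
      ← Algebra.smul_def]
    exact add_mem (Submodule.smul_mem _ _ hx) (Submodule.smul_mem _ _ hx')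

end BaseDer

end SuperPoly

/-! ### Smooth functions of the fields -/

section Fields

variable {ι₀ ι₁ : Type*}

/-- The body of the space of field histories: the values of the even (commuting) fields. -/
abbrev Body (p₀ : ι₀ → ZMod 2) := {i : ι₀ // p₀ i = 0} → ℝ

variable [Fintype ι₀]

/-- Smooth complex-valued functions of the even fields. -/
def Smooth (p₀ : ι₀ → ZMod 2) : Subalgebra ℂ (Body p₀ → ℂ) where
  carrier := {f | ContDiff ℝ ∞ f}
  mul_mem' {f g} (hf : ContDiff ℝ ∞ f) (hg : ContDiff ℝ ∞ g) := hf.mul hg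
  add_mem' {f g} (hf : ContDiff ℝ ∞ f) (hg : ContDiff ℝ ∞ g) := hf.add hg
  algebraMap_mem' c := (contDiff_const : ContDiff ℝ ∞ fun _ : Body p₀ => c)

theorem contDiff_smooth {p₀ : ι₀ → ZMod 2} (f : Smooth p₀) : ContDiff ℝ ∞ f.1 := f.2

/-- The partial derivative with respect to an even field. -/
def pderiv [DecidableEq ι₀] {p₀ : ι₀ → ZMod 2} (i : {i : ι₀ // p₀ i = 0}) :
    Derivation ℂ (Smooth p₀) (Smooth p₀) :=
  have hd (f : Smooth p₀) : Differentiable ℝ f.1 :=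
    (contDiff_smooth f).differentiable (by simp)
  Derivation.mk'
    { toFun := fun f => ⟨fun x => fderiv ℝ f.1 x (Pi.single i 1),
        ((contDiff_smooth f).fderiv_right (m := ∞) (by simp)).clm_apply contDiff_const⟩
      map_add' := fun f g => by
        ext x
        simp [fderiv_add (hd f x) (hd g x)]
      map_smul' := fun c f => by
        ext x
        simp [fderiv_const_smul (hd f x) c] }
    (fun f g => by
      ext x
      simp [fderiv_mul (hd f x) (hd g x)])

/-- The smooth functions `C^∞(I)` on the superspace of all field histories: the Grassmann algebra
on the odd (anticommuting) fields over the smooth functions of the even fields. -/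
abbrev FieldAlg (p₀ : ι₀ → ZMod 2) :=
  SuperPoly (Smooth p₀) (fun i : {i : ι₀ // p₀ i = 1} => p₀ i)

/-- The body of a superfunction: its value at vanishing odd fields. -/
def body (p₀ : ι₀ → ZMod 2) : FieldAlg p₀ →ₐ[Smooth p₀] Smooth p₀ :=
  lift (fun _ => 0) (by simp)

variable [DecidableEq ι₀]

/-- The right derivative `δ^R / δΦ^i` on `C^∞(I)`. -/
def derivR (p₀ : ι₀ → ZMod 2) (i : ι₀) (F : FieldAlg p₀) : FieldAlg p₀ :=
  if h : p₀ i = 0 then baseDer (pderiv ⟨i, h⟩) F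
  else rightDer (fun j : {i : ι₀ // p₀ i = 1} => if j.1 = i then 1 else 0) (fun j => by
    split_ifs
    · rw [j.2]; exact one_mem_parity
    · exact zero_mem _) F

/-- The left derivative `δ^L / δΦ^i` on `C^∞(I)`: it equals
`(-1) ^ (ε_i (ε(F) + 1)) δ^R F / δΦ^i`. -/
def derivL (p₀ : ι₀ → ZMod 2) (i : ι₀) (F : FieldAlg p₀) : FieldAlg p₀ :=
  if p₀ i = 0 then derivR p₀ i F else parityAut _ _ (derivR p₀ i F)

theorem derivR_mem_parity (p₀ : ι₀ → ZMod 2) (i : ι₀) {c : ZMod 2} {F : FieldAlg p₀}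
    (hF : F ∈ parityPart (Smooth p₀) _ c) :
    derivR p₀ i F ∈ parityPart (Smooth p₀) (fun i : {i : ι₀ // p₀ i = 1} => p₀ i) (p₀ i + c) := by
  unfold derivR
  split_ifs with h
  · rw [h, zero_add]; exact baseDer_mem_parity _ hF
  · have h1 : p₀ i = 1 := by
      revert h; generalize p₀ i = a; revert a; decide
    rw [h1, add_comm]; exact rightDer_mem_parity _ _ hF

theorem derivL_mem_parity (p₀ : ι₀ → ZMod 2) (i : ι₀) {c : ZMod 2} {F : FieldAlg p₀}
    (hF : F ∈ parityPart (Smooth p₀) _ c) :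
    derivL p₀ i F ∈ parityPart (Smooth p₀) (fun i : {i : ι₀ // p₀ i = 1} => p₀ i) (p₀ i + c) := by
  unfold derivL
  split_ifs with h
  · exact derivR_mem_parity p₀ i hF
  · rw [parityAut_of_mem (derivR_mem_parity p₀ i hF)]
    exact zsmul_mem (derivR_mem_parity p₀ i hF) _

/-! ### Gauge theories -/

/-- A Lagrangian gauge theory in condensed notation: an even action `S₀` (with real body) of the
fields `Φ^i`, of Grassmann parities `p₀ i`, and gauge generators `Z^i_α`, of parities
`p₀ i + p₁ α`, under which the action is invariant. -/
structure GaugeTheory (p₀ : ι₀ → ZMod 2) (p₁ : ι₁ → ZMod 2) where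
  S₀ : FieldAlg p₀
  Z : ι₀ → ι₁ → FieldAlg p₀
  S₀_even : S₀ ∈ parityPart _ _ 0
  S₀_real : ∀ x, ((body p₀ S₀ : Smooth p₀) : Body p₀ → ℂ) x ∈ Set.range ((↑) : ℝ → ℂ)
  Z_parity : ∀ i α, Z i α ∈ parityPart _ _ (p₀ i + p₁ α)
  gauge_invariant : ∀ α, ∑ i, derivR p₀ i S₀ * Z i α = 0

/-! ### The field, ghost and antifield spectrum -/

/-- The original fields and the ghosts `η_a^α`, `π_a^α`, `λ^α`. -/
inductive Field (ι₀ ι₁ : Type*)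
  | phi (i : ι₀)
  | eta (a : Fin 3) (α : ι₁)
  | pi (a : Fin 3) (α : ι₁)
  | lam (α : ι₁)

end Fields

/-- The indices of the ghosts alone. -/
inductive Ghost (ι₁ : Type*)
  | eta (a : Fin 3) (α : ι₁)
  | pi (a : Fin 3) (α : ι₁)
  | lam (α : ι₁)

/-- The field index of a ghost. -/
def Ghost.toField {ι₁ : Type*} (ι₀ : Type*) : Ghost ι₁ → Field ι₀ ι₁
  | .eta a α => .eta a α
  | .pi a α => .pi a α
  | .lam α => .lam α

section Spectrum

variable {ι₀ ι₁ : Type*}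

/-- The Grassmann parities of fields and ghosts. -/
def Field.parity (p₀ : ι₀ → ZMod 2) (p₁ : ι₁ → ZMod 2) : Field ι₀ ι₁ → ZMod 2
  | .phi i => p₀ i
  | .eta _ α => p₁ α + 1
  | .pi _ α => p₁ α
  | .lam α => p₁ α + 1

/-- The ghost tridegrees of fields and ghosts. -/
def Field.trigh : Field ι₀ ι₁ → Fin 3 → ℕ
  | .phi _ => 0
  | .eta a _ => fun b => if b = a then 1 else 0
  | .pi a _ => fun b => if b = a then 0 else 1
  | .lam _ => fun _ => 1

/-- The generators of the algebra `𝒜` over the smooth functions of the even fields: the odd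
fields, the ghosts, the antifields `Φ*^(a)_A`, the bar variables `Φ̄^(a)_A` and the tilde
variables `Φ̃_A`. -/
inductive Gen (p₀ : ι₀ → ZMod 2) (ι₁ : Type*)
  | odd (i : {i : ι₀ // p₀ i = 1})
  | ghost (c : Ghost ι₁)
  | star (a : Fin 3) (A : Field ι₀ ι₁)
  | bar (a : Fin 3) (A : Field ι₀ ι₁)
  | tilde (A : Field ι₀ ι₁)

/-- The Grassmann parities of the generators. -/
def Gen.parity (p₀ : ι₀ → ZMod 2) (p₁ : ι₁ → ZMod 2) : Gen p₀ ι₁ → ZMod 2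
  | .odd i => p₀ i
  | .ghost c => (c.toField ι₀).parity p₀ p₁
  | .star _ A => A.parity p₀ p₁ + 1
  | .bar _ A => A.parity p₀ p₁
  | .tilde A => A.parity p₀ p₁ + 1

/-- The resolution tridegrees of the generators. -/
def Gen.trires {p₀ : ι₀ → ZMod 2} : Gen p₀ ι₁ → Fin 3 → ℕ
  | .odd _ => 0
  | .ghost _ => 0
  | .star a A => fun b => A.trigh b + if b = a then 1 else 0
  | .bar a A => fun b => A.trigh b + if b = a then 0 else 1
  | .tilde A => fun b => A.trigh b + 1

/-- The tridegrees of the generators in the exterior longitudinal tricomplex. -/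
def Gen.trideg {p₀ : ι₀ → ZMod 2} : Gen p₀ ι₁ → Fin 3 → ℕ
  | .odd _ => 0
  | .ghost c => (c.toField ι₀).trigh
  | .star _ _ => 0
  | .bar _ _ => 0
  | .tilde _ => 0

/-- The ghost tridegrees of the generators. -/
def Gen.trigh {p₀ : ι₀ → ZMod 2} (g : Gen p₀ ι₁) (a : Fin 3) : ℤ := g.trideg a - g.trires a

/-- The total resolution degrees of the generators. -/
def Gen.res {p₀ : ι₀ → ZMod 2} (g : Gen p₀ ι₁) : ℕ := ∑ a, g.trires a

variable [Fintype ι₀]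

/-- The algebra `𝒜`: polynomials in antifields, bar and tilde variables and ghosts with
coefficients in `C^∞(I)`. -/
abbrev Alg (p₀ : ι₀ → ZMod 2) (p₁ : ι₁ → ZMod 2) :=
  SuperPoly (Smooth p₀) (Gen.parity p₀ p₁)

/-- The generators of `𝒜`. -/
def Alg.of (p₀ : ι₀ → ZMod 2) (p₁ : ι₁ → ZMod 2) (g : Gen p₀ ι₁) : Alg p₀ p₁ := gen _ _ g

/-- The inclusion of `C^∞(I)` in `𝒜`. -/
def coeff (p₀ : ι₀ → ZMod 2) (p₁ : ι₁ → ZMod 2) : FieldAlg p₀ →ₐ[Smooth p₀] Alg p₀ p₁ :=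
  lift (fun i => Alg.of p₀ p₁ (.odd i)) (fun g h => by
    simpa only [Alg.of, Gen.parity] using gen_swap (p := Gen.parity p₀ p₁) (.odd g) (.odd h))

theorem coeff_gen (p₀ : ι₀ → ZMod 2) (p₁ : ι₁ → ZMod 2) (i : {i : ι₀ // p₀ i = 1}) :
    coeff p₀ p₁ (gen _ _ i) = Alg.of p₀ p₁ (.odd i) :=
  lift_gen _ _ i

/-- The elements of ghost tridegree `d`. -/
def trighPart (p₀ : ι₀ → ZMod 2) (p₁ : ι₁ → ZMod 2) (d : Fin 3 → ℤ) :
    Submodule (Smooth p₀) (Alg p₀ p₁) := weightPart _ _ Gen.trigh d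

/-- The elements of total resolution degree `m`. -/
def resPart (p₀ : ι₀ → ZMod 2) (p₁ : ι₁ → ZMod 2) (m : ℕ) :
    Submodule (Smooth p₀) (Alg p₀ p₁) := weightPart _ _ Gen.res m

/-- `𝒜₊`: sums of elements of ghost tridegrees `(i, j, k)` with `i, j, k ≥ 0`. -/
def algNonneg (p₀ : ι₀ → ZMod 2) (p₁ : ι₁ → ZMod 2) : Submodule (Smooth p₀) (Alg p₀ p₁) :=
  ⨆ d ∈ {d : Fin 3 → ℤ | 0 ≤ d}, trighPart p₀ p₁ d

/-- `𝒜₊₊`: sums of elements of ghost tridegrees `(i, j, k)` with `i, j, k ≥ 0` and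
`i + j + k > 0`. -/
def algPos (p₀ : ι₀ → ZMod 2) (p₁ : ι₁ → ZMod 2) : Submodule (Smooth p₀) (Alg p₀ p₁) :=
  ⨆ d ∈ {d : Fin 3 → ℤ | 0 ≤ d ∧ 0 < ∑ a, d a}, trighPart p₀ p₁ d

theorem coeff_mem_parity {p₀ : ι₀ → ZMod 2} (p₁ : ι₁ → ZMod 2) {c : ZMod 2} {F : FieldAlg p₀}
    (hF : F ∈ parityPart _ _ c) : coeff p₀ p₁ F ∈ parityPart _ _ c := by
  induction hF using Submodule.span_induction with
  | mem x h =>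
    obtain ⟨l, rfl, rfl⟩ := h
    refine Submodule.subset_span ⟨l.map Gen.odd, ?_, ?_⟩
    · simp [Function.comp_def, Gen.parity]
    · rw [map_list_prod, List.map_map, List.map_map]
      congr 2
      ext i
      simp [coeff_gen, Alg.of]
  | zero => simp
  | add x y _ _ hx hy => rw [map_add]; exact add_mem hx hy
  | smul b x _ hx => rw [map_smul]; exact Submodule.smul_mem _ _ hx

theorem of_mem_parity {p₀ : ι₀ → ZMod 2} {p₁ : ι₁ → ZMod 2} (g : Gen p₀ ι₁) :
    Alg.of p₀ p₁ g ∈ parityPart _ _ (g.parity p₀ p₁) := gen_mem g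

end Spectrum

/-- The completely antisymmetric symbol with `ε_{123} = 1` (indices `0, 1, 2` here). -/
def eps (a b c : Fin 3) : ℤ :=
  if b = a + 1 ∧ c = a + 2 then 1 else if b = a + 2 ∧ c = a + 1 then -1 else 0

/-! ### The Koszul-Tate differentials -/

namespace GaugeTheory

variable {ι₀ ι₁ : Type*} [Fintype ι₀] [DecidableEq ι₀] {p₀ : ι₀ → ZMod 2} {p₁ : ι₁ → ZMod 2}

/-- Weak equality to zero: `F` vanishes on the stationary surface `Σ : δ^R S₀ / δΦ^i = 0`, i.e.
it is a combination of the field equations. -/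
def WeaklyZero (T : GaugeTheory p₀ p₁) (F : FieldAlg p₀) : Prop :=
  ∃ g : ι₀ → FieldAlg p₀, F = ∑ i, derivR p₀ i T.S₀ * g i

/-- Irreducibility: every solution `f` of `Z^i_α f^α ≈ 0` is trivial,
`f^α = (δ^R S₀ / δΦ^i) f^{i α}`. -/
def Irreducible [Fintype ι₁] (T : GaugeTheory p₀ p₁) : Prop :=
  ∀ f : ι₁ → FieldAlg p₀, (∀ i, T.WeaklyZero (∑ α, T.Z i α * f α)) →
    ∃ g : ι₀ → ι₁ → FieldAlg p₀, ∀ α, f α = ∑ i, derivR p₀ i T.S₀ * g i α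

/-- Completeness of the gauge generators and regularity of the field equations (the rank
condition of the antifield formalism): at each point of the stationary surface, every null vector
of the Hessian of the action is a combination of the gauge generators. (Conversely, gauge
invariance makes the gauge generators null vectors there.) -/
def CompleteRegular [Fintype ι₁] (T : GaugeTheory p₀ p₁) : Prop :=
  ∀ x : Body p₀, (∀ i, (body p₀ (derivR p₀ i T.S₀)).1 x = 0) →
    ∀ v : ι₀ → ℂ, (∀ j, ∑ i, (body p₀ (derivL p₀ j (derivR p₀ i T.S₀))).1 x * v i = 0) →
      ∃ w : ι₁ → ℂ, ∀ i, v i = ∑ α, (body p₀ (T.Z i α)).1 x * w α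

/-- The sum `y_i Z^i_α` over `i`, for generators `y_i`. -/
def contractZ (T : GaugeTheory p₀ p₁) (y : ι₀ → Gen p₀ ι₁) (α : ι₁) : Alg p₀ p₁ :=
  ∑ i, Alg.of p₀ p₁ (y i) * coeff p₀ p₁ (T.Z i α)

/-- The values `δ_a Φ*^(a)_A`. -/
def source (T : GaugeTheory p₀ p₁) : Fin 3 → Field ι₀ ι₁ → Alg p₀ p₁
  | _, .phi i => -coeff p₀ p₁ (derivL p₀ i T.S₀)
  | _, .eta c α => sgn (p₁ α) • T.contractZ (fun i => .star c (.phi i)) α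
  | _, .pi c α => sgn (p₁ α + 1) •
      ((∑ d, ∑ e, eps c d e • Alg.of p₀ p₁ (.star d (.eta e α))) +
        T.contractZ (fun i => .bar c (.phi i)) α)
  | _, .lam α => sgn (p₁ α + 1) •
      ((∑ d, (Alg.of p₀ p₁ (.star d (.pi d α)) + Alg.of p₀ p₁ (.bar d (.eta d α)))) -
        T.contractZ (fun i => .tilde (.phi i)) α)

/-- The values of `δ_a` on the generators; the fields and the ghosts are annihilated. -/
def deltaVal (T : GaugeTheory p₀ p₁) (a : Fin 3) : Gen p₀ ι₁ → Alg p₀ p₁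
  | .odd _ => 0
  | .ghost _ => 0
  | .star b A => if a = b then T.source a A else 0
  | .bar b A => sgn (A.parity p₀ p₁) • ∑ c, eps a b c • Alg.of p₀ p₁ (.star c A)
  | .tilde A => sgn (A.parity p₀ p₁ + 1) • Alg.of p₀ p₁ (.bar a A)

theorem contractZ_mem_parity (T : GaugeTheory p₀ p₁) (y : ι₀ → Gen p₀ ι₁) (α : ι₁) (c : ZMod 2)
    (hy : ∀ i, (y i).parity p₀ p₁ + p₀ i = c) :
    T.contractZ y α ∈ parityPart _ _ (c + p₁ α) := by
  refine sum_mem fun i _ => ?_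
  rw [← hy i, add_assoc]
  exact mul_mem_parity (of_mem_parity _) (coeff_mem_parity p₁ (T.Z_parity i α))

theorem source_mem_parity (T : GaugeTheory p₀ p₁) (a : Fin 3) (A : Field ι₀ ι₁) :
    T.source a A ∈ parityPart _ _ (A.parity p₀ p₁) := by
  have two (c : ZMod 2) : c + c = 0 := by revert c; decide
  cases A with
  | phi i =>
    have h := coeff_mem_parity p₁ (derivL_mem_parity p₀ i T.S₀_even)
    rw [add_zero] at h
    exact neg_mem h
  | eta c α =>
    have h := T.contractZ_mem_parity (fun i => .star c (.phi i)) α 1 (fun i => by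
      simp only [Gen.parity, Field.parity]
      rw [add_right_comm, two, zero_add])
    rw [add_comm] at h
    exact zsmul_mem h _
  | pi c α =>
    have h := T.contractZ_mem_parity (fun i => .bar c (.phi i)) α 0 (fun i => two _)
    rw [zero_add] at h
    refine zsmul_mem (add_mem (sum_mem fun d _ => sum_mem fun e _ => zsmul_mem ?_ _) h) _
    have h' := of_mem_parity (p₁ := p₁) (.star d (.eta e α) : Gen p₀ ι₁)
    simp only [Gen.parity, Field.parity] at h'
    rwa [add_assoc, two, add_zero] at h'
  | lam α =>
    have h := T.contractZ_mem_parity (fun i => .tilde (.phi i)) α 1 (fun i => by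
      simp only [Gen.parity, Field.parity]
      rw [add_right_comm, two, zero_add])
    rw [add_comm] at h
    exact zsmul_mem (sub_mem (sum_mem fun d _ =>
      add_mem (of_mem_parity (.star d (.pi d α))) (of_mem_parity (.bar d (.eta d α)))) h) _

theorem deltaVal_mem_parity (T : GaugeTheory p₀ p₁) (a : Fin 3) (g : Gen p₀ ι₁) :
    T.deltaVal a g ∈ parityPart _ _ (g.parity p₀ p₁ + 1) := by
  have two (c : ZMod 2) : c + 1 + 1 = c := by revert c; decide
  cases g with
  | odd i => exact zero_mem _
  | ghost c => exact zero_mem _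
  | star b A =>
    simp only [deltaVal, Gen.parity]
    rw [two]
    split_ifs
    · exact T.source_mem_parity a A
    · exact zero_mem _
  | bar b A => exact zsmul_mem (sum_mem fun c _ => zsmul_mem (of_mem_parity (.star c A)) _) _
  | tilde A =>
    simp only [deltaVal, Gen.parity]
    rw [two]
    exact zsmul_mem (of_mem_parity (.bar a A)) _

/-- The Koszul-Tate differential `δ_a` on `𝒜`. -/
def delta (T : GaugeTheory p₀ p₁) (a : Fin 3) : Alg p₀ p₁ →ₗ[Smooth p₀] Alg p₀ p₁ :=
  rightDer (T.deltaVal a) (T.deltaVal_mem_parity a)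

/-- The extended Koszul-Tate differential `δ = δ₁ + δ₂ + δ₃`. -/
def totalDelta (T : GaugeTheory p₀ p₁) : Alg p₀ p₁ →ₗ[Smooth p₀] Alg p₀ p₁ :=
  ∑ a, T.delta a

end GaugeTheory

end

end Sp3

/-! # The positivity theorem for the extended Koszul-Tate differential

The proof has an algebraic and an analytic half, joined by the statement `GaugeTheory.DeltaExact`:
each of the three differentials `δ_a` is exact in positive total resolution degree.

*From `δ_a` to `δ`.* The three `δ_a` anticommute, and `δ_a` lowers the `a`-th component of the
resolution tridegree `r` by one and keeps the tridegree `D` in the ghosts, so that `D` may be fixed.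
As the ghost tridegree is `D - r`, the elements of nonnegative ghost tridegree are those with `r` in
the box `r ≤ D`, and those of positive ghost tridegree stay off the corner `r = D`. Exactness of the
total differential on the complex truncated to a box, in total degrees strictly between zero and
the top, follows from that of the `δ_a` by induction on the number of directions
(`ExactTricomplex.exact_boxSet`): without a bound in the last direction `a` a preimage is built from
the exactness of `δ_a` alone, and its slices beyond the bound are cycles of the sum of the other
differentials, so that they can be removed from the top by the induction hypothesis.

*Localization.* In fixed resolution degree and number of ghosts the preimages form a finitely
generated module over the smooth functions. Linear functionals separate the elements of the
superalgebra, so that the coefficients of a preimage are subject to affine conditions at each point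
of the body, and local solutions glue by a partition of unity
(`GaugeTheory.deltaExact_of_locally`). It remains to show, at each point `x`, that cycles become
boundaries after multiplication by a function that does not vanish at `x`. Where some field equation
fails, the antifield of the field provides a contraction (`GaugeTheory.locallyExactAt_of_ne`).

*On the stationary surface.* Let `I` be a maximal set of fields whose columns of the Hessian are
independent at `x`. By completeness the gauge generators, in the rows outside `I`, have the largest
possible rank. Irreducibility makes their columns independent: a null vector `w` at `x` extends to
superfunctions `f` with body `w` at `x` that solve `Z f = 0` exactly outside `I`; then the Noether
identities and the nondegeneracy of the Hessian on `I` give `Z f ≈ 0`, up to a factor, hence `f ≈ 0`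
and `w = 0` (`GaugeTheory.exists_gauge_split`). The resulting local inverses are collected in
`GaugeTheory.ShellData`.

A filtration, bounded above in each resolution degree, reduces `δ_a` to its leading part
(`mem_satRange_of_leading`), in which the odd field equations in `I` are linear, the gauge
generators are replaced by their bodies outside `I`, and all other equations are dropped but the
even ones in `I`. Explicit inverses contract this leading part, up to a nonvanishing factor, onto
the Koszul complex of the even field equations in `I`, with inert odd fields and ghosts
(`GaugeTheory.ShellData.lead_contr`). These equations are given by real functions with independent
differentials, as the body of the action is real. By the inverse function theorem and Hadamard's
lemma they form a regular sequence near `x` (`exists_mul_eq_sum`), so that the Koszul complex is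
exact (`koszul_exact`).
-/

namespace Sp3

noncomputable section

/-! ### Monomials, weights and projections in free supercommutative algebras -/

section Words

variable {B : Type*} [CommRing B] {G : Type*} {p : G → ZMod 2}

variable (B p) in
/-- The product of a word in the generators. -/
def mon (l : List G) : SuperPoly B p := (l.map (gen B p)).prod

@[simp] theorem mon_nil : mon B p [] = 1 := rfl

@[simp] theorem mon_cons (g : G) (l : List G) : mon B p (g :: l) = gen B p g * mon B p l := by
  simp [mon]

theorem mon_append (l l' : List G) : mon B p (l ++ l') = mon B p l * mon B p l' := by
  simp [mon]

theorem mon_singleton (g : G) : mon B p [g] = gen B p g := by simp [mon]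

variable (B p) in
/-- The `B`-span of the monomials whose weight lies in the set `U`. -/
def wspan {M : Type*} [AddCommMonoid M] (w : G → M) (U : Set M) : Submodule B (SuperPoly B p) :=
  Submodule.span B {x | ∃ l : List G, (l.map w).sum ∈ U ∧ x = mon B p l}

variable {M : Type*} [AddCommMonoid M] {w : G → M}

theorem weightPart_eq_wspan (w : G → M) (d : M) : weightPart B p w d = wspan B p w {d} := rfl

theorem mon_mem_wspan {l : List G} {U : Set M} (h : (l.map w).sum ∈ U) :
    mon B p l ∈ wspan B p w U :=
  Submodule.subset_span ⟨l, h, rfl⟩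

theorem gen_mem_wspan {g : G} {U : Set M} (h : w g ∈ U) : gen B p g ∈ wspan B p w U := by
  rw [← mon_singleton]
  exact mon_mem_wspan (by simpa using h)

theorem one_mem_wspan {U : Set M} (h : (0 : M) ∈ U) : (1 : SuperPoly B p) ∈ wspan B p w U :=
  mon_mem_wspan (l := []) (by simpa using h)

/-- To check a linear property on `wspan w U` it is enough to check it on monomials. -/
theorem wspan_induction {U : Set M} {N : Submodule B (SuperPoly B p)}
    (h : ∀ l : List G, (l.map w).sum ∈ U → mon B p l ∈ N) {x : SuperPoly B p}
    (hx : x ∈ wspan B p w U) : x ∈ N := by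
  refine (Submodule.span_le.2 ?_ : wspan B p w U ≤ N) hx
  rintro _ ⟨l, hl, rfl⟩
  exact h l hl

theorem wspan_mono {U U' : Set M} (h : U ⊆ U') : wspan B p w U ≤ wspan B p w U' :=
  fun _ hx => wspan_induction (fun _ hl => mon_mem_wspan (h hl)) hx

theorem wspan_empty : wspan B p w ∅ = ⊥ :=
  eq_bot_iff.2 fun _ hx => wspan_induction (fun _ hl => hl.elim) hx

/-- Two linear maps that agree on monomials of weight in `U` agree on `wspan w U`. -/
theorem linearMap_eq_on_wspan {X : Type*} [AddCommGroup X] [Module B X] {U : Set M}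
    {f f' : SuperPoly B p →ₗ[B] X}
    (h : ∀ l : List G, (l.map w).sum ∈ U → f (mon B p l) = f' (mon B p l)) {x : SuperPoly B p}
    (hx : x ∈ wspan B p w U) : f x = f' x :=
  wspan_induction (N := LinearMap.eqLocus f f') h hx

variable (B p w) in
/-- The monomials span the whole algebra. -/
theorem mem_wspan_univ (x : SuperPoly B p) : x ∈ wspan B p w Set.univ := by
  obtain ⟨x, rfl⟩ := proj_surjective x
  have mul_mem {x y : SuperPoly B p} (hx : x ∈ wspan B p w Set.univ)
      (hy : y ∈ wspan B p w Set.univ) : x * y ∈ wspan B p w Set.univ := by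
    have h := Submodule.mul_mem_mul hx hy
    rw [wspan, Submodule.span_mul_span] at h
    refine Submodule.span_mono ?_ h
    rintro _ ⟨_, ⟨l, -, rfl⟩, _, ⟨l', -, rfl⟩, rfl⟩
    exact ⟨l ++ l', trivial, (mon_append _ _).symm⟩
  induction x using FreeAlgebra.induction with
  | grade0 b =>
    rw [AlgHom.commutes, Algebra.algebraMap_eq_smul_one]
    exact Submodule.smul_mem _ _ (one_mem_wspan trivial)
  | grade1 g => exact gen_mem_wspan (g := g) trivial
  | mul x y hx hy => rw [map_mul]; exact mul_mem hx hy
  | add x y hx hy => rw [map_add]; exact add_mem hx hy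

theorem linearMap_ext_mon {X : Type*} [AddCommGroup X] [Module B X]
    {f f' : SuperPoly B p →ₗ[B] X} (h : ∀ l : List G, f (mon B p l) = f' (mon B p l)) : f = f' :=
  LinearMap.ext fun x => linearMap_eq_on_wspan (w := fun _ => (0 : ℕ)) (fun l _ => h l)
    (mem_wspan_univ B p _ x)

theorem mul_mem_wspan {U U' U'' : Set M} (h : ∀ u ∈ U, ∀ u' ∈ U', u + u' ∈ U'')
    {x y : SuperPoly B p} (hx : x ∈ wspan B p w U) (hy : y ∈ wspan B p w U') :
    x * y ∈ wspan B p w U'' := by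
  have hm := Submodule.mul_mem_mul hx hy
  rw [wspan, wspan, Submodule.span_mul_span] at hm
  refine Submodule.span_mono ?_ hm
  rintro _ ⟨_, ⟨l, hl, rfl⟩, _, ⟨l', hl', rfl⟩, rfl⟩
  exact ⟨l ++ l', by simpa using h _ hl _ hl', (mon_append _ _).symm⟩

variable (B p w) in
/-- The homomorphism that marks each monomial with its weight. -/
def weightHom : SuperPoly B p →ₐ[B] AddMonoidAlgebra (SuperPoly B p) M :=
  lift (fun g => AddMonoidAlgebra.single (w g) (gen B p g)) (fun g h => by
    rw [AddMonoidAlgebra.single_mul_single, AddMonoidAlgebra.single_mul_single, gen_swap g h,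
      add_comm, AddMonoidAlgebra.smul_single])

theorem weightHom_mon (l : List G) :
    weightHom B p w (mon B p l) = AddMonoidAlgebra.single (l.map w).sum (mon B p l) := by
  induction l with
  | nil => simp [AddMonoidAlgebra.one_def]
  | cons g l ih =>
    rw [mon_cons, map_mul, ih, weightHom, lift_gen, AddMonoidAlgebra.single_mul_single]
    simp

open Classical in
variable (B p w) in
/-- The projection onto the span of the monomials of weight in `U`. -/
def projU (U : Set M) : SuperPoly B p →ₗ[B] SuperPoly B p :=
  (Finsupp.lsum B fun d => if d ∈ U then LinearMap.id else 0) ∘ₗ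
    ({ toFun := fun x => x.coeff
       map_add' := fun _ _ => rfl
       map_smul' := fun _ _ => rfl } :
      AddMonoidAlgebra (SuperPoly B p) M →ₗ[B] (M →₀ SuperPoly B p)) ∘ₗ
    (weightHom B p w).toLinearMap

open Classical in
theorem projU_mon (U : Set M) (l : List G) :
    projU B p w U (mon B p l) = if (l.map w).sum ∈ U then mon B p l else 0 := by
  simp only [projU, LinearMap.comp_apply, AlgHom.toLinearMap_apply, weightHom_mon]
  refine (Finsupp.lsum_single B _ _ _).trans ?_
  split_ifs <;> rfl

theorem projU_of_mem {U V : Set M} (h : U ⊆ V) {x : SuperPoly B p} (hx : x ∈ wspan B p w U) :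
    projU B p w V x = x :=
  linearMap_eq_on_wspan (f' := LinearMap.id)
    (fun l hl => by rw [projU_mon, if_pos (h hl)]; rfl) hx

theorem projU_of_disjoint {U V : Set M} (h : Disjoint U V) {x : SuperPoly B p}
    (hx : x ∈ wspan B p w U) : projU B p w V x = 0 :=
  linearMap_eq_on_wspan (f' := 0)
    (fun l hl => by rw [projU_mon, if_neg (Set.disjoint_left.1 h hl)]; rfl) hx

/-- The projection to the weights in `U` preserves the conditions on another weight `w'`. -/
theorem projU_mem_inter {M' : Type*} [AddCommMonoid M'] {w' : G → M'} {V : Set M'} (U : Set M)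
    {x : SuperPoly B p} (hx : x ∈ wspan B p w' V) :
    projU B p w U x ∈ wspan B p (fun g => (w g, w' g)) (U ×ˢ V) := by
  refine wspan_induction
    (N := (wspan B p (fun g => (w g, w' g)) (U ×ˢ V)).comap (projU B p w U)) (fun l hl => ?_) hx
  rw [Submodule.mem_comap, projU_mon]
  split_ifs with h
  · refine mon_mem_wspan ?_
    have e : (l.map fun g => (w g, w' g)).sum = ((l.map w).sum, (l.map w').sum) := by
      clear hl h
      induction l with
      | nil => rfl
      | cons g l ih => simp [ih]
    rw [e]
    exact ⟨h, hl⟩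
  · exact zero_mem _

theorem projU_mem_wspan_inter {U V : Set M} {x : SuperPoly B p} (hx : x ∈ wspan B p w V) :
    projU B p w U x ∈ wspan B p w (U ∩ V) := by
  refine wspan_induction
    (N := (wspan B p w (U ∩ V)).comap (projU B p w U)) (fun l hl => ?_) hx
  rw [Submodule.mem_comap, projU_mon]
  split_ifs with h
  · exact mon_mem_wspan ⟨h, hl⟩
  · exact zero_mem _

theorem projU_mem (U : Set M) (x : SuperPoly B p) : projU B p w U x ∈ wspan B p w U :=
  wspan_mono Set.inter_subset_left (projU_mem_wspan_inter (mem_wspan_univ B p w x))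

theorem projU_add_compl (U : Set M) (x : SuperPoly B p) :
    projU B p w U x + projU B p w Uᶜ x = x := by
  refine linearMap_eq_on_wspan (f := projU B p w U + projU B p w Uᶜ) (f' := LinearMap.id)
    (fun l _ => ?_) (mem_wspan_univ B p w x)
  rw [LinearMap.add_apply, projU_mon, projU_mon]
  by_cases h : (l.map w).sum ∈ U <;> simp [h]

/-- A weight may be replaced by its image under an additive map. -/
theorem wspan_comp {M' : Type*} [AddCommMonoid M'] (f : M →+ M') (U : Set M') :
    wspan B p (fun g => f (w g)) U = wspan B p w (f ⁻¹' U) := by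
  have e (l : List G) : (l.map fun g => f (w g)).sum = f (l.map w).sum := by
    rw [map_list_sum, List.map_map]; rfl
  simp only [wspan, e, Set.mem_preimage]

end Words

/-! ### Right superderivations -/

section Derivations

variable {B : Type*} [CommRing B] {G : Type*} {p : G → ZMod 2}

variable (B p) in
/-- The automorphism `x ↦ (-1) ^ (c * parity of x) x`. -/
def tw (c : ZMod 2) : SuperPoly B p →ₐ[B] SuperPoly B p :=
  if c = 0 then AlgHom.id B _ else parityAut B p

theorem tw_zero (x : SuperPoly B p) : tw B p 0 x = x := rfl

theorem tw_one : tw B p 1 = parityAut B p := rfl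

theorem sgn_zero : sgn 0 = 1 := rfl

theorem sgn_one : sgn 1 = -1 := rfl

theorem tw_of_mem {a : ZMod 2} (c : ZMod 2) {x : SuperPoly B p} (hx : x ∈ parityPart B p a) :
    tw B p c x = sgn (c * a) • x := by
  fin_cases c
  · change x = sgn (0 * a) • x
    simp [sgn_zero]
  · change parityAut B p x = sgn (1 * a) • x
    rw [one_mul, parityAut_of_mem hx]

theorem mon_mem_parity (l : List G) : mon B p l ∈ parityPart B p (l.map p).sum :=
  Submodule.subset_span ⟨l, rfl, rfl⟩

theorem tw_mon (c : ZMod 2) (l : List G) :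
    tw B p c (mon B p l) = sgn (c * (l.map p).sum) • mon B p l :=
  tw_of_mem c (mon_mem_parity l)

theorem tw_mem_wspan {M : Type*} [AddCommMonoid M] {w : G → M} {U : Set M} (c : ZMod 2)
    {x : SuperPoly B p} (hx : x ∈ wspan B p w U) : tw B p c x ∈ wspan B p w U := by
  refine wspan_induction (N := (wspan B p w U).comap (tw B p c).toLinearMap) (fun l hl => ?_) hx
  change tw B p c (mon B p l) ∈ wspan B p w U
  rw [tw_mon]
  exact zsmul_mem (mon_mem_wspan (B := B) (p := p) hl) _

theorem tw_tw (c c' : ZMod 2) (x : SuperPoly B p) : tw B p c (tw B p c' x) = tw B p (c + c') x := by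
  refine LinearMap.congr_fun (f := (tw B p c).toLinearMap ∘ₗ (tw B p c').toLinearMap)
    (g := (tw B p (c + c')).toLinearMap) (linearMap_ext_mon fun l => ?_) x
  change tw B p c (tw B p c' (mon B p l)) = tw B p (c + c') (mon B p l)
  rw [tw_mon, map_zsmul, tw_mon, tw_mon, smul_smul, add_mul, sgn_add, mul_comm]

theorem mul_gen_swap (x : SuperPoly B p) (g : G) :
    x * gen B p g = gen B p g * tw B p (p g) x := by
  refine LinearMap.congr_fun (f := LinearMap.mulRight B (gen B p g))
    (g := LinearMap.mulLeft B (gen B p g) ∘ₗ (tw B p (p g)).toLinearMap)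
    (linearMap_ext_mon fun l => ?_) x
  change mon B p l * gen B p g = gen B p g * tw B p (p g) (mon B p l)
  rw [tw_mon, swap_gen (mon_mem_parity l), mul_smul_comm, mul_comm (p g)]

theorem gen_mul_swap (x : SuperPoly B p) (g : G) :
    gen B p g * x = tw B p (p g) x * gen B p g := by
  rw [mul_gen_swap, tw_tw]
  have : p g + p g = 0 := CharTwo.add_self_eq_zero _
  rw [this, tw_zero]

/-- An element of parity `a` commutes past every element up to the sign rule. -/
theorem mul_swap_of_mem {a : ZMod 2} {z : SuperPoly B p} (hz : z ∈ parityPart B p a)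
    (x : SuperPoly B p) : x * z = z * tw B p a x := by
  refine LinearMap.congr_fun (f := LinearMap.mulRight B z)
    (g := LinearMap.mulLeft B z ∘ₗ (tw B p a).toLinearMap) (linearMap_ext_mon fun l => ?_) x
  change mon B p l * z = z * tw B p a (mon B p l)
  induction l with
  | nil => simp
  | cons g l ih =>
    rw [mon_cons, mul_assoc, ih, map_mul, ← mul_assoc, ← mul_assoc,
      tw_of_mem a (gen_mem g), mul_smul_comm, swap_gen hz, smul_smul, sgn_mul_self, one_smul]

/-- `D` is a right superderivation of parity `c` over `B`:
`D (x y) = x D y + (-1) ^ (c * parity of y) (D x) y`. -/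
def IsRightDer (c : ZMod 2) (D : SuperPoly B p →ₗ[B] SuperPoly B p) : Prop :=
  ∀ x y, D (x * y) = x * D y + D x * tw B p c y

theorem isRightDer_rightDer (X : G → SuperPoly B p) (hX : ∀ g, X g ∈ parityPart B p (p g + 1)) :
    IsRightDer 1 (rightDer X hX) :=
  fun x y => rightDer_mul X hX x y

namespace IsRightDer

variable {c c' : ZMod 2} {D D' : SuperPoly B p →ₗ[B] SuperPoly B p}

theorem map_one (h : IsRightDer c D) : D 1 = 0 := by
  have := h 1 1
  simpa using this

theorem add (h : IsRightDer c D) (h' : IsRightDer c D') : IsRightDer c (D + D') := fun x y => by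
  simp only [LinearMap.add_apply, h x y, h' x y, mul_add, add_mul]
  abel

theorem neg (h : IsRightDer c D) : IsRightDer c (-D) := fun x y => by
  simp only [LinearMap.neg_apply, h x y, mul_neg, neg_mul, neg_add]

theorem sub (h : IsRightDer c D) (h' : IsRightDer c D') : IsRightDer c (D - D') := by
  rw [sub_eq_add_neg]; exact h.add h'.neg

theorem sum {κ : Type*} (s : Finset κ) {E : κ → SuperPoly B p →ₗ[B] SuperPoly B p}
    (h : ∀ k ∈ s, IsRightDer c (E k)) : IsRightDer c (∑ k ∈ s, E k) := by
  classical
  induction s using Finset.induction_on with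
  | empty => intro x y; simp
  | insert k s hk ih =>
    rw [Finset.sum_insert hk]
    exact (h k (by simp)).add (ih fun j hj => h j (by simp [hj]))

theorem eq_zero (h : IsRightDer c D) (hg : ∀ g, D (gen B p g) = 0) : D = 0 := by
  refine linearMap_ext_mon fun l => ?_
  induction l with
  | nil => simp [h.map_one]
  | cons g l ih => rw [mon_cons, h, hg, ih]; simp

theorem ext (h : IsRightDer c D) (h' : IsRightDer c D')
    (hg : ∀ g, D (gen B p g) = D' (gen B p g)) : D = D' :=
  sub_eq_zero.1 ((h.sub h').eq_zero fun g => by simp [hg])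

/-- A derivation that moves the weights of the generators by elements of `U'` moves all weights by
elements of `U'`. -/
theorem mem_wspan {M : Type*} [AddCommGroup M] {w : G → M} (h : IsRightDer c D) {U' : Set M}
    (hg : ∀ g, D (gen B p g) ∈ wspan B p w {d | d - w g ∈ U'}) {U U'' : Set M}
    (hU : ∀ u ∈ U, ∀ u' ∈ U', u + u' ∈ U'') {x : SuperPoly B p} (hx : x ∈ wspan B p w U) :
    D x ∈ wspan B p w U'' := by
  refine wspan_induction (N := (wspan B p w U'').comap D) (fun l hl => ?_) hx
  rw [Submodule.mem_comap]
  have key : D (mon B p l) ∈ wspan B p w {d | d - (l.map w).sum ∈ U'} := by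
    clear hl
    induction l with
    | nil => rw [mon_nil, h.map_one]; exact zero_mem _
    | cons g l ih =>
      rw [mon_cons, h]
      refine add_mem (mul_mem_wspan ?_ (gen_mem_wspan (U := {w g}) rfl) ih)
        (mul_mem_wspan ?_ (hg g) (tw_mem_wspan c (mon_mem_wspan (U := {(l.map w).sum}) rfl)))
      · rintro _ rfl u hu
        simpa [List.sum_cons, add_sub_add_left_eq_sub] using hu
      · rintro u hu _ rfl
        simpa [List.sum_cons, add_sub_add_right_eq_sub] using hu
  exact wspan_mono (fun d hd => by simpa using hU _ hl _ hd) key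

/-- A derivation that moves all weights by `e` commutes with the projections. -/
theorem projU_comm {M : Type*} [AddCommGroup M] {w : G → M} (h : IsRightDer c D) {e : M}
    (hg : ∀ g, D (gen B p g) ∈ wspan B p w {w g + e}) (U : Set M) (x : SuperPoly B p) :
    projU B p w U (D x) = D (projU B p w {d | d + e ∈ U} x) := by
  refine LinearMap.congr_fun (f := projU B p w U ∘ₗ D)
    (g := D ∘ₗ projU B p w {d | d + e ∈ U}) (linearMap_ext_mon fun l => ?_) x
  have hD : D (mon B p l) ∈ wspan B p w {(l.map w).sum + e} :=
    h.mem_wspan (U := {(l.map w).sum}) (U' := {e})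
      (fun g => wspan_mono (by rintro _ rfl; simp) (hg g))
      (by rintro _ rfl _ rfl; rfl) (mon_mem_wspan rfl)
  simp only [LinearMap.comp_apply, projU_mon]
  split_ifs with hl
  · exact projU_of_mem (by simpa using hl) hD
  · rw [map_zero]; exact projU_of_disjoint (by simpa using hl) hD

/-- An Euler operator: an even derivation that rescales the generators rescales monomials by
their total weight. -/
theorem euler (h : IsRightDer 0 D) {w : G → ℤ} {ρ : B}
    (hg : ∀ g, D (gen B p g) = w g • ρ • gen B p g) {n : ℤ} {x : SuperPoly B p}
    (hx : x ∈ wspan B p w {n}) : D x = n • ρ • x := by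
  refine linearMap_eq_on_wspan (f := D) (f' := n • ρ • LinearMap.id) (fun l hl => ?_) hx
  rw [Set.mem_singleton_iff] at hl
  subst hl
  clear hx
  change D (mon B p l) = (l.map w).sum • ρ • mon B p l
  induction l with
  | nil => simp [h.map_one]
  | cons g l ih =>
    rw [mon_cons, h, hg, ih, tw_zero, List.map_cons, List.sum_cons, add_smul]
    simp only [mul_smul_comm, smul_mul_assoc]
    abel

/-- The supercommutation of a derivation with the parity automorphism. -/
theorem tw_apply (h : IsRightDer c D) (hp : ∀ g, D (gen B p g) ∈ parityPart B p (p g + c))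
    (a : ZMod 2) (x : SuperPoly B p) : tw B p a (D x) = sgn (a * c) • D (tw B p a x) := by
  refine LinearMap.congr_fun (f := (tw B p a).toLinearMap ∘ₗ D)
    (g := sgn (a * c) • (D ∘ₗ (tw B p a).toLinearMap)) (linearMap_ext_mon fun l => ?_) x
  simp only [LinearMap.comp_apply, LinearMap.smul_apply, AlgHom.toLinearMap_apply]
  have hp' (g : G) : D (gen B p g) ∈ wspan B p p {d | d - p g ∈ ({c} : Set (ZMod 2))} :=
    wspan_mono (U := {p g + c}) (by rintro _ rfl; simp) (hp g)
  have hD : D (mon B p l) ∈ wspan B p p {(l.map p).sum + c} :=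
    h.mem_wspan (U := {(l.map p).sum}) hp' (by rintro _ rfl _ rfl; rfl) (mon_mem_wspan rfl)
  rw [tw_of_mem a hD, tw_mon, map_zsmul, smul_smul, mul_add, sgn_add, mul_comm]

/-- The supercommutator of two superderivations is a superderivation. -/
theorem supercomm (h : IsRightDer c D) (hp : ∀ g, D (gen B p g) ∈ parityPart B p (p g + c))
    (h' : IsRightDer c' D') (hp' : ∀ g, D' (gen B p g) ∈ parityPart B p (p g + c')) :
    IsRightDer (c + c') (D ∘ₗ D' - sgn (c * c') • (D' ∘ₗ D)) := fun x y => by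
  have e1 : D (tw B p c' y) = sgn (c * c') • tw B p c' (D y) := by
    rw [h.tw_apply hp, smul_smul, mul_comm c', sgn_mul_self, one_smul]
  have e2 : D' (tw B p c y) = sgn (c * c') • tw B p c (D' y) := by
    rw [h'.tw_apply hp', smul_smul, sgn_mul_self, one_smul]
  have e3 : tw B p c' (tw B p c y) = tw B p (c + c') y := by rw [tw_tw, add_comm]
  have e4 : tw B p c (tw B p c' y) = tw B p (c + c') y := tw_tw _ _ _
  simp only [LinearMap.sub_apply, LinearMap.smul_apply, LinearMap.comp_apply, h x y, h' x y,
    map_add, h x, h _ (tw B p c' y), h' x, h' _ (tw B p c y), e1, e2, e3, e4, smul_add,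
    mul_smul_comm, mul_sub, sub_mul, smul_mul_assoc, smul_smul, sgn_mul_self, one_smul]
  abel

/-- Odd derivations anticommute if they do so on the generators. -/
theorem anticomm (h : IsRightDer 1 D) (hp : ∀ g, D (gen B p g) ∈ parityPart B p (p g + 1))
    (h' : IsRightDer 1 D') (hp' : ∀ g, D' (gen B p g) ∈ parityPart B p (p g + 1)) :
    IsRightDer 0 (D ∘ₗ D' + D' ∘ₗ D) := by
  have := h.supercomm hp h' hp'
  rwa [show sgn (1 * 1) = -1 from rfl, neg_smul, one_smul, sub_neg_eq_add,
    show (1 + 1 : ZMod 2) = 0 from rfl] at this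

end IsRightDer

/-- The homomorphism `x ↦ x + ε D x` that encodes the even derivation `D` with given values on the
generators. -/
def evenDerHom (X : G → SuperPoly B p) (hX : ∀ g, X g ∈ parityPart B p (p g)) :
    SuperPoly B p →ₐ[B] DualNumber (SuperPoly B p) :=
  lift (fun g => TrivSqZeroExt.inl (gen B p g) + TrivSqZeroExt.inr (X g)) (fun g h => by
    ext
    · simp [gen_swap g h]
    · have h2 : gen B p g * X h = sgn (p g * p h) • (X h * gen B p g) := by
        rw [swap_gen (hX h) g, smul_smul, mul_comm (p h), sgn_mul_self, one_smul]
      simp [swap_gen (hX g) h, h2]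
      rw [← mul_add, add_comm])

/-- The even derivation over `B` with given values on the generators. -/
def evenDer (X : G → SuperPoly B p) (hX : ∀ g, X g ∈ parityPart B p (p g)) :
    SuperPoly B p →ₗ[B] SuperPoly B p where
  toFun x := (evenDerHom X hX x).snd
  map_add' x y := by simp
  map_smul' b x := by simp

theorem evenDer_gen (X : G → SuperPoly B p) (hX : ∀ g, X g ∈ parityPart B p (p g)) (g : G) :
    evenDer X hX (gen B p g) = X g := by
  simp [evenDer, evenDerHom]

theorem evenDerHom_fst (X : G → SuperPoly B p) (hX : ∀ g, X g ∈ parityPart B p (p g))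
    (x : SuperPoly B p) : (evenDerHom X hX x).fst = x := by
  refine LinearMap.congr_fun
    (f := (TrivSqZeroExt.fstHom B (SuperPoly B p) (SuperPoly B p)).toLinearMap ∘ₗ
      (evenDerHom X hX).toLinearMap) (g := LinearMap.id) (linearMap_ext_mon fun l => ?_) x
  change (evenDerHom X hX (mon B p l)).fst = mon B p l
  induction l with
  | nil => simp
  | cons g l ih => rw [mon_cons, map_mul, TrivSqZeroExt.fst_mul, ih]; simp [evenDerHom]

theorem isRightDer_evenDer (X : G → SuperPoly B p) (hX : ∀ g, X g ∈ parityPart B p (p g)) :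
    IsRightDer 0 (evenDer X hX) := fun x y => by
  change (evenDerHom X hX (x * y)).snd =
    x * (evenDerHom X hX y).snd + (evenDerHom X hX x).snd * y
  rw [map_mul, TrivSqZeroExt.snd_mul, evenDerHom_fst, evenDerHom_fst]
  simp

open Classical in
variable (B p) in
/-- The right partial derivative with respect to a generator. -/
def pd (g : G) : SuperPoly B p →ₗ[B] SuperPoly B p :=
  if hg : p g = 0 then
    evenDer (fun h => if h = g then 1 else 0) (fun h => by
      split_ifs with e
      · rw [e, hg]; exact one_mem_parity
      · exact zero_mem _)
  else
    rightDer (fun h => if h = g then 1 else 0) (fun h => by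
      split_ifs with e
      · have h1 : p g + 1 = 0 := by
          revert hg; generalize p g = a; revert a; decide
        rw [e, h1]; exact one_mem_parity
      · exact zero_mem _)

theorem isRightDer_pd (g : G) : IsRightDer (p g) (pd B p g) := by
  unfold pd
  split_ifs with hg
  · rw [hg]; exact isRightDer_evenDer _ _
  · have h1 : p g = 1 := by revert hg; generalize p g = a; revert a; decide
    rw [h1]; exact isRightDer_rightDer _ _

open Classical in
theorem pd_gen (g h : G) : pd B p g (gen B p h) = if h = g then 1 else 0 := by
  unfold pd
  split_ifs with hg e e
  · rw [evenDer_gen, if_pos e]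
  · rw [evenDer_gen, if_neg e]
  · rw [rightDer_gen, if_pos e]
  · rw [rightDer_gen, if_neg e]

theorem pd_gen_mem_parity (g h : G) : pd B p g (gen B p h) ∈ parityPart B p (p h + p g) := by
  rw [pd_gen]
  split_ifs with e
  · rw [e, CharTwo.add_self_eq_zero]; exact one_mem_parity
  · exact zero_mem _

theorem pd_gen_mem_wspan {M : Type*} [AddCommGroup M] (w : G → M) (g h : G) :
    pd B p g (gen B p h) ∈ wspan B p w {w h + -w g} := by
  rw [pd_gen]
  split_ifs with e
  · rw [e]; exact one_mem_wspan (by simp)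
  · exact zero_mem _

theorem pd_mem_wspan {M : Type*} [AddCommGroup M] (w : G → M) (g : G) {U U' : Set M}
    (h : ∀ u ∈ U, u - w g ∈ U') {x : SuperPoly B p} (hx : x ∈ wspan B p w U) :
    pd B p g x ∈ wspan B p w U' :=
  (isRightDer_pd g).mem_wspan (U' := {-w g})
    (fun k => wspan_mono (by rintro _ rfl; simp) (pd_gen_mem_wspan w g k))
    (by rintro u hu _ rfl; simpa [sub_eq_add_neg] using h u hu) hx

/-- The Euler operator of a finite set of generators. -/
def eulerOp (s : Finset G) : SuperPoly B p →ₗ[B] SuperPoly B p :=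
  ∑ g ∈ s, LinearMap.mulRight B (gen B p g) ∘ₗ pd B p g

theorem eulerOp_apply (s : Finset G) (x : SuperPoly B p) :
    eulerOp s x = ∑ g ∈ s, pd B p g x * gen B p g := by
  simp [eulerOp]

theorem isRightDer_eulerOp (s : Finset G) : IsRightDer 0 (eulerOp (B := B) (p := p) s) := by
  refine IsRightDer.sum s fun g _ x y => ?_
  simp only [LinearMap.comp_apply, LinearMap.mulRight_apply, tw_zero]
  rw [isRightDer_pd g x y, add_mul, mul_assoc, mul_assoc, mul_assoc, gen_mul_swap y g]

open Classical in
theorem eulerOp_of_mem (s : Finset G) {n : ℤ} {x : SuperPoly B p}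
    (hx : x ∈ wspan B p (fun g => if g ∈ s then (1 : ℤ) else 0) {n}) : eulerOp s x = n • x := by
  have := (isRightDer_eulerOp (B := B) (p := p) s).euler (ρ := 1)
    (w := fun g => if g ∈ s then (1 : ℤ) else 0) (fun g => ?_) hx
  · simpa using this
  · rw [eulerOp_apply]
    simp [pd_gen]

end Derivations

section Words

variable {B : Type*} [CommRing B] {G : Type*} {p : G → ZMod 2} {M : Type*} [AddCommMonoid M]

open Classical in
theorem projU_singleton (w : G → M) (d : M) (x : SuperPoly B p) :
    projU B p w {d} x = (weightHom B p w x).coeff d := by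
  refine LinearMap.congr_fun (f := projU B p w {d})
    (g := { toFun := fun x => (weightHom B p w x).coeff d
            map_add' := fun x y => by simp
            map_smul' := fun b x => by simp }) (linearMap_ext_mon fun l => ?_) x
  change projU B p w {d} (mon B p l) = (weightHom B p w (mon B p l)).coeff d
  rw [projU_mon, weightHom_mon, AddMonoidAlgebra.coeff_single, Finsupp.single_apply]
  rfl

/-- Every element is the sum of its homogeneous parts. -/
theorem exists_sum_projU (w : G → M) (x : SuperPoly B p) :
    ∃ s : Finset M, x = ∑ d ∈ s, projU B p w {d} x := by
  classical
  refine ⟨(weightHom B p w x).coeff.support, ?_⟩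
  conv_lhs => rw [← projU_of_mem (V := Set.univ) subset_rfl (mem_wspan_univ B p w x)]
  simp only [projU_singleton]
  change (Finsupp.lsum B _) (weightHom B p w x).coeff = _
  rw [Finsupp.lsum_apply, Finsupp.sum]
  refine Finset.sum_congr rfl fun d _ => ?_
  simp

theorem eq_zero_of_projU_eq_zero (w : G → M) {x : SuperPoly B p}
    (h : ∀ d, projU B p w {d} x = 0) : x = 0 := by
  obtain ⟨s, hs⟩ := exists_sum_projU w x
  rw [hs]
  exact Finset.sum_eq_zero fun d _ => h d

end Words

/-! ### Linear functionals separate the elements of a superalgebra -/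

section Separation

variable {B : Type*} [CommRing B] {G : Type*} {p : G → ZMod 2}

variable (B p) in
/-- The augmentation, which sends all generators to zero. -/
def aug : SuperPoly B p →ₐ[B] B := lift (fun _ => 0) (by simp)

theorem aug_gen (g : G) : aug B p (gen B p g) = 0 := by
  rw [aug, lift_gen]

/-- The elements of degree zero in the generators are the scalars. -/
theorem eq_algebraMap_aug_of_mem {w : G → ℤ} (hw : ∀ g, 0 < w g) {x : SuperPoly B p}
    (hx : x ∈ wspan B p w {0}) : x = algebraMap B _ (aug B p x) := by
  refine linearMap_eq_on_wspan (f := LinearMap.id)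
    (f' := (Algebra.linearMap B (SuperPoly B p)) ∘ₗ (aug B p).toLinearMap) (fun l hl => ?_) hx
  cases l with
  | nil => simp
  | cons g l =>
    exfalso
    have h0 : 0 ≤ (l.map w).sum := List.sum_nonneg (by
      intro x hx
      obtain ⟨k, -, rfl⟩ := List.mem_map.1 hx
      exact (hw k).le)
    have := hw g
    simp only [List.map_cons, List.sum_cons, Set.mem_singleton_iff] at hl
    omega

variable [Algebra ℂ B]

/-- Modules over a `ℂ`-algebra are torsion-free over `ℤ`. -/
theorem eq_zero_of_zsmul_eq_zero {X : Type*} [AddCommGroup X] [Module B X] {n : ℤ} (hn : n ≠ 0)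
    {x : X} (h : n • x = 0) : x = 0 := by
  have e : algebraMap ℂ B ((n : ℂ)⁻¹) • (n : B) • x = x := by
    have h1 : algebraMap ℂ B ((n : ℂ)⁻¹) * (n : B) = 1 := by
      rw [← map_intCast (algebraMap ℂ B), ← map_mul,
        inv_mul_cancel₀ (by exact_mod_cast hn), map_one]
    rw [smul_smul, h1, one_smul]
  rw [← e, Int.cast_smul_eq_zsmul, h, smul_zero]

/-- The linear functionals separate the elements: the iterated partial derivatives, evaluated at
the vanishing generators, are enough. -/
theorem eq_zero_of_functionals [Finite G] {x : SuperPoly B p}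
    (h : ∀ f : SuperPoly B p →ₗ[B] B, f x = 0) : x = 0 := by
  classical
  have := Fintype.ofFinite G
  have key (n : ℕ) : ∀ x ∈ wspan B p (fun _ => (1 : ℤ)) {(n : ℤ)},
      (∀ f : SuperPoly B p →ₗ[B] B, f x = 0) → x = 0 := by
    induction n with
    | zero =>
      intro x hx hf
      rw [Nat.cast_zero] at hx
      have h0 := eq_algebraMap_aug_of_mem (fun _ => one_pos) hx
      have := hf (aug B p).toLinearMap
      rw [AlgHom.toLinearMap_apply] at this
      rw [h0, this, map_zero]
    | succ n ih =>
      intro x hx hf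
      have h0 (g : G) : pd B p g x = 0 :=
        ih _ (pd_mem_wspan (fun _ => (1 : ℤ)) g (by rintro _ rfl; push_cast; simp) hx)
          (fun f => hf (f ∘ₗ pd B p g))
      have he := eulerOp_of_mem (B := B) (p := p) Finset.univ (n := ((n + 1 : ℕ) : ℤ)) (x := x)
        (by simpa using hx)
      rw [eulerOp_apply] at he
      simp only [h0, zero_mul, Finset.sum_const_zero] at he
      exact eq_zero_of_zsmul_eq_zero (B := B) (by positivity) he.symm
  refine eq_zero_of_projU_eq_zero (fun _ => (1 : ℤ)) fun d => ?_
  by_cases hd : 0 ≤ d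
  · lift d to ℕ using hd
    exact key d _ (projU_mem _ _) fun f => h (f ∘ₗ projU B p _ _)
  · refine projU_of_disjoint (U := {d | 0 ≤ d}) (by simpa using hd) ?_
    exact wspan_induction (N := wspan B p (fun _ => (1 : ℤ)) {d | 0 ≤ d})
      (fun l _ => mon_mem_wspan (show 0 ≤ (l.map fun _ => (1 : ℤ)).sum by simp))
      (mem_wspan_univ B p (fun _ => (1 : ℤ)) x)

/-! ### Nilpotency of the odd generators -/

theorem gen_mul_self {g : G} (hg : p g = 1) : gen B p g * gen B p g = 0 := by
  have h := gen_swap (B := B) (p := p) g g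
  rw [hg, show sgn (1 * 1) = -1 from rfl, neg_smul, one_smul] at h
  refine eq_zero_of_zsmul_eq_zero (B := B) (n := 2) two_ne_zero ?_
  rw [two_smul]
  nth_rewrite 1 [h]
  exact neg_add_cancel _

open Classical in
theorem mon_eq_zero_of_count {g : G} (hg : p g = 1) {l : List G} (h : 2 ≤ l.count g) :
    mon B p l = 0 := by
  induction l with
  | nil => simp at h
  | cons k l ih =>
    rw [mon_cons]
    by_cases e : k = g
    · subst e
      have hk : k ∈ l := List.count_pos_iff.1 (by rw [List.count_cons_self] at h; omega)
      obtain ⟨s, t, rfl⟩ := List.append_of_mem hk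
      rw [mon_append, mon_cons, ← mul_assoc, ← mul_assoc, mul_assoc _ (mon B p s),
        mul_gen_swap, ← mul_assoc, gen_mul_self hg, zero_mul, zero_mul]
    · rw [ih (by rwa [List.count_cons_of_ne e] at h), mul_zero]

open Classical in
theorem sum_indicator_eq (s : Finset G) (l : List G) :
    (l.map fun g => if g ∈ s then (1 : ℤ) else 0).sum = ∑ g ∈ s, (l.count g : ℤ) := by
  induction l with
  | nil => simp
  | cons k l ih =>
    simp only [List.map_cons, List.sum_cons, ih, List.count_cons, Nat.cast_add,
      Finset.sum_add_distrib]
    simp [add_comm]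

open Classical in
/-- A monomial with more odd factors from a finite set than the set has elements vanishes. -/
theorem mon_eq_zero_of_card {s : Finset G} (hs : ∀ g ∈ s, p g = 1) {l : List G}
    (h : (s.card : ℤ) < (l.map fun g => if g ∈ s then (1 : ℤ) else 0).sum) : mon B p l = 0 := by
  rw [sum_indicator_eq] at h
  obtain ⟨g, hg, h2⟩ : ∃ g ∈ s, 2 ≤ l.count g := by
    by_contra! hc
    have : ∑ g ∈ s, (l.count g : ℤ) ≤ ∑ g ∈ s, 1 :=
      Finset.sum_le_sum fun g hg => by have := hc g hg; omega
    simp at this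
    omega
  exact mon_eq_zero_of_count (hs g hg) h2

open Classical in
theorem wspan_eq_bot_of_card {s : Finset G} (hs : ∀ g ∈ s, p g = 1) {U : Set ℤ}
    (hU : ∀ u ∈ U, (s.card : ℤ) < u) :
    wspan B p (fun g => if g ∈ s then (1 : ℤ) else 0) U = ⊥ :=
  eq_bot_iff.2 fun _ hx => wspan_induction
    (fun _ hl => (Submodule.mem_bot B).2 (mon_eq_zero_of_card hs (hU _ hl))) hx

end Separation

/-! ### Truncation of a multicomplex to a box -/

section Box

variable {B : Type*} [CommRing B] {G : Type*} {p : G → ZMod 2} {Q : Type*} [AddCommGroup Q]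

/-- The weights `(q, r)` with `q = D`, `0 ≤ r`, total degree `∑ r = m`, with `r ≤ d` in the
directions in `S` and `r = r₀` in the others. -/
def boxSet (S : Finset (Fin 3)) (D : Q) (d r₀ : Fin 3 → ℤ) (m : ℤ) : Set (Q × (Fin 3 → ℤ)) :=
  {u | u.1 = D ∧ 0 ≤ u.2 ∧ ∑ a, u.2 a = m ∧ (∀ a ∈ S, u.2 a ≤ d a) ∧ ∀ a ∉ S, u.2 a = r₀ a}

/-- Data for the truncation argument: anticommuting odd derivations `δ_a`, each of which lowers the
`a`-th component of the resolution degree `r` by one and is exact in positive total degree. -/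
structure ExactTricomplex (w : G → Q × (Fin 3 → ℤ))
    (δ : Fin 3 → SuperPoly B p →ₗ[B] SuperPoly B p) : Prop where
  isRightDer : ∀ a, IsRightDer 1 (δ a)
  nonneg : ∀ g, 0 ≤ (w g).2
  shift : ∀ a g, δ a (gen B p g) ∈ wspan B p w {w g + (0, -Pi.single a 1)}
  anticomm : ∀ a b x, δ a (δ b x) + δ b (δ a x) = 0
  exact : ∀ a (m : ℤ), 0 < m → ∀ x ∈ wspan B p w {u | ∑ b, u.2 b = m}, δ a x = 0 →
    ∃ y, δ a y = x

namespace ExactTricomplex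

variable {w : G → Q × (Fin 3 → ℤ)} {δ : Fin 3 → SuperPoly B p →ₗ[B] SuperPoly B p}

theorem sum_nonneg (h : ExactTricomplex w δ) (l : List G) : 0 ≤ ((l.map w).sum).2 := by
  induction l with
  | nil => simp
  | cons g l ih =>
    rw [List.map_cons, List.sum_cons]
    exact add_nonneg (h.nonneg g) ih

theorem mem_wspan (h : ExactTricomplex w δ) (a : Fin 3) {U U' : Set (Q × (Fin 3 → ℤ))}
    (hU : ∀ u ∈ U, 0 ≤ (u - (0, Pi.single a 1)).2 → u - (0, Pi.single a 1) ∈ U')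
    {x : SuperPoly B p} (hx : x ∈ wspan B p w U) : δ a x ∈ wspan B p w U' := by
  have h1 : δ a x ∈ wspan B p w {u | u + (0, Pi.single a 1) ∈ U} := by
    refine (h.isRightDer a).mem_wspan (U' := {(0, -Pi.single a 1)})
      (fun g => wspan_mono (by rintro _ rfl; simp) (h.shift a g)) ?_ hx
    rintro u hu _ rfl
    simpa [add_assoc, ← Prod.zero_eq_mk] using hu
  have h2 : wspan B p w {u | u + (0, Pi.single a 1) ∈ U} ≤
      wspan B p w ({u | u + (0, Pi.single a 1) ∈ U} ∩ {u | 0 ≤ u.2}) := fun x hx =>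
    wspan_induction (fun l hl => mon_mem_wspan (Set.mem_inter hl (h.sum_nonneg l))) hx
  refine wspan_mono ?_ (h2 h1)
  rintro u ⟨hu, hu0⟩
  simpa using hU _ hu (by simpa using hu0)

theorem projU_comm (h : ExactTricomplex w δ) (a : Fin 3) (U : Set (Q × (Fin 3 → ℤ)))
    (x : SuperPoly B p) :
    projU B p w U (δ a x) = δ a (projU B p w {u | u - (0, Pi.single a 1) ∈ U} x) := by
  rw [(h.isRightDer a).projU_comm (h.shift a)]
  simp [sub_eq_add_neg]

/-- The weights as in `boxSet`, where the component in the direction `a` lies in `I` instead. -/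
def freeSet (S : Finset (Fin 3)) (a : Fin 3) (D : Q) (d r₀ : Fin 3 → ℤ) (m : ℤ) (I : Set ℤ) :
    Set (Q × (Fin 3 → ℤ)) :=
  {u | u.1 = D ∧ 0 ≤ u.2 ∧ ∑ b, u.2 b = m ∧ (∀ b ∈ S, u.2 b ≤ d b) ∧
    (∀ b ∉ S, b ≠ a → u.2 b = r₀ b) ∧ u.2 a ∈ I}

variable {S : Finset (Fin 3)} {a : Fin 3} {D : Q} {d r₀ : Fin 3 → ℤ} {m : ℤ} {I J : Set ℤ}

theorem sum_sub_single (r : Fin 3 → ℤ) (b : Fin 3) :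
    ∑ c, (r - Pi.single b 1 : Fin 3 → ℤ) c = ∑ c, r c - 1 := by
  simp

/-- The differentials in the directions in `S` do not change the `a`-degree. -/
theorem mem_freeSet_of_ne (h : ExactTricomplex w δ) (haS : a ∉ S) {x : SuperPoly B p}
    (hx : x ∈ wspan B p w (freeSet S a D d r₀ m I)) :
    (∑ b ∈ S, δ b) x ∈ wspan B p w (freeSet S a D d r₀ (m - 1) I) := by
  rw [LinearMap.sum_apply]
  refine sum_mem fun b hb => h.mem_wspan b ?_ hx
  rintro u ⟨h1, -, h3, h4, h5, h6⟩ h0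
  have hba : a ≠ b := fun e => haS (e ▸ hb)
  refine ⟨by simpa using h1, h0, ?_, fun c hc => ?_, fun c hc hca => ?_, ?_⟩
  · rw [← h3, Prod.snd_sub, sum_sub_single]
  · have := h4 c hc
    have h' : 0 ≤ (Pi.single b 1 : Fin 3 → ℤ) c := by rw [Pi.single_apply]; split_ifs <;> simp
    simp only [Prod.snd_sub, Pi.sub_apply]
    omega
  · have hcb : c ≠ b := fun e => hc (e ▸ hb)
    simpa [hcb] using h5 c hc hca
  · simpa [hba] using h6

theorem mem_freeSet_self (h : ExactTricomplex w δ) (haS : a ∉ S)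
    (hIJ : ∀ i ∈ I, i - 1 ∈ J) {x : SuperPoly B p}
    (hx : x ∈ wspan B p w (freeSet S a D d r₀ m I)) :
    δ a x ∈ wspan B p w (freeSet S a D d r₀ (m - 1) J) := by
  refine h.mem_wspan a ?_ hx
  rintro u ⟨h1, -, h3, h4, h5, h6⟩ h0
  refine ⟨by simpa using h1, h0, ?_, fun c hc => ?_, fun c hc hca => ?_, ?_⟩
  · rw [← h3, Prod.snd_sub, sum_sub_single]
  · have hca : c ≠ a := fun e => haS (e ▸ hc)
    simpa [hca] using h4 c hc
  · simpa [hca] using h5 c hc hca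
  · simpa using hIJ _ h6

omit [AddCommGroup Q] in
theorem freeSet_inter (I J : Set ℤ) :
    {u : Q × (Fin 3 → ℤ) | u.2 a ∈ J} ∩ freeSet S a D d r₀ m I =
      freeSet S a D d r₀ m (I ∩ J) := by
  ext u
  simp only [freeSet, Set.mem_inter_iff, Set.mem_ofPred_eq]
  tauto

omit [AddCommGroup Q] in
theorem freeSet_mono (h : I ⊆ J) : freeSet S a D d r₀ m I ⊆ freeSet S a D d r₀ m J :=
  fun _ ⟨h1, h2, h3, h4, h5, h6⟩ => ⟨h1, h2, h3, h4, h5, h h6⟩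

/-- Splitting off the part of `a`-degree in `J`. -/
theorem exists_split {x : SuperPoly B p} (hx : x ∈ wspan B p w (freeSet S a D d r₀ m I))
    (J : Set ℤ) : ∃ x₁ ∈ wspan B p w (freeSet S a D d r₀ m (I ∩ J)),
      ∃ x₂ ∈ wspan B p w (freeSet S a D d r₀ m (I ∩ Jᶜ)), x = x₁ + x₂ := by
  refine ⟨_, ?_, _, ?_, (projU_add_compl (w := w) {u | u.2 a ∈ J} x).symm⟩
  · rw [← freeSet_inter]; exact projU_mem_wspan_inter hx
  · rw [← freeSet_inter]; exact projU_mem_wspan_inter hx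

/-- Parts with disjoint `a`-degrees are independent. -/
theorem eq_zero_of_add_eq {x y : SuperPoly B p}
    (hx : x ∈ wspan B p w (freeSet S a D d r₀ m I))
    (hy : y ∈ wspan B p w (freeSet S a D d r₀ m J)) (hIJ : Disjoint I J) (h : x + y = 0) :
    x = 0 := by
  have h' := congrArg (projU B p w (freeSet S a D d r₀ m I)) h
  rw [map_add, projU_of_mem subset_rfl hx, projU_of_disjoint ?_ hy, add_zero, map_zero] at h'
  · exact h'
  · refine Set.disjoint_left.2 ?_
    rintro u ⟨-, -, -, -, -, h1⟩ ⟨-, -, -, -, -, h2⟩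
    exact Set.disjoint_left.1 hIJ h2 h1

variable [Algebra ℂ B]

theorem sum_sum_eq_zero (h : ExactTricomplex w δ) (S : Finset (Fin 3)) (x : SuperPoly B p) :
    (∑ a ∈ S, δ a) ((∑ a ∈ S, δ a) x) = 0 := by
  simp only [LinearMap.sum_apply, map_sum]
  refine eq_zero_of_zsmul_eq_zero (B := B) (n := 2) two_ne_zero ?_
  rw [two_smul]
  nth_rewrite 1 [Finset.sum_comm]
  simp only [← Finset.sum_add_distrib, h.anticomm, Finset.sum_const_zero]

/-- Without a bound in the direction `a`, the exactness of `δ_a` alone gives the exactness of the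
sum: the lowest slice is removed first. -/
theorem exists_of_free (h : ExactTricomplex w δ) (haS : a ∉ S) (hm : 0 < m) (n : ℕ) :
    ∀ k : ℤ, m < k + n → ∀ F ∈ wspan B p w (freeSet S a D d r₀ m (Set.Ici k)),
      (δ a + ∑ b ∈ S, δ b) F = 0 →
      ∃ P ∈ wspan B p w (freeSet S a D d r₀ (m + 1) Set.univ), (δ a + ∑ b ∈ S, δ b) P = F := by
  induction n with
  | zero =>
    intro k hk F hF _
    have he : freeSet S a D d r₀ m (Set.Ici k) = ∅ := by
      refine Set.eq_empty_of_forall_notMem ?_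
      rintro u ⟨-, h2, h3, -, -, h6⟩
      have : u.2 a ≤ ∑ b, u.2 b :=
        Finset.single_le_sum (f := u.2) (fun b _ => h2 b) (Finset.mem_univ a)
      simp only [Set.mem_Ici] at h6
      push_cast at hk
      omega
    rw [he, wspan_empty, Submodule.mem_bot] at hF
    exact ⟨0, zero_mem _, by rw [hF, map_zero]⟩
  | succ n ih =>
    intro k hk F hF hδ
    obtain ⟨F₁, h1, F₂, h2, rfl⟩ := exists_split hF {k}
    replace h1 : F₁ ∈ wspan B p w (freeSet S a D d r₀ m {k}) :=
      wspan_mono (freeSet_mono Set.inter_subset_right) h1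
    replace h2 : F₂ ∈ wspan B p w (freeSet S a D d r₀ m (Set.Ici (k + 1))) :=
      wspan_mono (freeSet_mono (by
        rintro i ⟨hi, hi'⟩
        simp only [Set.mem_Ici, Set.mem_compl_iff, Set.mem_singleton_iff] at *
        omega)) h2
    -- The lowest slice is a cycle of `δ a`, as nothing else has its `a`-degree minus one.
    have hz : δ a F₁ = 0 := by
      refine eq_zero_of_add_eq (h.mem_freeSet_self haS (J := {k - 1}) (by rintro _ rfl; rfl) h1)
        (J := Set.Ici k) (add_mem
          (h.mem_freeSet_of_ne haS (wspan_mono (freeSet_mono (by simp)) h1))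
          (add_mem (h.mem_freeSet_self haS (J := Set.Ici k) ?_ h2)
            (h.mem_freeSet_of_ne haS (wspan_mono (freeSet_mono ?_) h2)))) ?_ ?_
      · intro i hi; simp only [Set.mem_Ici] at *; omega
      · intro i hi; simp only [Set.mem_Ici] at *; omega
      · simp
      · rw [← hδ]
        simp only [LinearMap.add_apply, map_add]
        abel
    obtain ⟨y, hy⟩ := h.exact a m hm F₁ (wspan_mono (fun u hu => hu.2.2.1) h1) hz
    have hQ := h.projU_comm a (freeSet S a D d r₀ m {k}) y
    rw [hy, projU_of_mem subset_rfl h1] at hQ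
    set Q₁ := projU B p w {u | u - (0, Pi.single a 1) ∈ freeSet S a D d r₀ m {k}} y
    have hQm : Q₁ ∈ wspan B p w (freeSet S a D d r₀ (m + 1) {k + 1}) := by
      refine wspan_mono ?_ (projU_mem _ _)
      rintro u ⟨h1, h2, h3, h4, h5, h6⟩
      have hp : 0 ≤ (Pi.single a 1 : Fin 3 → ℤ) := by
        intro c; rw [Pi.single_apply]; split_ifs <;> simp
      refine ⟨by simpa using h1, ?_, ?_, fun c hc => ?_, fun c hc hca => ?_, ?_⟩
      · exact hp.trans (by simpa using h2)
      · rw [Prod.snd_sub, sum_sub_single] at h3; omega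
      · have hca : c ≠ a := fun e => haS (e ▸ hc)
        simpa [hca] using h4 c hc
      · simpa [hca] using h5 c hc hca
      · simp only [Prod.snd_sub, Pi.sub_apply, Pi.single_eq_same, Set.mem_singleton_iff] at h6 ⊢
        omega
    have hdd : (δ a + ∑ b ∈ S, δ b) ((δ a + ∑ b ∈ S, δ b) Q₁) = 0 := by
      rw [← Finset.sum_insert haS]; exact h.sum_sum_eq_zero _ _
    obtain ⟨P, hP, hP'⟩ := ih (k + 1) (by push_cast at hk; omega) (F₂ - (∑ b ∈ S, δ b) Q₁)
      (sub_mem h2 (by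
        have := h.mem_freeSet_of_ne haS hQm
        rw [add_sub_cancel_right] at this
        exact wspan_mono (freeSet_mono (by simp)) this)) (by
        have e : F₂ - (∑ b ∈ S, δ b) Q₁ = (F₁ + F₂) - (δ a + ∑ b ∈ S, δ b) Q₁ := by
          rw [LinearMap.add_apply, ← hQ]; abel
        rw [e, map_sub, hδ, hdd, sub_zero])
    refine ⟨P + Q₁, add_mem hP (wspan_mono (freeSet_mono (Set.subset_univ _)) hQm), ?_⟩
    rw [map_add, hP', LinearMap.add_apply, ← hQ]
    abel

/-- The slices beyond the bound in the direction `a` are cycles of the remaining differential, and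
are removed from the top. -/
theorem exists_of_slices (h : ExactTricomplex w δ) (haS : a ∉ S)
    (ih : ∀ k : ℤ, d a < k → ∀ F ∈ wspan B p w (boxSet S D d (Function.update r₀ a k) (m + 1)),
      (∑ b ∈ S, δ b) F = 0 →
      ∃ P ∈ wspan B p w (boxSet S D d (Function.update r₀ a k) (m + 1 + 1)),
        (∑ b ∈ S, δ b) P = F)
    {F : SuperPoly B p} (hF : F ∈ wspan B p w (freeSet S a D d r₀ m (Set.Iic (d a)))) (n : ℕ) :
    ∀ k : ℤ, k ≤ d a + n → ∀ P ∈ wspan B p w (freeSet S a D d r₀ (m + 1) (Set.Iic k)),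
      (δ a + ∑ b ∈ S, δ b) P = F →
      ∃ P ∈ wspan B p w (freeSet S a D d r₀ (m + 1) (Set.Iic (d a))),
        (δ a + ∑ b ∈ S, δ b) P = F := by
  induction n with
  | zero =>
    intro k hk P hP hPF
    exact ⟨P, wspan_mono (freeSet_mono (Set.Iic_subset_Iic.2 (by simpa using hk))) hP, hPF⟩
  | succ n ihn =>
    intro k hk P hP hPF
    by_cases hkd : k ≤ d a
    · exact ⟨P, wspan_mono (freeSet_mono (Set.Iic_subset_Iic.2 hkd)) hP, hPF⟩
    rw [not_le] at hkd
    obtain ⟨P₁, h1, P₂, h2, rfl⟩ := exists_split hP {k}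
    replace h1 : P₁ ∈ wspan B p w (freeSet S a D d r₀ (m + 1) {k}) :=
      wspan_mono (freeSet_mono Set.inter_subset_right) h1
    replace h2 : P₂ ∈ wspan B p w (freeSet S a D d r₀ (m + 1) (Set.Iic (k - 1))) :=
      wspan_mono (freeSet_mono (by
        rintro i ⟨hi, hi'⟩
        simp only [Set.mem_Iic, Set.mem_compl_iff, Set.mem_singleton_iff] at *
        omega)) h2
    have d1 := h.mem_freeSet_of_ne haS h1
    have d2 := h.mem_freeSet_of_ne haS h2
    have d3 := h.mem_freeSet_self haS (J := {k - 1}) (by rintro _ rfl; rfl) h1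
    have d4 := h.mem_freeSet_self haS (J := Set.Iic (k - 1))
      (by intro i hi; simp only [Set.mem_Iic] at *; omega) h2
    rw [add_sub_cancel_right] at d1 d2 d3 d4
    -- The top slice is a cycle of `∑ b ∈ S, δ b`, as all other terms have
    -- lower `a`-degree.
    have hz : (∑ b ∈ S, δ b) P₁ = 0 := by
      refine eq_zero_of_add_eq d1 (J := Set.Iic (k - 1))
        (y := (∑ b ∈ S, δ b) P₂ + (δ a P₁ + (δ a P₂ - F))) (add_mem d2 (add_mem
          (wspan_mono (freeSet_mono (by simp)) d3) (sub_mem d4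
            (wspan_mono (freeSet_mono (Set.Iic_subset_Iic.2 (by omega))) hF)))) (by simp) ?_
      rw [← hPF]
      simp only [LinearMap.add_apply, map_add]
      abel
    obtain ⟨Q₁, hQm, hQ⟩ := ih k hkd P₁ (wspan_mono (by
      rintro u ⟨h1, h2, h3, h4, h5, h6⟩
      refine ⟨h1, h2, h3, h4, fun c hc => ?_⟩
      by_cases hca : c = a
      · subst hca; simpa using h6
      · simpa [hca] using h5 c hc hca) h1) hz
    replace hQm : Q₁ ∈ wspan B p w (freeSet S a D d r₀ (m + 1 + 1) {k}) := by
      refine wspan_mono ?_ hQm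
      rintro u ⟨h1, h2, h3, h4, h5⟩
      exact ⟨h1, h2, h3, h4, fun c hc hca => by simpa [hca] using h5 c hc,
        by simpa using h5 a haS⟩
    have hdd : (δ a + ∑ b ∈ S, δ b) ((δ a + ∑ b ∈ S, δ b) Q₁) = 0 := by
      rw [← Finset.sum_insert haS]; exact h.sum_sum_eq_zero _ _
    refine ihn (k - 1) (by push_cast at hk; omega) (P₂ - δ a Q₁) (sub_mem h2 ?_) ?_
    · have := h.mem_freeSet_self haS (J := Set.Iic (k - 1)) (by rintro _ rfl; simp) hQm
      rwa [add_sub_cancel_right] at this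
    · have e : P₂ - δ a Q₁ = (P₁ + P₂) - (δ a + ∑ b ∈ S, δ b) Q₁ := by
        rw [LinearMap.add_apply, hQ]; abel
      rw [e, map_sub, hPF, hdd, sub_zero]

/-- The complex truncated to the box `r ≤ d` (in the directions in `S`, the other components of `r`
being fixed) is exact in total degrees strictly between zero and the top. -/
theorem exact_boxSet (h : ExactTricomplex w δ) (S : Finset (Fin 3)) :
    ∀ (D : Q) (d r₀ : Fin 3 → ℤ) (m : ℤ), 0 < m → m < ∑ b ∈ S, d b + ∑ b ∈ Sᶜ, r₀ b →
      ∀ F ∈ wspan B p w (boxSet S D d r₀ m), (∑ b ∈ S, δ b) F = 0 →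
      ∃ P ∈ wspan B p w (boxSet S D d r₀ (m + 1)), (∑ b ∈ S, δ b) P = F := by
  induction S using Finset.induction_on with
  | empty =>
    intro D d r₀ m _ hmd F hF _
    have he : boxSet ∅ D d r₀ m = ∅ := by
      refine Set.eq_empty_of_forall_notMem ?_
      rintro u ⟨-, -, h3, -, h5⟩
      have : ∑ b, u.2 b = ∑ b, r₀ b := Finset.sum_congr rfl fun b _ => h5 b (by simp)
      simp only [Finset.sum_empty, Finset.compl_empty, zero_add] at hmd
      omega
    rw [he, wspan_empty, Submodule.mem_bot] at hF
    exact ⟨0, zero_mem _, by rw [hF, map_zero]⟩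
  | insert a S haS ih =>
    intro D d r₀ m hm hmd F hF hδ
    have hbox (m : ℤ) : boxSet (insert a S) D d r₀ m = freeSet S a D d r₀ m (Set.Iic (d a)) := by
      ext u
      simp only [boxSet, freeSet, Set.mem_ofPred_eq, Finset.mem_insert, Set.mem_Iic,
        forall_eq_or_imp, not_or, and_imp]
      constructor
      · rintro ⟨h1, h2, h3, ⟨h4, h4'⟩, h5⟩
        exact ⟨h1, h2, h3, h4', fun b hb hba => h5 b hba hb, h4⟩
      · rintro ⟨h1, h2, h3, h4, h5, h6⟩
        exact ⟨h1, h2, h3, ⟨h6, h4⟩, fun b hba hb => h5 b hb hba⟩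
    rw [hbox] at hF ⊢
    rw [Finset.sum_insert haS] at hδ ⊢
    have hsub : freeSet S a D d r₀ m (Set.Iic (d a)) ⊆ freeSet S a D d r₀ m (Set.Ici 0) :=
      fun u hu => ⟨hu.1, hu.2.1, hu.2.2.1, hu.2.2.2.1, hu.2.2.2.2.1, hu.2.1 a⟩
    have hF' := wspan_mono hsub hF
    -- A preimage that may exceed the bound in the direction `a` is cut down from the top.
    obtain ⟨P, hP, hPF⟩ := h.exists_of_free haS hm (m.toNat + 1) 0 (by omega) F hF' hδ
    refine h.exists_of_slices haS (fun k hk F' hF' hδ' => ?_) hF (m + 1 - d a).toNat (m + 1)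
      (by omega) P (wspan_mono ?_ hP) hPF
    · refine ih D d _ (m + 1) (by omega) ?_ F' hF' hδ'
      have e1 : (Sᶜ : Finset (Fin 3)) = insert a (insert a S)ᶜ := by
        rw [Finset.compl_insert, Finset.insert_erase (by simpa using haS)]
      have e2 : ∑ b ∈ (insert a S)ᶜ, Function.update r₀ a k b = ∑ b ∈ (insert a S)ᶜ, r₀ b :=
        Finset.sum_congr rfl fun b hb => by
          have : b ≠ a := by rintro rfl; simp at hb
          simp [this]
      rw [e1, Finset.sum_insert (by simp), e2, Function.update_self]
      rw [Finset.sum_insert haS] at hmd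
      omega
    · intro u hu
      obtain ⟨h1, h2, h3, h4, h5, -⟩ := hu
      refine ⟨h1, h2, h3, h4, h5, ?_⟩
      have : u.2 a ≤ ∑ b, u.2 b :=
        Finset.single_le_sum (f := u.2) (fun b _ => h2 b) (Finset.mem_univ a)
      simp only [Set.mem_Iic]
      omega

end ExactTricomplex

end Box

/-! ### The Koszul-Tate tricomplex -/

theorem eps_swap_left (a b c : Fin 3) : eps b a c = -eps a b c := by
  revert a b c; decide

theorem eps_swap_right (a b c : Fin 3) : eps a c b = -eps a b c := by
  revert a b c; decide

theorem eps_rotate (a b c : Fin 3) : eps b c a = eps a b c := by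
  revert a b c; decide

theorem sgn_add_one (a : ZMod 2) : sgn (a + 1) = -sgn a := by
  revert a; decide

section Weights

variable {ι₀ ι₁ : Type*} [Fintype ι₀] {p₀ : ι₀ → ZMod 2} {p₁ : ι₁ → ZMod 2}

theorem coeff_mem_wspan {M : Type*} [AddCommMonoid M] {w : Gen p₀ ι₁ → M}
    (hw : ∀ i, w (.odd i) = 0) (F : FieldAlg p₀) :
    coeff p₀ p₁ F ∈ wspan (Smooth p₀) (Gen.parity p₀ p₁) w {0} := by
  refine wspan_induction (w := fun _ => (0 : ℕ))
    (N := (wspan (Smooth p₀) (Gen.parity p₀ p₁) w {0}).comap (coeff p₀ p₁).toLinearMap)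
    (fun l hl => ?_) (mem_wspan_univ (Smooth p₀) _ _ F)
  clear hl
  rw [Submodule.mem_comap, AlgHom.toLinearMap_apply]
  induction l with
  | nil => rw [mon_nil, map_one]; exact one_mem_wspan rfl
  | cons i l ih =>
    rw [mon_cons, map_mul, coeff_gen]
    exact mul_mem_wspan (by rintro _ rfl _ rfl; simp) (gen_mem_wspan (U := {0}) (hw i)) ih

theorem tw_coeff {c : ZMod 2} (a : ZMod 2) {F : FieldAlg p₀} (hF : F ∈ parityPart _ _ c) :
    tw (Smooth p₀) (Gen.parity p₀ p₁) a (coeff p₀ p₁ F) = sgn (a * c) • coeff p₀ p₁ F :=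
  tw_of_mem a (coeff_mem_parity p₁ hF)

/-- A derivation that annihilates the odd fields annihilates all superfunctions. -/
theorem IsRightDer.apply_coeff {c : ZMod 2} {D : Alg p₀ p₁ →ₗ[Smooth p₀] Alg p₀ p₁}
    (h : IsRightDer c D) (hD : ∀ i, D (Alg.of p₀ p₁ (.odd i)) = 0) (F : FieldAlg p₀) :
    D (coeff p₀ p₁ F) = 0 := by
  refine LinearMap.congr_fun (f := D ∘ₗ (coeff p₀ p₁).toLinearMap) (g := 0)
    (linearMap_ext_mon fun l => ?_) F
  simp only [LinearMap.comp_apply, AlgHom.toLinearMap_apply, LinearMap.zero_apply]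
  induction l with
  | nil => rw [mon_nil, _root_.map_one, h.map_one]
  | cons i l ih => rw [mon_cons, map_mul, coeff_gen, h, hD, ih, mul_zero, zero_mul, add_zero]

theorem zsmul_of_mem_wspan {M : Type*} [AddCommMonoid M] {w : Gen p₀ ι₁ → M} {U : Set M} (n : ℤ)
    {g : Gen p₀ ι₁} (h : n ≠ 0 → w g ∈ U) :
    n • Alg.of p₀ p₁ g ∈ wspan (Smooth p₀) (Gen.parity p₀ p₁) w U := by
  by_cases hn : n = 0
  · rw [hn, zero_smul]; exact zero_mem _
  · exact zsmul_mem (gen_mem_wspan (B := Smooth p₀) (p := Gen.parity p₀ p₁) (h hn)) _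

end Weights

namespace GaugeTheory

variable {ι₀ ι₁ : Type*} [Fintype ι₀] [DecidableEq ι₀] {p₀ : ι₀ → ZMod 2} {p₁ : ι₁ → ZMod 2}
  (T : GaugeTheory p₀ p₁)

theorem isRightDer_delta (a : Fin 3) : IsRightDer 1 (T.delta a) :=
  isRightDer_rightDer _ _

theorem delta_of (a : Fin 3) (g : Gen p₀ ι₁) : T.delta a (Alg.of p₀ p₁ g) = T.deltaVal a g :=
  rightDer_gen _ _ g

theorem delta_gen (a : Fin 3) (g : Gen p₀ ι₁) :
    T.delta a (gen (Smooth p₀) (Gen.parity p₀ p₁) g) = T.deltaVal a g :=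
  rightDer_gen _ _ g

theorem delta_coeff (a : Fin 3) (F : FieldAlg p₀) : T.delta a (coeff p₀ p₁ F) = 0 :=
  (T.isRightDer_delta a).apply_coeff (fun i => by rw [delta_of]; rfl) F

/-- A derivation of parity one, applied to `y_i Z^i_α`. -/
theorem _root_.Sp3.IsRightDer.apply_contractZ {D : Alg p₀ p₁ →ₗ[Smooth p₀] Alg p₀ p₁}
    (h : IsRightDer 1 D) (hD : ∀ i, D (Alg.of p₀ p₁ (.odd i)) = 0) (y : ι₀ → Gen p₀ ι₁) (α : ι₁) :
    D (T.contractZ y α) = ∑ i, sgn (p₀ i + p₁ α) •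
      (D (Alg.of p₀ p₁ (y i)) * coeff p₀ p₁ (T.Z i α)) := by
  rw [contractZ, map_sum]
  refine Finset.sum_congr rfl fun i _ => ?_
  rw [h, h.apply_coeff hD, mul_zero, zero_add, tw_coeff 1 (T.Z_parity i α), one_mul,
    mul_smul_comm]

theorem delta_contractZ (a : Fin 3) (y : ι₀ → Gen p₀ ι₁) (α : ι₁) :
    T.delta a (T.contractZ y α) = ∑ i, sgn (p₀ i + p₁ α) •
      (T.deltaVal a (y i) * coeff p₀ p₁ (T.Z i α)) := by
  rw [(T.isRightDer_delta a).apply_contractZ T (fun i => by rw [delta_of]; rfl)]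
  simp only [delta_of]

/-- Gauge invariance, for the left derivatives of the action. -/
theorem sum_derivL_mul_Z (α : ι₁) :
    ∑ i, sgn (p₀ i + p₁ α) • (coeff p₀ p₁ (derivL p₀ i T.S₀) * coeff p₀ p₁ (T.Z i α)) = 0 := by
  have e (i : ι₀) : derivL p₀ i T.S₀ = sgn (p₀ i) • derivR p₀ i T.S₀ := by
    unfold derivL
    split_ifs with h
    · rw [h, sgn_zero, one_smul]
    · have := derivR_mem_parity p₀ i T.S₀_even
      rw [add_zero] at this
      exact parityAut_of_mem this
  have h := congrArg (coeff p₀ p₁) (T.gauge_invariant α)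
  rw [map_sum, map_zero] at h
  simp only [e, map_zsmul, smul_mul_assoc, smul_smul, sgn_add]
  have h1 (i : ι₀) : sgn (p₀ i) * sgn (p₁ α) * sgn (p₀ i) = sgn (p₁ α) := by
    linear_combination sgn (p₁ α) * sgn_mul_self (p₀ i)
  simp only [h1, ← map_mul, ← Finset.smul_sum, h, smul_zero]

theorem delta_contractZ_star (a c : Fin 3) (α : ι₁) :
    T.delta a (T.contractZ (fun i => .star c (.phi i)) α) = 0 := by
  rw [delta_contractZ]
  simp only [deltaVal]
  split_ifs
  · simp only [source, neg_mul, smul_neg, Finset.sum_neg_distrib, sum_derivL_mul_Z, neg_zero]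
  · simp

theorem delta_contractZ_bar (a c : Fin 3) (α : ι₁) :
    T.delta a (T.contractZ (fun i => .bar c (.phi i)) α) =
      sgn (p₁ α) • ∑ d, eps a c d • T.contractZ (fun i => .star d (.phi i)) α := by
  rw [delta_contractZ]
  simp only [deltaVal, contractZ, Finset.smul_sum, Finset.sum_mul, smul_mul_assoc, smul_smul,
    Field.parity]
  rw [Finset.sum_comm]
  refine Finset.sum_congr rfl fun d _ => Finset.sum_congr rfl fun i _ => ?_
  congr 1
  rw [sgn_add]
  linear_combination sgn (p₁ α) * eps a c d * sgn_mul_self (p₀ i)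

theorem delta_contractZ_tilde (a : Fin 3) (α : ι₁) :
    T.delta a (T.contractZ (fun i => .tilde (.phi i)) α) =
      -sgn (p₁ α) • T.contractZ (fun i => .bar a (.phi i)) α := by
  rw [delta_contractZ]
  simp only [deltaVal, contractZ, Finset.smul_sum, smul_mul_assoc, smul_smul, Field.parity]
  refine Finset.sum_congr rfl fun i _ => ?_
  congr 1
  rw [sgn_add, sgn_add_one]
  linear_combination -sgn (p₁ α) * sgn_mul_self (p₀ i)

/-- The sources of the antifields are annihilated by the three differentials. -/
theorem delta_source (a b : Fin 3) (A : Field ι₀ ι₁) : T.delta a (T.source b A) = 0 := by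
  cases A with
  | phi i => rw [source, map_neg, delta_coeff, neg_zero]
  | eta c α => rw [source, map_zsmul, delta_contractZ_star, smul_zero]
  | pi c α =>
    rw [source, map_zsmul, map_add, delta_contractZ_bar]
    simp only [map_sum, map_zsmul, delta_of, deltaVal, source]
    simp only [smul_ite, smul_zero, Finset.sum_ite_irrel, Finset.sum_const_zero,
      Finset.sum_ite_eq, Finset.mem_univ, if_true]
    have : ∑ e, eps c a e • sgn (p₁ α) • T.contractZ (fun i => .star e (.phi i)) α =
        -(sgn (p₁ α) • ∑ d, eps a c d • T.contractZ (fun i => .star d (.phi i)) α) := by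
      rw [Finset.smul_sum, ← Finset.sum_neg_distrib]
      refine Finset.sum_congr rfl fun e _ => ?_
      rw [eps_swap_left a c e, smul_comm, neg_smul, smul_neg]
    rw [this, neg_add_cancel, smul_zero]
  | lam α =>
    rw [source, map_zsmul, map_sub, delta_contractZ_tilde]
    simp only [map_sum, map_add, delta_of, deltaVal, source, Finset.sum_add_distrib]
    simp only [Finset.sum_ite_eq, Finset.mem_univ, if_true, Field.parity, sgn_add_one]
    have : ∑ d, -sgn (p₁ α) • ∑ c, eps a d c • Alg.of p₀ p₁ (.star c (.eta d α)) =
        -(-sgn (p₁ α) • ∑ d, ∑ e, eps a d e • Alg.of p₀ p₁ (.star d (.eta e α))) := by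
      rw [← Finset.smul_sum, Finset.sum_comm, ← smul_neg, ← Finset.sum_neg_distrib]
      congr 1
      refine Finset.sum_congr rfl fun d _ => ?_
      rw [← Finset.sum_neg_distrib]
      refine Finset.sum_congr rfl fun e _ => ?_
      rw [eps_swap_right a d e, neg_smul]
    rw [this, smul_add]
    simp

/-- The three Koszul-Tate differentials anticommute. -/
theorem delta_anticomm (a b : Fin 3) (x : Alg p₀ p₁) :
    T.delta a (T.delta b x) + T.delta b (T.delta a x) = 0 := by
  have h := (T.isRightDer_delta a).anticomm
    (fun g => by rw [delta_gen]; exact T.deltaVal_mem_parity a g) (T.isRightDer_delta b)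
    (fun g => by rw [delta_gen]; exact T.deltaVal_mem_parity b g)
  refine LinearMap.congr_fun (h.eq_zero fun g => ?_) x
  simp only [LinearMap.add_apply, LinearMap.comp_apply, delta_gen]
  cases g with
  | odd i => simp [deltaVal]
  | ghost c => simp [deltaVal]
  | star c A =>
    simp only [deltaVal]
    split_ifs <;> simp [delta_source]
  | bar c A =>
    simp only [deltaVal, map_zsmul, map_sum, delta_of, smul_ite, smul_zero, Finset.sum_ite_eq,
      Finset.mem_univ, if_true]
    have : T.source b A = T.source a A := by cases A <;> rfl
    rw [this, ← smul_add, ← add_smul]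
    have e : eps b c a + eps a c b = 0 := by
      rw [eps_rotate, eps_swap_right a b c, add_neg_cancel]
    rw [e, zero_smul, smul_zero]
  | tilde A =>
    simp only [deltaVal, map_zsmul, delta_of]
    rw [← smul_add, ← smul_add, ← Finset.sum_add_distrib, Finset.sum_eq_zero, smul_zero, smul_zero]
    intro c _
    rw [← add_smul, eps_swap_left a b c, add_neg_cancel, zero_smul]

theorem delta_delta (a : Fin 3) (x : Alg p₀ p₁) : T.delta a (T.delta a x) = 0 := by
  refine eq_zero_of_zsmul_eq_zero (B := Smooth p₀) (n := 2) two_ne_zero ?_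
  rw [two_smul]
  exact T.delta_anticomm a a x

theorem contractZ_mem_wspan {M : Type*} [AddCommMonoid M] {w : Gen p₀ ι₁ → M} {U : Set M}
    (hw : ∀ i, w (.odd i) = 0) {y : ι₀ → Gen p₀ ι₁} (hy : ∀ i, w (y i) ∈ U) (α : ι₁) :
    T.contractZ y α ∈ wspan (Smooth p₀) (Gen.parity p₀ p₁) w U :=
  sum_mem fun i _ => mul_mem_wspan (U := U) (U' := {0}) (by rintro u hu _ rfl; simpa using hu)
    (gen_mem_wspan (hy i)) (coeff_mem_wspan hw _)

/-- The tridegree in the ghosts and the resolution tridegree. -/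
def triWeight (g : Gen p₀ ι₁) : (Fin 3 → ℤ) × (Fin 3 → ℤ) :=
  (fun a => g.trideg a, fun a => g.trires a)

theorem eps_ne_zero {a b c : Fin 3} (h : eps a b c ≠ 0) (d : Fin 3) :
    (if d = a then (1 : ℤ) else 0) + (if d = b then 1 else 0) + (if d = c then 1 else 0) = 1 := by
  revert a b c d; decide

/-- `δ_a` lowers the `a`-th component of the resolution tridegree by one. -/
theorem delta_gen_mem (a : Fin 3) (g : Gen p₀ ι₁) :
    T.delta a (gen (Smooth p₀) (Gen.parity p₀ p₁) g) ∈
      wspan (Smooth p₀) (Gen.parity p₀ p₁) triWeight {triWeight g + (0, -Pi.single a 1)} := by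
  have hodd : ∀ i, triWeight (.odd i : Gen p₀ ι₁) = 0 := fun i => rfl
  rw [delta_gen]
  cases g with
  | odd i => exact zero_mem _
  | ghost c => exact zero_mem _
  | star b A =>
    rw [deltaVal]
    split_ifs with hab
    swap
    · exact zero_mem _
    subst hab
    cases A with
    | phi i =>
      refine neg_mem (wspan_mono ?_ (coeff_mem_wspan hodd _))
      refine Set.singleton_subset_singleton.2 (Prod.ext (by ext; rfl) ?_)
      ext d
      simp [triWeight, Gen.trires, Field.trigh, Pi.single_apply]
    | eta c α =>
      refine zsmul_mem (T.contractZ_mem_wspan hodd (fun i => ?_) α) _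
      refine Prod.ext (by ext; rfl) ?_
      ext d
      simp [triWeight, Gen.trires, Field.trigh, Pi.single_apply]
    | pi c α =>
      refine zsmul_mem (add_mem (sum_mem fun d _ => sum_mem fun e _ =>
        zsmul_of_mem_wspan _ fun h => ?_) (T.contractZ_mem_wspan hodd (fun i => ?_) α)) _
      · refine Prod.ext (by ext; rfl) ?_
        ext f
        have := eps_ne_zero h f
        simp only [triWeight, Gen.trires, Field.trigh, Prod.snd_add, Pi.add_apply, Pi.neg_apply,
          Pi.single_apply]
        push_cast
        split_ifs at * <;> simp_all
      · refine Prod.ext (by ext; rfl) ?_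
        ext d
        simp [triWeight, Gen.trires, Field.trigh, Pi.single_apply]
    | lam α =>
      refine zsmul_mem (sub_mem (sum_mem fun d _ => add_mem (gen_mem_wspan ?_) (gen_mem_wspan ?_))
        (T.contractZ_mem_wspan hodd (fun i => ?_) α)) _
      all_goals
        refine Prod.ext (by ext; rfl) ?_
        ext d
        simp only [triWeight, Gen.trires, Field.trigh, Prod.snd_add, Pi.add_apply, Pi.neg_apply,
          Pi.single_apply, Pi.zero_apply]
        push_cast
        split_ifs <;> simp_all
  | bar b A =>
    refine zsmul_mem (sum_mem fun c _ => zsmul_of_mem_wspan _ fun h => ?_) _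
    refine Prod.ext (by ext; rfl) ?_
    ext d
    have := eps_ne_zero h d
    simp only [triWeight, Gen.trires, Prod.snd_add, Pi.add_apply, Pi.neg_apply, Pi.single_apply]
    push_cast
    split_ifs at * <;> simp_all
  | tilde A =>
    refine zsmul_mem (gen_mem_wspan (U := {_}) ?_) _
    refine Prod.ext (by ext; rfl) ?_
    ext d
    simp only [triWeight, Gen.trires, Prod.snd_add, Pi.add_apply, Pi.neg_apply, Pi.single_apply]
    push_cast
    split_ifs <;> simp_all

end GaugeTheory

theorem wspan_inter {B : Type*} [CommRing B] {G : Type*} {p : G → ZMod 2} {M : Type*}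
    [AddCommMonoid M] {w : G → M} {U V : Set M} {x : SuperPoly B p} (hU : x ∈ wspan B p w U)
    (hV : x ∈ wspan B p w V) : x ∈ wspan B p w (U ∩ V) := by
  rw [← projU_of_mem subset_rfl hU]
  exact projU_mem_wspan_inter hV

theorem projU_comp {B : Type*} [CommRing B] {G : Type*} {p : G → ZMod 2} {M M' : Type*}
    [AddCommMonoid M] [AddCommMonoid M'] (w : G → M) (f : M →+ M') (U : Set M') :
    projU B p (fun g => f (w g)) U = projU B p w (f ⁻¹' U) := by
  refine linearMap_ext_mon fun l => ?_
  rw [projU_mon, projU_mon, Set.mem_preimage, map_list_sum, List.map_map]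
  rfl

namespace GaugeTheory

variable {ι₀ ι₁ : Type*} [Fintype ι₀] [DecidableEq ι₀] {p₀ : ι₀ → ZMod 2} {p₁ : ι₁ → ZMod 2}
  (T : GaugeTheory p₀ p₁)

/-- Exactness of each of the three differentials in positive resolution degree. -/
def DeltaExact : Prop :=
  ∀ (a : Fin 3) (m : ℤ), 0 < m →
    ∀ x ∈ wspan (Smooth p₀) (Gen.parity p₀ p₁) (fun g => (g.res : ℤ)) {m}, T.delta a x = 0 →
      ∃ y, T.delta a y = x

omit [Fintype ι₀] [DecidableEq ι₀] in
theorem cast_res (g : Gen p₀ ι₁) : (g.res : ℤ) = ∑ b, (triWeight g).2 b := by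
  simp [Gen.res, triWeight]

/-- The total resolution degree as a function of the tridegrees. -/
def sumSnd : (Fin 3 → ℤ) × (Fin 3 → ℤ) →+ ℤ where
  toFun u := ∑ b, u.2 b
  map_zero' := by simp
  map_add' u v := by simp [Finset.sum_add_distrib]

omit [DecidableEq ι₀] in
theorem wspan_res (U : Set ℤ) :
    wspan (Smooth p₀) (Gen.parity p₀ p₁) (fun g : Gen p₀ ι₁ => (g.res : ℤ)) U =
      wspan (Smooth p₀) (Gen.parity p₀ p₁) triWeight {u | ∑ b, u.2 b ∈ U} := by
  simp only [cast_res]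
  exact wspan_comp sumSnd U

theorem exactTricomplex (h : T.DeltaExact) :
    ExactTricomplex (triWeight (p₀ := p₀) (ι₁ := ι₁)) T.delta where
  isRightDer := T.isRightDer_delta
  nonneg g b := by simp [triWeight]
  shift := T.delta_gen_mem
  anticomm := T.delta_anticomm
  exact a m hm x hx hδ := h a m hm x (by rw [wspan_res]; exact hx) hδ

/-- The ghost tridegree as a function of the tridegrees. -/
def fstSubSnd : (Fin 3 → ℤ) × (Fin 3 → ℤ) →+ (Fin 3 → ℤ) where
  toFun u := u.1 - u.2
  map_zero' := by simp
  map_add' u v := by simp only [Prod.fst_add, Prod.snd_add]; abel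

omit [DecidableEq ι₀] in
theorem trighPart_eq (d : Fin 3 → ℤ) :
    trighPart p₀ p₁ d =
      wspan (Smooth p₀) (Gen.parity p₀ p₁) (triWeight (p₀ := p₀) (ι₁ := ι₁))
        {u | u.1 - u.2 = d} := by
  have e : (Gen.trigh : Gen p₀ ι₁ → Fin 3 → ℤ) = fun g => fstSubSnd (triWeight g) := rfl
  rw [trighPart, weightPart_eq_wspan, e, wspan_comp]
  rfl

omit [DecidableEq ι₀] in
theorem resPart_le (m : ℕ) :
    resPart p₀ p₁ m ≤
      wspan (Smooth p₀) (Gen.parity p₀ p₁) (triWeight (p₀ := p₀) (ι₁ := ι₁))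
        {u | ∑ b, u.2 b = (m : ℤ)} := by
  intro x hx
  have h := wspan_res (p₀ := p₀) (p₁ := p₁) {(m : ℤ)}
  have h' := wspan_comp (B := Smooth p₀) (p := Gen.parity p₀ p₁) (w := Gen.res)
    (Nat.castAddMonoidHom ℤ) {(m : ℤ)}
  have e : Nat.castAddMonoidHom ℤ ⁻¹' {(m : ℤ)} = {m} := by ext k; simp
  rw [e] at h'
  change _ = resPart p₀ p₁ m at h'
  rw [← h'] at hx
  exact h ▸ hx

omit [DecidableEq ι₀] in
theorem algPos_le :
    algPos p₀ p₁ ≤ wspan (Smooth p₀) (Gen.parity p₀ p₁) (triWeight (p₀ := p₀) (ι₁ := ι₁))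
      {u | u.2 ≤ u.1 ∧ ∑ b, u.2 b < ∑ b, u.1 b} := by
  refine iSup₂_le fun d hd => ?_
  rw [trighPart_eq]
  refine wspan_mono ?_
  rintro u rfl
  refine ⟨sub_nonneg.1 hd.1, ?_⟩
  have := hd.2
  simp only [Pi.sub_apply, Finset.sum_sub_distrib] at this
  simpa using this

omit [DecidableEq ι₀] in
theorem wspan_le_algNonneg (U : Set ((Fin 3 → ℤ) × (Fin 3 → ℤ))) (hU : ∀ u ∈ U, u.2 ≤ u.1) :
    wspan (Smooth p₀) (Gen.parity p₀ p₁) triWeight U ≤ algNonneg p₀ p₁ := by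
  intro x hx
  refine wspan_induction (fun l hl => ?_) hx
  have h : mon (Smooth p₀) (Gen.parity p₀ p₁) l ∈
      trighPart p₀ p₁ ((l.map triWeight).sum.1 - (l.map triWeight).sum.2) := by
    rw [trighPart_eq]
    exact mon_mem_wspan rfl
  exact Submodule.mem_iSup_of_mem _ (Submodule.mem_iSup_of_mem (sub_nonneg.2 (hU _ hl)) h)

theorem totalDelta_projU (D : Fin 3 → ℤ) (x : Alg p₀ p₁) :
    projU (Smooth p₀) (Gen.parity p₀ p₁) triWeight {u | u.1 = D} (T.totalDelta x) =
      T.totalDelta (projU (Smooth p₀) (Gen.parity p₀ p₁) triWeight {u | u.1 = D} x) := by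
  simp only [totalDelta, LinearMap.sum_apply, map_sum]
  refine Finset.sum_congr rfl fun a _ => ?_
  rw [(T.isRightDer_delta a).projU_comm (T.delta_gen_mem a)]
  simp

/-- The case of a fixed tridegree `D` in the ghosts: nonnegative ghost tridegree says that the
resolution tridegree lies in the box `r ≤ D`, positive ghost tridegree that it is not the top of the
box. -/
theorem exists_of_deltaExact_of_trideg (h : T.DeltaExact) {m : ℕ} (hm : 0 < m) {F : Alg p₀ p₁}
    {D : Fin 3 → ℤ} (hF : F ∈ wspan (Smooth p₀) (Gen.parity p₀ p₁) triWeight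
      {u | (u.2 ≤ u.1 ∧ ∑ b, u.2 b < ∑ b, u.1 b) ∧ ∑ b, u.2 b = (m : ℤ) ∧ u.1 = D})
    (hδ : T.totalDelta F = 0) :
    ∃ P ∈ algNonneg p₀ p₁, T.totalDelta P = F := by
  have hnn : F ∈ wspan (Smooth p₀) (Gen.parity p₀ p₁) triWeight {u | 0 ≤ u.2} :=
    wspan_induction (fun l _ => mon_mem_wspan ((T.exactTricomplex h).sum_nonneg l))
      (mem_wspan_univ _ _ triWeight F)
  by_cases hmD : (m : ℤ) < ∑ b, D b
  · have hbox : F ∈ wspan (Smooth p₀) (Gen.parity p₀ p₁) triWeight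
        (boxSet Finset.univ D D 0 m) := by
      refine wspan_mono ?_ (wspan_inter hF hnn)
      rintro u ⟨⟨⟨h1, -⟩, h2, rfl⟩, h3⟩
      exact ⟨rfl, h3, h2, fun b _ => h1 b, fun b hb => absurd (Finset.mem_univ b) hb⟩
    obtain ⟨P, hP, hPF⟩ := (T.exactTricomplex h).exact_boxSet Finset.univ D D 0 m
      (by exact_mod_cast hm) (by simpa using hmD) F hbox hδ
    refine ⟨P, wspan_le_algNonneg _ ?_ hP, hPF⟩
    rintro u ⟨rfl, -, -, h4, -⟩ b
    exact h4 b (Finset.mem_univ b)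
  · refine ⟨0, zero_mem _, ?_⟩
    rw [map_zero]
    refine ((Submodule.mem_bot (Smooth p₀)).1 ?_).symm
    rw [← wspan_empty (w := triWeight)]
    refine wspan_mono ?_ hF
    rintro u ⟨⟨-, h1⟩, h2, rfl⟩
    exact hmD (h2 ▸ h1)

/-- The positivity theorem, given the exactness of the three differentials. -/
theorem exists_of_deltaExact (h : T.DeltaExact) {m : ℕ} (hm : 0 < m) {F : Alg p₀ p₁}
    (hF : F ∈ algPos p₀ p₁) (hres : F ∈ resPart p₀ p₁ m) (hδ : T.totalDelta F = 0) :
    ∃ P ∈ algNonneg p₀ p₁, T.totalDelta P = F := by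
  have hF' := wspan_inter (algPos_le hF) (resPart_le m hres)
  obtain ⟨s, hs⟩ := exists_sum_projU
    (fun g : Gen p₀ ι₁ => AddMonoidHom.fst (Fin 3 → ℤ) (Fin 3 → ℤ) (triWeight g)) F
  have hD (D : Fin 3 → ℤ) : ∃ P ∈ algNonneg p₀ p₁,
      T.totalDelta P = projU (Smooth p₀) (Gen.parity p₀ p₁) triWeight {u | u.1 = D} F := by
    refine T.exists_of_deltaExact_of_trideg h hm (D := D)
      (wspan_mono ?_ (projU_mem_wspan_inter hF')) ?_
    · rintro u ⟨h1, h2, h3⟩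
      exact ⟨h2, h3, h1⟩
    · rw [← totalDelta_projU, hδ, map_zero]
  choose P hP hPF using hD
  refine ⟨∑ D ∈ s, P D, sum_mem fun D _ => hP D, ?_⟩
  rw [map_sum]
  conv_rhs => rw [hs]
  refine Finset.sum_congr rfl fun D _ => ?_
  rw [hPF, projU_comp]
  rfl

end GaugeTheory

/-! ### From local to global exactness -/

section Gluing

open scoped Manifold Topology

variable {ι₀ ι₁ : Type*} [Fintype ι₀] {p₀ : ι₀ → ZMod 2} {p₁ : ι₁ → ZMod 2}

/-- Membership in a finitely generated submodule is local on the body, in modules whose elements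
are separated by the linear functionals: local coefficients are glued by a partition of unity. -/
theorem mem_span_range_of_local {A : Type*} [AddCommGroup A] [Module (Smooth p₀) A]
    (hsep : ∀ x : A, (∀ f : A →ₗ[Smooth p₀] Smooth p₀, f x = 0) → x = 0) {κ : Type*} [Fintype κ]
    (v : κ → A) (c : A)
    (h : ∀ x : Body p₀, ∃ ρ : Smooth p₀, ρ.1 x ≠ 0 ∧
      ρ • c ∈ Submodule.span (Smooth p₀) (Set.range v)) :
    c ∈ Submodule.span (Smooth p₀) (Set.range v) := by
  -- The coefficients at `x` that represent `c` under all functionals form an affine space.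
  let t : Body p₀ → Set (κ → ℂ) := fun x =>
    {β | ∀ f : A →ₗ[Smooth p₀] Smooth p₀, ∑ k, β k * (f (v k)).1 x = (f c).1 x}
  have ht (x : Body p₀) : Convex ℝ (t x) := by
    intro β hβ γ hγ a b _ _ hab f
    have h1 := hβ f
    have h2 := hγ f
    simp only [Pi.add_apply, Pi.smul_apply, add_mul, Finset.sum_add_distrib, smul_mul_assoc,
      ← Finset.smul_sum, h1, h2, ← add_smul, hab, one_smul]
  have hloc (x : Body p₀) : ∃ U ∈ 𝓝 x, ∃ g : Body p₀ → (κ → ℂ),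
      ContMDiffOn 𝓘(ℝ, Body p₀) 𝓘(ℝ, κ → ℂ) ∞ g U ∧ ∀ y ∈ U, g y ∈ t y := by
    obtain ⟨ρ, hρ, hc⟩ := h x
    obtain ⟨b, hb⟩ := (Submodule.mem_span_range_iff_exists_fun (Smooth p₀)).1 hc
    have hcont : Continuous ρ.1 := (contDiff_smooth ρ).continuous
    refine ⟨{y | ρ.1 y ≠ 0}, (isOpen_ne.preimage hcont).mem_nhds hρ,
      fun y k => (ρ.1 y)⁻¹ * (b k).1 y, ?_, fun y hy f => ?_⟩
    · rw [contMDiffOn_iff_contDiffOn]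
      refine contDiffOn_pi.2 fun k => ContDiffOn.mul ?_ (contDiff_smooth (b k)).contDiffOn
      exact (contDiff_smooth ρ).contDiffOn.inv fun y hy => hy
    · have h1 := congrArg (fun z => (f z).1 y) hb
      simp only [map_sum, map_smul, smul_eq_mul] at h1
      rw [AddSubmonoidClass.coe_finsetSum, Finset.sum_apply] at h1
      change ∑ k, (b k).1 y * (f (v k)).1 y = ρ.1 y * (f c).1 y at h1
      simp only [mul_assoc]
      rw [← Finset.mul_sum, h1, inv_mul_cancel_left₀ hy]
  obtain ⟨g, hg⟩ := exists_contMDiffMap_forall_mem_convex_of_local 𝓘(ℝ, Body p₀) ht hloc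
  have hgs (k : κ) : ContDiff ℝ ∞ fun x => g x k :=
    contDiff_pi.1 (contMDiff_iff_contDiff.1 g.contMDiff) k
  rw [Submodule.mem_span_range_iff_exists_fun]
  refine ⟨fun k => ⟨fun x => g x k, hgs k⟩, sub_eq_zero.1 (hsep _ fun f => ?_)⟩
  rw [map_sub, sub_eq_zero, map_sum]
  ext x
  simp only [map_smul, smul_eq_mul]
  rw [AddSubmonoidClass.coe_finsetSum, Finset.sum_apply]
  exact hg x f

instance [Finite ι₁] : Finite (Gen p₀ ι₁) := by
  let F : Field ι₀ ι₁ → (ι₀ ⊕ Fin 3 × ι₁ ⊕ Fin 3 × ι₁ ⊕ ι₁) := fun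
    | .phi i => .inl i
    | .eta a α => .inr (.inl (a, α))
    | .pi a α => .inr (.inr (.inl (a, α)))
    | .lam α => .inr (.inr (.inr α))
  have hF : Function.Injective F := by
    rintro (_ | _ | _ | _) (_ | _ | _ | _) h <;> simp_all [F]
  have : Finite (Field ι₀ ι₁) := Finite.of_injective F hF
  have hGh : Function.Injective (Ghost.toField (ι₁ := ι₁) ι₀) := by
    rintro (_ | _ | _) (_ | _ | _) h <;> simp_all [Ghost.toField]
  have : Finite (Ghost ι₁) := Finite.of_injective _ hGh
  let H : Gen p₀ ι₁ → ({i : ι₀ // p₀ i = 1} ⊕ Ghost ι₁ ⊕ Fin 3 × Field ι₀ ι₁ ⊕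
      Fin 3 × Field ι₀ ι₁ ⊕ Field ι₀ ι₁) := fun
    | .odd i => .inl i
    | .ghost c => .inr (.inl c)
    | .star a A => .inr (.inr (.inl (a, A)))
    | .bar a A => .inr (.inr (.inr (.inl (a, A))))
    | .tilde A => .inr (.inr (.inr (.inr A)))
  refine Finite.of_injective H ?_
  rintro (_ | _ | _ | _ | _) (_ | _ | _ | _ | _) h <;> simp_all [H]

/-- The number of ghosts. -/
def Gen.ghostCount : Gen p₀ ι₁ → ℤ
  | .ghost _ => 1
  | _ => 0

/-- The number of odd fields. -/
def Gen.oddCount : Gen p₀ ι₁ → ℤ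
  | .odd _ => 1
  | _ => 0

/-- Monomials with many odd fields vanish, as each odd field squares to zero. -/
theorem mon_eq_zero_of_oddCount {l : List (Gen p₀ ι₁)}
    (hl : (Fintype.card ι₀ : ℤ) < (l.map Gen.oddCount).sum) :
    mon (Smooth p₀) (Gen.parity p₀ p₁) l = 0 := by
  classical
  let s : Finset (Gen p₀ ι₁) :=
    (Finset.univ : Finset {i : ι₀ // p₀ i = 1}).map ⟨Gen.odd, fun _ _ h => by simpa using h⟩
  refine mon_eq_zero_of_card (s := s) (fun g hg => ?_) (lt_of_le_of_lt ?_ (hl.trans_eq ?_))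
  · obtain ⟨i, -, rfl⟩ := Finset.mem_map.1 hg
    exact i.2
  · rw [Finset.card_map, Finset.card_univ]
    exact_mod_cast Fintype.card_subtype_le _
  · congr 2
    ext g
    have hodd (i : {i : ι₀ // p₀ i = 1}) : (Gen.odd i : Gen p₀ ι₁) ∈ s :=
      Finset.mem_map.2 ⟨i, Finset.mem_univ _, rfl⟩
    cases g with
    | odd i => rw [if_pos (hodd i)]; rfl
    | _ => simp [s, Gen.oddCount]

omit [Fintype ι₀] in
theorem Gen.one_le_res (g : Gen p₀ ι₁) : 1 ≤ (g.res : ℤ) + g.ghostCount + g.oddCount := by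
  cases g with
  | odd i => simp [Gen.res, Gen.trires, ghostCount, oddCount]
  | ghost c => simp [Gen.res, Gen.trires, ghostCount, oddCount]
  | star a A =>
    have h : 1 ≤ (Gen.star a A : Gen p₀ ι₁).trires a := by simp [Gen.trires]
    have := Finset.single_le_sum (f := (Gen.star a A : Gen p₀ ι₁).trires)
      (fun b _ => Nat.zero_le _) (Finset.mem_univ a)
    simp only [Gen.res, ghostCount, oddCount]
    omega
  | bar a A =>
    have h : 1 ≤ (Gen.bar a A : Gen p₀ ι₁).trires (a + 1) := by simp [Gen.trires]
    have := Finset.single_le_sum (f := (Gen.bar a A : Gen p₀ ι₁).trires)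
      (fun b _ => Nat.zero_le _) (Finset.mem_univ (a + 1))
    simp only [Gen.res, ghostCount, oddCount]
    omega
  | tilde A =>
    have h : 1 ≤ (Gen.tilde A : Gen p₀ ι₁).trires 0 := by simp [Gen.trires]
    have := Finset.single_le_sum (f := (Gen.tilde A : Gen p₀ ι₁).trires)
      (fun b _ => Nat.zero_le _) (Finset.mem_univ 0)
    simp only [Gen.res, ghostCount, oddCount]
    omega

omit [Fintype ι₀] in
/-- Every generator is counted by one of the three degrees, so that these bound the length of words.
-/
theorem length_le (l : List (Gen p₀ ι₁)) :
    (l.length : ℤ) ≤ (l.map fun g => (g.res : ℤ)).sum + (l.map Gen.ghostCount).sum +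
      (l.map Gen.oddCount).sum := by
  induction l with
  | nil => simp
  | cons g l ih =>
    have := g.one_le_res
    simp only [List.length_cons, List.map_cons, List.sum_cons]
    push_cast
    omega

/-- The resolution degree and the number of ghosts. -/
def Gen.resGhost (g : Gen p₀ ι₁) : ℤ × ℤ := (g.res, g.ghostCount)

omit [Fintype ι₀] in
theorem sum_resGhost (l : List (Gen p₀ ι₁)) :
    (l.map Gen.resGhost).sum = ((l.map fun g => (g.res : ℤ)).sum, (l.map Gen.ghostCount).sum) := by
  induction l with
  | nil => rfl
  | cons g l ih => rw [List.map_cons, List.sum_cons, ih]; rfl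

theorem wspan_fst {B : Type*} [CommRing B] {G : Type*} {p : G → ZMod 2} {M M' : Type*}
    [AddCommMonoid M] [AddCommMonoid M'] (w : G → M × M') (U : Set M) :
    wspan B p (fun g => (w g).1) U = wspan B p w {u | u.1 ∈ U} :=
  wspan_comp (AddMonoidHom.fst M M') U

theorem wspan_snd {B : Type*} [CommRing B] {G : Type*} {p : G → ZMod 2} {M M' : Type*}
    [AddCommMonoid M] [AddCommMonoid M'] (w : G → M × M') (U : Set M') :
    wspan B p (fun g => (w g).2) U = wspan B p w {u | u.2 ∈ U} :=
  wspan_comp (AddMonoidHom.snd M M') U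

theorem wspan_res_eq (U : Set ℤ) :
    wspan (Smooth p₀) (Gen.parity p₀ p₁) (fun g : Gen p₀ ι₁ => (g.res : ℤ)) U =
      wspan (Smooth p₀) (Gen.parity p₀ p₁) Gen.resGhost {u | u.1 ∈ U} :=
  wspan_fst Gen.resGhost U

theorem wspan_ghostCount_eq (U : Set ℤ) :
    wspan (Smooth p₀) (Gen.parity p₀ p₁) (Gen.ghostCount : Gen p₀ ι₁ → ℤ) U =
      wspan (Smooth p₀) (Gen.parity p₀ p₁) Gen.resGhost {u | u.2 ∈ U} :=
  wspan_snd Gen.resGhost U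

end Gluing

namespace GaugeTheory

variable {ι₀ ι₁ : Type*} [Fintype ι₀] [DecidableEq ι₀] {p₀ : ι₀ → ZMod 2} {p₁ : ι₁ → ZMod 2}
  (T : GaugeTheory p₀ p₁)

/-- Exactness of `δ_a` in positive resolution degree near a point of the body: cycles become
boundaries after multiplication by a function that does not vanish at the point. -/
def LocallyExactAt (a : Fin 3) (x : Body p₀) : Prop :=
  ∀ m : ℤ, 0 < m →
    ∀ c ∈ wspan (Smooth p₀) (Gen.parity p₀ p₁) (fun g => (g.res : ℤ)) {m}, T.delta a c = 0 →
      ∃ ρ : Smooth p₀, ρ.1 x ≠ 0 ∧ ∃ y, T.delta a y = ρ • c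

theorem delta_mem_wspan_of_le {M : Type*} [AddCommMonoid M]
    (f : (Fin 3 → ℤ) × (Fin 3 → ℤ) →+ M) (a : Fin 3) (g : Gen p₀ ι₁) :
    T.delta a (gen (Smooth p₀) (Gen.parity p₀ p₁) g) ∈
      wspan (Smooth p₀) (Gen.parity p₀ p₁) (fun g => f (triWeight g))
        {f (triWeight g) + f (0, -Pi.single a 1)} := by
  rw [wspan_comp]
  refine wspan_mono ?_ (T.delta_gen_mem a g)
  rintro _ rfl
  rw [Set.mem_preimage, map_add]
  rfl

theorem delta_gen_mem_res (a : Fin 3) (g : Gen p₀ ι₁) :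
    T.delta a (gen (Smooth p₀) (Gen.parity p₀ p₁) g) ∈
      wspan (Smooth p₀) (Gen.parity p₀ p₁) (fun g => (g.res : ℤ)) {(g.res : ℤ) + -1} := by
  have h := T.delta_mem_wspan_of_le sumSnd a g
  have e : sumSnd (0, -Pi.single a 1) = -1 := by simp [sumSnd]
  have e' (g : Gen p₀ ι₁) : sumSnd (triWeight g) = (g.res : ℤ) := (cast_res g).symm
  simp only [e, e'] at h
  exact h

/-- The differentials preserve the number of ghosts, which they neither act on nor produce. -/
theorem deltaVal_mem_ghostCount (a : Fin 3) (g : Gen p₀ ι₁) :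
    T.deltaVal a g ∈ wspan (Smooth p₀) (Gen.parity p₀ p₁) Gen.ghostCount {g.ghostCount} := by
  have hodd : ∀ i, Gen.ghostCount (.odd i : Gen p₀ ι₁) = 0 := fun i => rfl
  have hZ (y : ι₀ → Gen p₀ ι₁) (hy : ∀ i, (y i).ghostCount = 0) (α : ι₁) :
      T.contractZ y α ∈ wspan (Smooth p₀) (Gen.parity p₀ p₁) Gen.ghostCount {0} :=
    T.contractZ_mem_wspan hodd (U := {0}) hy α
  cases g with
  | odd i => exact zero_mem _
  | ghost c => exact zero_mem _
  | star b A =>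
    rw [deltaVal]
    split_ifs
    swap
    · exact zero_mem _
    cases A with
    | phi i => exact neg_mem (coeff_mem_wspan hodd _)
    | eta c α => exact zsmul_mem (hZ _ (fun i => rfl) α) _
    | pi c α =>
      refine zsmul_mem (add_mem (sum_mem fun d _ => sum_mem fun e _ =>
        zsmul_of_mem_wspan _ fun _ => ?_) (hZ _ (fun i => rfl) α)) _
      exact Set.mem_singleton _
    | lam α =>
      refine zsmul_mem (sub_mem (sum_mem fun d _ => add_mem (gen_mem_wspan ?_) (gen_mem_wspan ?_))
        (hZ _ (fun i => rfl) α)) _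
      all_goals exact Set.mem_singleton _
  | bar b A =>
    refine zsmul_mem (sum_mem fun c _ => zsmul_of_mem_wspan _ fun _ => ?_) _
    exact Set.mem_singleton _
  | tilde A =>
    refine zsmul_mem (gen_mem_wspan ?_) _
    exact Set.mem_singleton _

theorem delta_gen_mem_resGhost (a : Fin 3) (g : Gen p₀ ι₁) :
    T.delta a (gen (Smooth p₀) (Gen.parity p₀ p₁) g) ∈
      wspan (Smooth p₀) (Gen.parity p₀ p₁) Gen.resGhost {g.resGhost + (-1, 0)} := by
  have h1 := T.delta_gen_mem_res a g
  have h2 := T.deltaVal_mem_ghostCount a g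
  rw [← delta_gen] at h2
  rw [wspan_res_eq] at h1
  rw [wspan_ghostCount_eq] at h2
  refine wspan_mono ?_ (wspan_inter h1 h2)
  rintro ⟨u, v⟩ ⟨hu, hv⟩
  exact Prod.ext hu (Eq.trans hv (add_zero _).symm)

/-- Local exactness at all points of the body implies exactness. -/
theorem deltaExact_of_locally [Finite ι₁] (h : ∀ a x, T.LocallyExactAt a x) : T.DeltaExact := by
  classical
  intro a m hm c hc hδ
  have hcomm (U : Set (ℤ × ℤ)) (x : Alg p₀ p₁) :=
    (T.isRightDer_delta a).projU_comm (T.delta_gen_mem_resGhost a) U x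
  obtain ⟨s, hs⟩ := exists_sum_projU (Gen.resGhost (p₀ := p₀) (ι₁ := ι₁)) c
  rw [wspan_res_eq] at hc
  have key (u : ℤ × ℤ) : ∃ y, T.delta a y = projU (Smooth p₀) _ Gen.resGhost {u} c := by
    set cu := projU (Smooth p₀) (Gen.parity p₀ p₁) Gen.resGhost {u} c with hcu
    by_cases hum : u.1 = m
    swap
    · refine ⟨0, ?_⟩
      rw [map_zero, hcu, projU_of_disjoint ?_ hc]
      rw [Set.disjoint_singleton_right]
      exact hum
    have hcum : cu ∈ wspan (Smooth p₀) (Gen.parity p₀ p₁) Gen.resGhost {u} := projU_mem _ _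
    have hδu : T.delta a cu = 0 := by
      have := hcomm {u + (-1, 0)} c
      rw [hδ, map_zero] at this
      simpa [hcu] using this.symm
    -- The words that can contribute to a preimage have bounded length.
    let N : ℕ := (m + 1 + u.2 + Fintype.card ι₀).toNat
    have : Finite {l : List (Gen p₀ ι₁) // l.length ≤ N} :=
      (List.finite_length_le (Gen p₀ ι₁) N).to_subtype
    have := Fintype.ofFinite {l : List (Gen p₀ ι₁) // l.length ≤ N}
    let v : {l : List (Gen p₀ ι₁) // l.length ≤ N} → Alg p₀ p₁ := fun l =>
      T.delta a (mon (Smooth p₀) _ l.1)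
    have hmem (y : Alg p₀ p₁)
        (hy : y ∈ wspan (Smooth p₀) (Gen.parity p₀ p₁) Gen.resGhost {u - (-1, 0)}) :
        T.delta a y ∈ Submodule.span (Smooth p₀) (Set.range v) := by
      refine wspan_induction
        (N := (Submodule.span (Smooth p₀) (Set.range v)).comap (T.delta a)) (fun l hl => ?_) hy
      rw [Submodule.mem_comap]
      by_cases hodd : (Fintype.card ι₀ : ℤ) < (l.map Gen.oddCount).sum
      · rw [mon_eq_zero_of_oddCount hodd, map_zero]; exact zero_mem _
      · refine Submodule.subset_span ⟨⟨l, ?_⟩, rfl⟩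
        have h1 := length_le l
        rw [sum_resGhost, Set.mem_singleton_iff, Prod.ext_iff] at hl
        obtain ⟨h2, h3⟩ := hl
        simp only [Prod.fst_sub, Prod.snd_sub] at h2 h3
        have : (l.length : ℤ) ≤ m + 1 + u.2 + Fintype.card ι₀ := by omega
        omega
    have hspan := mem_span_range_of_local (A := Alg p₀ p₁)
      (fun x hx => eq_zero_of_functionals hx) v cu (fun x => by
        obtain ⟨ρ, hρ, y, hy⟩ := h a x m hm cu (by
          rw [wspan_res_eq]
          exact wspan_mono (by rintro _ rfl; exact hum) hcum) hδu
        refine ⟨ρ, hρ, ?_⟩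
        have h1 := hcomm {u} y
        rw [hy, map_smul, projU_of_mem subset_rfl hcum] at h1
        rw [h1]
        refine hmem _ (wspan_mono ?_ (projU_mem _ _))
        intro w hw
        exact eq_sub_of_add_eq hw)
    obtain ⟨b, hb⟩ := (Submodule.mem_span_range_iff_exists_fun (Smooth p₀)).1 hspan
    refine ⟨∑ l, b l • mon (Smooth p₀) _ l.1, ?_⟩
    rw [map_sum, ← hb]
    simp only [map_smul]
    rfl
  choose y hy using key
  refine ⟨∑ u ∈ s, y u, ?_⟩
  rw [map_sum]
  simp only [hy]
  exact hs.symm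

end GaugeTheory

/-! ### Exactness away from the stationary surface -/

section Nilpotent

variable {B : Type*} [CommRing B] {G : Type*} {p : G → ZMod 2}

/-- Every element is its body plus terms with at least one generator. -/
theorem sub_aug_mem (x : SuperPoly B p) :
    x - algebraMap B _ (aug B p x) ∈ wspan B p (fun _ => (1 : ℤ)) (Set.Ici 1) := by
  refine wspan_induction (w := fun _ => (1 : ℤ))
    (N := (wspan B p (fun _ => (1 : ℤ)) (Set.Ici 1)).comap
      (LinearMap.id - Algebra.linearMap B (SuperPoly B p) ∘ₗ (aug B p).toLinearMap))
    (fun l hl => ?_) (mem_wspan_univ B p _ x)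
  clear hl
  rw [Submodule.mem_comap]
  simp only [LinearMap.sub_apply, LinearMap.id_apply, LinearMap.comp_apply,
    AlgHom.toLinearMap_apply, Algebra.linearMap_apply]
  cases l with
  | nil => simp
  | cons g l =>
    rw [mon_cons, map_mul, aug_gen, zero_mul, map_zero, sub_zero, ← mon_cons]
    refine mon_mem_wspan ?_
    have : 0 ≤ (l.map fun _ => (1 : ℤ)).sum := by simp
    simp only [List.map_cons, List.sum_cons, Set.mem_Ici]
    omega

theorem pow_mem_wspan_Ici {x : SuperPoly B p} (hx : x ∈ wspan B p (fun _ => (1 : ℤ)) (Set.Ici 1))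
    (k : ℕ) : x ^ k ∈ wspan B p (fun _ => (1 : ℤ)) (Set.Ici (k : ℤ)) := by
  induction k with
  | zero => rw [pow_zero]; exact one_mem_wspan (by simp)
  | succ k ih =>
    rw [pow_succ]
    refine mul_mem_wspan ?_ ih hx
    intro u hu u' hu'
    simp only [Set.mem_Ici, Nat.cast_add, Nat.cast_one] at *
    omega

/-- Over finitely many odd generators, terms of high degree vanish. -/
theorem wspan_Ici_eq_bot [Algebra ℂ B] [Fintype G] (hp : ∀ g, p g = 1) {k : ℤ}
    (hk : (Fintype.card G : ℤ) < k) : wspan B p (fun _ => (1 : ℤ)) (Set.Ici k) = ⊥ := by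
  classical
  have h := wspan_eq_bot_of_card (B := B) (s := Finset.univ) (fun g _ => hp g) (U := Set.Ici k)
    (fun u hu => lt_of_lt_of_le hk hu)
  simpa using h

end Nilpotent

theorem body_eq_aug {ι₀ : Type*} [Fintype ι₀] (p₀ : ι₀ → ZMod 2) :
    body p₀ = aug (Smooth p₀) _ := rfl

/-- The body of a superfunction of odd parity vanishes. -/
theorem aug_eq_zero_of_mem {B : Type*} [CommRing B] {G : Type*} {p : G → ZMod 2} {c : ZMod 2}
    (hc : c ≠ 0) {x : SuperPoly B p} (hx : x ∈ parityPart B p c) : aug B p x = 0 := by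
  refine LinearMap.mem_ker.1 (wspan_induction (w := p) (U := {c})
    (N := LinearMap.ker (aug B p).toLinearMap) (fun l hl => ?_) hx)
  rw [LinearMap.mem_ker, AlgHom.toLinearMap_apply]
  cases l with
  | nil => exact absurd (by simpa using hl : (0 : ZMod 2) = c).symm hc
  | cons g l => rw [mon_cons, map_mul, aug_gen, zero_mul]

theorem aug_parityAut {B : Type*} [CommRing B] {G : Type*} {p : G → ZMod 2} (x : SuperPoly B p) :
    aug B p (parityAut B p x) = aug B p x := by
  refine LinearMap.congr_fun (f := (aug B p).toLinearMap ∘ₗ (parityAut B p).toLinearMap)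
    (g := (aug B p).toLinearMap) (linearMap_ext_mon fun l => ?_) x
  change aug B p (tw B p 1 (mon B p l)) = aug B p (mon B p l)
  rw [tw_mon]
  cases l with
  | nil => simp [sgn_zero]
  | cons g l => rw [map_zsmul, mon_cons, map_mul, aug_gen, zero_mul, smul_zero]

namespace GaugeTheory

variable {ι₀ ι₁ : Type*} [Fintype ι₀] [DecidableEq ι₀] {p₀ : ι₀ → ZMod 2} {p₁ : ι₁ → ZMod 2}
  (T : GaugeTheory p₀ p₁)

omit [DecidableEq ι₀] in
theorem exists_pow_eq_zero (F : FieldAlg p₀) :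
    ∃ k : ℕ, (F - algebraMap _ _ (body p₀ F)) ^ k = 0 := by
  refine ⟨Fintype.card {i : ι₀ // p₀ i = 1} + 1, ?_⟩
  have h := pow_mem_wspan_Ici (sub_aug_mem F) (Fintype.card {i : ι₀ // p₀ i = 1} + 1)
  rw [wspan_Ici_eq_bot (fun i => i.2) (by push_cast; omega)] at h
  exact (Submodule.mem_bot _).1 h

theorem body_derivL (i : ι₀) (F : FieldAlg p₀) :
    body p₀ (derivL p₀ i F) = body p₀ (derivR p₀ i F) := by
  unfold derivL
  split_ifs
  · rfl
  · exact aug_parityAut _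

/-- Where some field equation does not hold, its left-hand side is invertible up to nilpotent terms,
and the antifield of the field contracts the complex. -/
theorem locallyExactAt_of_ne (a : Fin 3) {x : Body p₀} {i : ι₀}
    (hi : (body p₀ (derivR p₀ i T.S₀)).1 x ≠ 0) : T.LocallyExactAt a x := by
  intro m _ c _ hδ
  set z := derivL p₀ i T.S₀
  set f := body p₀ z with hf
  set n := z - algebraMap _ _ f with hn
  have hz : T.delta a (Alg.of p₀ p₁ (.star a (.phi i))) = -coeff p₀ p₁ z := by
    rw [delta_of, deltaVal, if_pos rfl]; rfl
  have hcoeff : coeff p₀ p₁ z = algebraMap _ _ f + coeff p₀ p₁ n := by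
    rw [hn, map_sub, AlgHom.commutes]; abel
  have key (k : ℕ) : ∀ c : Alg p₀ p₁, T.delta a c = 0 →
      ∃ y, T.delta a y = f ^ k • c - (-1 : ℤ) ^ k • (c * coeff p₀ p₁ n ^ k) := by
    induction k with
    | zero => intro c _; exact ⟨0, by simp⟩
    | succ k ih =>
      intro c hc
      obtain ⟨y, hy⟩ := ih (c * coeff p₀ p₁ n) (by
        rw [T.isRightDer_delta a, delta_coeff, hc, mul_zero, zero_mul, add_zero])
      refine ⟨-(f ^ k • (c * Alg.of p₀ p₁ (.star a (.phi i)))) - y, ?_⟩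
      rw [map_sub, map_neg, map_smul, T.isRightDer_delta a, hc, hz, hy, hcoeff, zero_mul, add_zero,
        mul_neg, mul_add, ← Algebra.commutes, ← Algebra.smul_def, pow_succ f,
        pow_succ' (coeff _ _ _), mul_smul, pow_succ (-1 : ℤ), mul_smul, smul_neg, neg_neg, smul_add,
        mul_assoc c]
      simp only [neg_smul, one_smul, smul_neg]
      abel
  -- As `n` is nilpotent, `f ^ k • c` is a boundary for large `k`.
  obtain ⟨k, hk⟩ := exists_pow_eq_zero z
  obtain ⟨y, hy⟩ := key k c hδ
  rw [← map_pow (coeff p₀ p₁) n k, show n ^ k = 0 from hk, map_zero, mul_zero, smul_zero,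
    sub_zero] at hy
  refine ⟨f ^ k, ?_, y, hy⟩
  change (f.1 x) ^ k ≠ 0
  rw [hf, body_derivL]
  exact pow_ne_zero k hi

end GaugeTheory

/-! ### Exactness up to denominators: filtrations, contractions and Koszul complexes -/

section SatRange

variable {B : Type*} [CommRing B] {A : Type*} [AddCommGroup A] [Module B A]

/-- The elements that become values of `D` after multiplication by an element of `S`. -/
def satRange (S : Submonoid B) (D : A →ₗ[B] A) : Submodule B A where
  carrier := {c | ∃ s ∈ S, ∃ b, D b = s • c}
  zero_mem' := ⟨1, S.one_mem, 0, by simp⟩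
  add_mem' := by
    rintro c c' ⟨s, hs, b, hb⟩ ⟨s', hs', b', hb'⟩
    refine ⟨s * s', S.mul_mem hs hs', s' • b + s • b', ?_⟩
    rw [map_add, map_smul, map_smul, hb, hb', smul_add, smul_smul, smul_smul, mul_comm s' s]
  smul_mem' := by
    rintro f c ⟨s, hs, b, hb⟩
    exact ⟨s, hs, f • b, by rw [map_smul, hb, smul_comm]⟩

theorem mem_satRange {S : Submonoid B} {D : A →ₗ[B] A} {c : A} :
    c ∈ satRange S D ↔ ∃ s ∈ S, ∃ b, D b = s • c := Iff.rfl

theorem mem_satRange_of_smul {S : Submonoid B} {D : A →ₗ[B] A} {c : A} {s : B} (hs : s ∈ S)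
    (h : s • c ∈ satRange S D) : c ∈ satRange S D := by
  obtain ⟨s', hs', b, hb⟩ := h
  exact ⟨s' * s, S.mul_mem hs' hs, b, by rw [hb, smul_smul]⟩

theorem apply_mem_satRange (S : Submonoid B) (D : A →ₗ[B] A) (b : A) : D b ∈ satRange S D :=
  ⟨1, S.one_mem, b, (one_smul _ _).symm⟩

/-- Submodules over a `ℂ`-algebra are saturated with respect to nonzero integers. -/
theorem mem_of_zsmul_mem [Algebra ℂ B] (N : Submodule B A) {n : ℤ} (hn : n ≠ 0) {c : A}
    (h : n • c ∈ N) : c ∈ N := by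
  have e : algebraMap ℂ B ((n : ℂ)⁻¹) • n • c = c := by
    have h1 : algebraMap ℂ B ((n : ℂ)⁻¹) * (n : B) = 1 := by
      rw [← map_intCast (algebraMap ℂ B), ← map_mul,
        inv_mul_cancel₀ (by exact_mod_cast hn), map_one]
    rw [← Int.cast_smul_eq_zsmul B n c, smul_smul, h1, one_smul]
  rw [← e]
  exact N.smul_mem _ h

end SatRange

section Filtration

variable {B : Type*} [CommRing B] {G : Type*} {p : G → ZMod 2}

theorem exists_mem_wspan_Ici (v : G → ℤ) (x : SuperPoly B p) :
    ∃ k : ℤ, x ∈ wspan B p v (Set.Ici k) := by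
  obtain ⟨s, hs⟩ := exists_sum_projU v x
  obtain ⟨k, hk⟩ := s.bddBelow
  refine ⟨k, ?_⟩
  rw [hs]
  refine sum_mem fun d hd => wspan_mono ?_ (projU_mem _ _)
  rintro _ rfl
  exact hk hd

/-- Cycles of a filtered differential `δ` are boundaries (up to denominators) if this holds for the
leading part `δ₀`, provided that the filtration is bounded above. -/
theorem mem_satRange_of_leading {S : Submonoid B} {v r : G → ℤ}
    {δ δ₀ : SuperPoly B p →ₗ[B] SuperPoly B p} (hδ : IsRightDer 1 δ) (hδ₀ : IsRightDer 1 δ₀)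
    (hsq : ∀ x, δ (δ x) = 0)
    (hg₀ : ∀ g, δ₀ (gen B p g) ∈ wspan B p (fun g => (v g, r g)) {(v g, r g - 1)})
    (hg : ∀ g, δ (gen B p g) - δ₀ (gen B p g) ∈
      wspan B p (fun g => (v g, r g)) {u | v g + 1 ≤ u.1 ∧ u.2 = r g - 1})
    {m : ℤ} {V : ℤ} (hV : wspan B p (fun g => (v g, r g)) {u | V < u.1 ∧ u.2 = m} = ⊥)
    (hloc : ∀ k : ℤ, ∀ c ∈ wspan B p (fun g => (v g, r g)) {(k, m)}, δ₀ c = 0 →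
      c ∈ satRange S δ₀)
    {c : SuperPoly B p} (hc : c ∈ wspan B p r {m}) (hδc : δ c = 0) : c ∈ satRange S δ := by
  set wt : G → ℤ × ℤ := fun g => (v g, r g)
  have hd₀ {U U' : Set (ℤ × ℤ)} (hU : ∀ u ∈ U, (u.1, u.2 - 1) ∈ U') {x : SuperPoly B p}
      (hx : x ∈ wspan B p wt U) : δ₀ x ∈ wspan B p wt U' := by
    refine hδ₀.mem_wspan (U' := {(0, -1)}) (fun g => wspan_mono ?_ (hg₀ g)) ?_ hx
    · rintro _ rfl
      exact Prod.ext (sub_self _) (by simp [wt])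
    · rintro ⟨u, u'⟩ hu _ rfl
      simpa [sub_eq_add_neg] using hU _ hu
  have hd₁ {U U' : Set (ℤ × ℤ)} (hU : ∀ u ∈ U, ∀ i, u.1 + 1 ≤ i → (i, u.2 - 1) ∈ U')
      {x : SuperPoly B p} (hx : x ∈ wspan B p wt U) : (δ - δ₀) x ∈ wspan B p wt U' := by
    refine (hδ.sub hδ₀).mem_wspan (U' := {u | 1 ≤ u.1 ∧ u.2 = -1})
      (fun g => wspan_mono ?_ (hg g)) ?_ hx
    · rintro ⟨u, u'⟩ ⟨h1, h2⟩
      simp only [wt] at *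
      exact ⟨by simp only [Prod.fst_sub]; omega, by simp only [Prod.snd_sub]; omega⟩
    · rintro ⟨u, u'⟩ hu ⟨i, _⟩ ⟨h1, rfl⟩
      have := hU _ hu (u + i) (by simp only at h1 ⊢; omega)
      simpa [sub_eq_add_neg] using this
  have key (n : ℕ) : ∀ k : ℤ, V < k + n → ∀ c ∈ wspan B p wt {u | k ≤ u.1 ∧ u.2 = m}, δ c = 0 →
      c ∈ satRange S δ := by
    induction n with
    | zero =>
      intro k hk c hc _
      have : c ∈ wspan B p wt {u | V < u.1 ∧ u.2 = m} := wspan_mono (by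
        rintro u ⟨h1, h2⟩
        exact ⟨by push_cast at hk; omega, h2⟩) hc
      rw [hV] at this
      rw [(Submodule.mem_bot B).1 this]
      exact zero_mem _
    | succ n ih =>
      intro k hk c hc hδc
      set c₁ := projU B p wt {u | u.1 = k} c with hc₁
      set c₂ := projU B p wt {u | u.1 = k}ᶜ c with hc₂
      have hcc : c₁ + c₂ = c := projU_add_compl _ _
      have h1 : c₁ ∈ wspan B p wt {(k, m)} := wspan_mono (by
        rintro u ⟨h1, h2, h3⟩
        exact Prod.ext h1 h3) (projU_mem_wspan_inter hc)
      have h2 : c₂ ∈ wspan B p wt {u | k + 1 ≤ u.1 ∧ u.2 = m} := wspan_mono (by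
        rintro u ⟨h1, h2, h3⟩
        refine ⟨?_, h3⟩
        have : u.1 ≠ k := h1
        omega) (projU_mem_wspan_inter hc)
      have hz : δ₀ c₁ = 0 := by
        have e : δ₀ c₁ = -((δ - δ₀) c₁ + ((δ - δ₀) c₂ + δ₀ c₂)) := by
          rw [← sub_eq_zero, ← hδc, ← hcc]
          simp only [LinearMap.sub_apply, map_add]
          abel
        have m1 : δ₀ c₁ ∈ wspan B p wt {(k, m - 1)} := hd₀ (by rintro _ rfl; rfl) h1
        have m2 : δ₀ c₁ ∈ wspan B p wt {u | k + 1 ≤ u.1} := by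
          rw [e]
          refine neg_mem (add_mem (hd₁ ?_ h1) (add_mem (hd₁ ?_ h2) (hd₀ ?_ h2)))
          · rintro _ rfl i hi; exact hi
          · rintro u ⟨hu, -⟩ i hi
            change k + 1 ≤ i
            omega
          · rintro u ⟨hu, -⟩; exact hu
        have m3 := wspan_inter m1 m2
        have : ({(k, m - 1)} ∩ {u : ℤ × ℤ | k + 1 ≤ u.1}) = ∅ := by
          refine Set.eq_empty_of_forall_notMem ?_
          rintro _ ⟨rfl, h⟩
          have h' : k + 1 ≤ k := h
          omega
        rw [this, wspan_empty] at m3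
        exact (Submodule.mem_bot B).1 m3
      obtain ⟨s, hs, b, hb⟩ := hloc k c₁ h1 hz
      -- The preimage may be taken homogeneous.
      have hb' := hδ₀.projU_comm (w := wt) (e := (0, -1)) (fun g => wspan_mono (by
        rintro _ rfl; simp [wt, sub_eq_add_neg]) (hg₀ g)) {(k, m)} b
      rw [hb, map_smul, projU_of_mem subset_rfl h1] at hb'
      set b' := projU B p wt {d | d + (0, -1) ∈ ({(k, m)} : Set (ℤ × ℤ))} b
      have hbm : b' ∈ wspan B p wt {(k, m + 1)} := wspan_mono (by
        rintro ⟨u, u'⟩ hu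
        simp only [Set.mem_ofPred_eq, Prod.mk_add_mk, Set.mem_singleton_iff, Prod.mk.injEq] at hu ⊢
        omega) (projU_mem _ _)
      have hrest : s • c - δ b' ∈ wspan B p wt {u | k + 1 ≤ u.1 ∧ u.2 = m} := by
        have e : s • c - δ b' = s • c₂ - (δ - δ₀) b' := by
          rw [LinearMap.sub_apply, ← hb', ← hcc, smul_add]; abel
        rw [e]
        refine sub_mem (Submodule.smul_mem _ _ h2) (hd₁ ?_ hbm)
        rintro _ rfl i hi
        exact ⟨hi, by simp⟩
      have hfin := ih (k + 1) (by push_cast at hk; omega) _ hrest (by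
        rw [map_sub, map_smul, hδc, hsq, smul_zero, sub_zero])
      refine mem_satRange_of_smul hs ?_
      have := add_mem hfin (apply_mem_satRange S δ b')
      rwa [sub_add_cancel] at this
  obtain ⟨k, hk⟩ := exists_mem_wspan_Ici v c
  refine key (V + 1 - k).toNat k (by omega) c ?_ hδc
  have h1 := wspan_fst (B := B) (p := p) wt (Set.Ici k)
  have h2 := wspan_snd (B := B) (p := p) wt {m}
  change wspan B p v _ = _ at h1
  change wspan B p r _ = _ at h2
  rw [h1] at hk
  rw [h2] at hc
  exact wspan_inter hk hc

/-- A contraction `σ` with `δ₀ σ + σ δ₀ = ρ n`, where `n` counts some of the generators, reduces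
exactness up to denominators to the elements without such generators. -/
theorem mem_satRange_of_contraction [Algebra ℂ B] {S : Submonoid B} {n : G → ℤ} {ρ : B}
    (hρ : ρ ∈ S) {δ₀ σ : SuperPoly B p →ₗ[B] SuperPoly B p}
    (hδ₀ : IsRightDer 1 δ₀) (hσ : IsRightDer 1 σ)
    (hpδ : ∀ g, δ₀ (gen B p g) ∈ parityPart B p (p g + 1))
    (hpσ : ∀ g, σ (gen B p g) ∈ parityPart B p (p g + 1))
    (hn : ∀ g, δ₀ (gen B p g) ∈ wspan B p n {n g})
    (hΔ : ∀ g, δ₀ (σ (gen B p g)) + σ (δ₀ (gen B p g)) = n g • ρ • gen B p g)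
    {c : SuperPoly B p} (hc : δ₀ c = 0)
    (h₀ : ∀ c' ∈ wspan B p n {0}, δ₀ c' = 0 → c' = projU B p n {0} c → c' ∈ satRange S δ₀) :
    c ∈ satRange S δ₀ := by
  have hcomm (j : ℤ) : δ₀ (projU B p n {j} c) = 0 := by
    have := hδ₀.projU_comm (w := n) (e := 0) (fun g => by simpa using hn g) {j} c
    rw [hc, map_zero] at this
    simpa using this.symm
  obtain ⟨s, hs⟩ := exists_sum_projU n c
  rw [hs]
  refine sum_mem fun j _ => ?_
  by_cases hj : j = 0
  · subst hj
    exact h₀ _ (projU_mem _ _) (hcomm 0) rfl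
  · have he := (hδ₀.anticomm hpδ hσ hpσ).euler (w := n) (ρ := ρ) hΔ
      (projU_mem (B := B) (p := p) (w := n) {j} c)
    rw [LinearMap.add_apply, LinearMap.comp_apply, LinearMap.comp_apply, hcomm, map_zero,
      add_zero] at he
    refine mem_satRange_of_smul hρ (mem_of_zsmul_mem _ hj ?_)
    rw [← he]
    exact apply_mem_satRange S δ₀ _

end Filtration

section Koszul

variable {B : Type*} [CommRing B] {G : Type*} {p : G → ZMod 2}

variable (B p) in
/-- The span of the monomials whose words satisfy `P`. -/
def lspan (P : List G → Prop) : Submodule B (SuperPoly B p) :=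
  Submodule.span B {x | ∃ l : List G, P l ∧ x = mon B p l}

theorem mon_mem_lspan {P : List G → Prop} {l : List G} (h : P l) : mon B p l ∈ lspan B p P :=
  Submodule.subset_span ⟨l, h, rfl⟩

theorem lspan_induction {P : List G → Prop} {N : Submodule B (SuperPoly B p)}
    (h : ∀ l : List G, P l → mon B p l ∈ N) {x : SuperPoly B p} (hx : x ∈ lspan B p P) : x ∈ N := by
  refine (Submodule.span_le.2 ?_ : lspan B p P ≤ N) hx
  rintro _ ⟨l, hl, rfl⟩
  exact h l hl

theorem lspan_mono {P P' : List G → Prop} (h : ∀ l, P l → P' l) : lspan B p P ≤ lspan B p P' :=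
  fun _ hx => lspan_induction (fun l hl => mon_mem_lspan (h l hl)) hx

/-- Elements of given weight in a span of words lie in the span of those of the words that have this
weight. -/
theorem mem_lspan_and {M : Type*} [AddCommMonoid M] {w : G → M} {U : Set M} {P : List G → Prop}
    {x : SuperPoly B p} (hx : x ∈ wspan B p w U) (hx' : x ∈ lspan B p P) :
    x ∈ lspan B p fun l => P l ∧ (l.map w).sum ∈ U := by
  classical
  rw [← projU_of_mem subset_rfl hx]
  refine lspan_induction
    (N := (lspan B p fun l => P l ∧ (l.map w).sum ∈ U).comap (projU B p w U)) (fun l hl => ?_) hx'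
  rw [Submodule.mem_comap, projU_mon]
  split_ifs with h
  · exact mon_mem_lspan ⟨hl, h⟩
  · exact zero_mem _

theorem tw_mem_lspan {P : List G → Prop} (c : ZMod 2) {x : SuperPoly B p}
    (hx : x ∈ lspan B p P) : tw B p c x ∈ lspan B p P := by
  refine lspan_induction (N := (lspan B p P).comap (tw B p c).toLinearMap) (fun l hl => ?_) hx
  rw [Submodule.mem_comap, AlgHom.toLinearMap_apply, tw_mon]
  exact zsmul_mem (mon_mem_lspan (B := B) (p := p) hl) _

theorem mul_mem_lspan {P P' P'' : List G → Prop} (h : ∀ l l', P l → P' l' → P'' (l ++ l'))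
    {x y : SuperPoly B p} (hx : x ∈ lspan B p P) (hy : y ∈ lspan B p P') :
    x * y ∈ lspan B p P'' := by
  have hm := Submodule.mul_mem_mul hx hy
  rw [lspan, lspan, Submodule.span_mul_span] at hm
  refine Submodule.span_mono ?_ hm
  rintro _ ⟨_, ⟨l, hl, rfl⟩, _, ⟨l', hl', rfl⟩, rfl⟩
  exact ⟨l ++ l', h _ _ hl hl', (mon_append _ _).symm⟩

theorem gen_mem_lspan {P : List G → Prop} {g : G} (h : P [g]) : gen B p g ∈ lspan B p P := by
  rw [← mon_singleton]; exact mon_mem_lspan h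

/-- A derivation that preserves the span of the words in `s` on the letters in `s`, preserves it. -/
theorem IsRightDer.mem_lspan {c : ZMod 2} {D : SuperPoly B p →ₗ[B] SuperPoly B p}
    (h : IsRightDer c D) {s : Set G}
    (hs : ∀ g ∈ s, D (gen B p g) ∈ lspan B p fun l => ∀ g ∈ l, g ∈ s) {x : SuperPoly B p}
    (hx : x ∈ lspan B p fun l => ∀ g ∈ l, g ∈ s) : D x ∈ lspan B p fun l => ∀ g ∈ l, g ∈ s := by
  have happ (l l' : List G) (h : ∀ g ∈ l, g ∈ s) (h' : ∀ g ∈ l', g ∈ s) : ∀ g ∈ l ++ l', g ∈ s := by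
    intro g hg
    rcases List.mem_append.1 hg with hg | hg
    · exact h g hg
    · exact h' g hg
  refine lspan_induction (N := (lspan B p fun l => ∀ g ∈ l, g ∈ s).comap D) (fun l hl => ?_) hx
  rw [Submodule.mem_comap]
  clear hx
  induction l with
  | nil => rw [mon_nil, h.map_one]; exact zero_mem _
  | cons g l ih =>
    have hl' : ∀ g ∈ l, g ∈ s := fun k hk => hl k (List.mem_cons_of_mem _ hk)
    have hg : g ∈ s := hl g List.mem_cons_self
    rw [mon_cons, h]
    refine add_mem (mul_mem_lspan happ (gen_mem_lspan ?_) (ih hl'))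
      (mul_mem_lspan happ (hs g hg) (tw_mem_lspan c (mon_mem_lspan hl')))
    intro k hk
    rwa [List.mem_singleton.1 hk]

/-- A derivation that vanishes on the letters in `s` vanishes on the words in `s`. -/
theorem IsRightDer.eq_zero_of_mem_lspan {c : ZMod 2} {D : SuperPoly B p →ₗ[B] SuperPoly B p}
    (h : IsRightDer c D) {s : Set G} (hs : ∀ g ∈ s, D (gen B p g) = 0) {x : SuperPoly B p}
    (hx : x ∈ lspan B p fun l => ∀ g ∈ l, g ∈ s) : D x = 0 := by
  refine LinearMap.mem_ker.1 (lspan_induction (N := LinearMap.ker D) (fun l hl => ?_) hx)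
  rw [LinearMap.mem_ker]
  clear hx
  induction l with
  | nil => rw [mon_nil, h.map_one]
  | cons g l ih =>
    rw [mon_cons, h, hs g (hl g List.mem_cons_self),
      ih fun k hk => hl k (List.mem_cons_of_mem _ hk)]
    simp

variable [Algebra ℂ B] {S : Submonoid B} {κ : Type*} {y : κ → B} {ξ : κ → G}
  {D : SuperPoly B p →ₗ[B] SuperPoly B p}

/-- The words of length `m` in the letters `ξ k`, `k ∈ K`. -/
def IsKoszulWord (ξ : κ → G) (K : Finset κ) (m : ℕ) (l : List G) : Prop :=
  (∀ g ∈ l, g ∈ ξ '' K) ∧ l.length = m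

/-- A Koszul chain splits into a part without `ξ k` and a multiple of `ξ k`. -/
theorem koszul_split [DecidableEq κ] (hξ : ∀ k, p (ξ k) = 1) {k : κ} {K : Finset κ} {m : ℕ}
    {c : SuperPoly B p} (hc : c ∈ lspan B p (IsKoszulWord ξ (insert k K) (m + 1))) :
    ∃ a ∈ lspan B p (IsKoszulWord ξ K (m + 1)), ∃ b ∈ lspan B p (IsKoszulWord ξ K m),
      c = a + b * gen B p (ξ k) := by
  have hcons {j : κ} (hj : j ∈ K) {m : ℕ} {x : SuperPoly B p}
      (hx : x ∈ lspan B p (IsKoszulWord ξ K m)) :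
      gen B p (ξ j) * x ∈ lspan B p (IsKoszulWord ξ K (m + 1)) := by
    refine mul_mem_lspan (P := fun l => l = [ξ j]) ?_ (gen_mem_lspan rfl) hx
    rintro _ l rfl ⟨h1, h2⟩
    refine ⟨?_, by simp [h2]⟩
    intro g hg
    rcases List.mem_cons.1 hg with rfl | hg
    · exact ⟨j, hj, rfl⟩
    · exact h1 g hg
  -- The splitting holds for words, including the empty one.
  have key (l : List G) : (∀ g ∈ l, g ∈ ξ '' (insert k K : Finset κ)) →
      ∃ a ∈ lspan B p (IsKoszulWord ξ K l.length), ∃ b,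
        (∀ n, l.length = n + 1 → b ∈ lspan B p (IsKoszulWord ξ K n)) ∧ (l = [] → b = 0) ∧
        mon B p l = a + b * gen B p (ξ k) := by
    induction l with
    | nil =>
      intro _
      exact ⟨1, mon_mem_lspan (l := []) ⟨by simp, rfl⟩, 0, by simp, by simp, by simp⟩
    | cons g l ih =>
      intro hl
      obtain ⟨a, ha, b, hb, hb0, hab⟩ := ih fun k hk => hl k (List.mem_cons_of_mem _ hk)
      obtain ⟨j, hj, rfl⟩ := hl g List.mem_cons_self
      rcases Finset.mem_insert.1 hj with rfl | hj
      · refine ⟨0, zero_mem _, tw B p 1 a, ?_, by simp, ?_⟩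
        · intro n hn
          obtain rfl : l.length = n := by simpa using hn
          exact tw_mem_lspan 1 ha
        · rw [mon_cons, hab, mul_add, gen_mul_swap a, ← mul_assoc, gen_mul_swap b, hξ, mul_assoc,
            gen_mul_self (hξ j), mul_zero, add_zero, zero_add]
      · refine ⟨gen B p (ξ j) * a, hcons hj ha, gen B p (ξ j) * b, ?_, by simp, ?_⟩
        · intro n hn
          obtain rfl : l.length = n := by simpa using hn
          cases hl' : l.length with
          | zero =>
            rw [hb0 (List.length_eq_zero_iff.1 hl'), mul_zero]; exact zero_mem _
          | succ n => exact hcons hj (hb n hl')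
        · rw [mon_cons, hab, mul_add, mul_assoc]
  have hsup : c ∈ lspan B p (IsKoszulWord ξ K (m + 1)) ⊔
      (lspan B p (IsKoszulWord ξ K m)).map (LinearMap.mulRight B (gen B p (ξ k))) := by
    refine lspan_induction (fun l hl => ?_) hc
    obtain ⟨a, ha, b, hb, -, hab⟩ := key l hl.1
    rw [hab]
    rw [hl.2] at ha
    exact add_mem (Submodule.mem_sup_left ha)
      (Submodule.mem_sup_right ⟨b, hb m hl.2, rfl⟩)
  obtain ⟨a, ha, _, ⟨b, hb, rfl⟩, rfl⟩ := Submodule.mem_sup.1 hsup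
  exact ⟨a, ha, b, hb, rfl⟩

/-- The Koszul complex of a sequence that is regular up to denominators, in any order, is exact up
to denominators in positive degrees. -/
theorem koszul_exact (hξinj : Function.Injective ξ) (hξ : ∀ k, p (ξ k) = 1) (hD : IsRightDer 1 D)
    (hDξ : ∀ k, D (gen B p (ξ k)) = algebraMap B _ (y k))
    (hreg : ∀ (K : Finset κ) (k : κ), k ∉ K → ∀ f : B, y k * f ∈ Ideal.span (y '' K) →
      ∃ s ∈ S, s * f ∈ Ideal.span (y '' K)) (K : Finset κ) :
    ∀ m : ℕ, ∀ c ∈ lspan B p (IsKoszulWord ξ K (m + 1)), D c = 0 →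
      ∃ s ∈ S, ∃ b ∈ lspan B p (IsKoszulWord ξ K (m + 1 + 1)), D b = s • c := by
  classical
  induction K using Finset.induction_on with
  | empty =>
    intro m c hc _
    refine ⟨1, S.one_mem, 0, zero_mem _, ?_⟩
    have : c ∈ (⊥ : Submodule B (SuperPoly B p)) := lspan_induction (fun l hl => by
      obtain ⟨h1, h2⟩ := hl
      cases l with
      | nil => simp at h2
      | cons g l => simpa using h1 g List.mem_cons_self) hc
    rw [(Submodule.mem_bot B).1 this]
    simp
  | insert k K hk ih =>
    intro m c hc hDc
    have hmono (m : ℕ) : lspan B p (IsKoszulWord ξ K m) ≤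
        lspan B p (IsKoszulWord ξ (insert k K) m) :=
      lspan_mono fun l hl => ⟨fun g hg => Set.image_mono (by simp) (hl.1 g hg), hl.2⟩
    have hmul {m : ℕ} {x : SuperPoly B p} (hx : x ∈ lspan B p (IsKoszulWord ξ K m)) :
        x * gen B p (ξ k) ∈ lspan B p (IsKoszulWord ξ (insert k K) (m + 1)) := by
      refine mul_mem_lspan (P' := fun l => l = [ξ k]) ?_ (hmono m hx) (gen_mem_lspan rfl)
      rintro l _ ⟨h1, h2⟩ rfl
      refine ⟨?_, by simp [h2]⟩
      intro g hg
      rcases List.mem_append.1 hg with hg | hg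
      · exact h1 g hg
      · exact ⟨k, by simp, (List.mem_singleton.1 hg).symm⟩
    have hDK {m : ℕ} {x : SuperPoly B p} (hx : x ∈ lspan B p (IsKoszulWord ξ K m)) :
        D x ∈ lspan B p fun l => ∀ g ∈ l, g ∈ ξ '' (K : Set κ) := by
      refine hD.mem_lspan ?_ (lspan_mono (fun l hl => hl.1) hx)
      rintro _ ⟨j, -, rfl⟩
      rw [hDξ, Algebra.algebraMap_eq_smul_one]
      exact Submodule.smul_mem _ _ (mon_mem_lspan (l := []) (by simp))
    have hpd {x : SuperPoly B p} (hx : x ∈ lspan B p fun l => ∀ g ∈ l, g ∈ ξ '' (K : Set κ)) :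
        pd B p (ξ k) x = 0 := by
      refine (isRightDer_pd (ξ k)).eq_zero_of_mem_lspan ?_ hx
      rintro _ ⟨j, hj, rfl⟩
      rw [pd_gen, if_neg]
      intro e
      exact hk (hξinj e ▸ hj)
    have hDmul (x : SuperPoly B p) :
        D (x * gen B p (ξ k)) = y k • x - D x * gen B p (ξ k) := by
      rw [hD, hDξ, ← Algebra.commutes, ← Algebra.smul_def, tw_of_mem 1 (gen_mem _), hξ,
        show sgn (1 * 1) = -1 from rfl, neg_smul, one_smul, mul_neg, sub_eq_add_neg]
    obtain ⟨a, ha, b, hb, rfl⟩ := koszul_split hξ hc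
    rw [map_add, hDmul] at hDc
    have hDb : D b = 0 := by
      have h1 := congrArg (pd B p (ξ k)) hDc
      rw [map_add, map_sub, map_smul, hpd (hDK ha), hpd (lspan_mono (fun l hl => hl.1) hb),
        isRightDer_pd (ξ k), hpd (hDK hb), pd_gen, if_pos rfl, zero_mul, add_zero, mul_one,
        smul_zero, zero_sub, zero_add, map_zero, neg_eq_zero] at h1
      exact h1
    rw [hDb, zero_mul, sub_zero] at hDc
    obtain ⟨s, hs, b', hb', hb's⟩ : ∃ s ∈ S, ∃ b' ∈ lspan B p (IsKoszulWord ξ K (m + 1)),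
        D b' = s • b := by
      cases m with
      | succ m => exact ih m b hb hDb
      | zero =>
        -- Here `b` is a scalar, and regularity applies.
        obtain ⟨β, hβ⟩ : ∃ β : B, b = β • 1 := by
          have : b ∈ Submodule.span B {(1 : SuperPoly B p)} := lspan_induction (fun l hl => by
            rw [List.length_eq_zero_iff.1 hl.2]
            exact Submodule.mem_span_singleton_self _) hb
          obtain ⟨β, hβ⟩ := Submodule.mem_span_singleton.1 this
          exact ⟨β, hβ.symm⟩
        have hDa : D a ∈ Submodule.map (Algebra.linearMap B (SuperPoly B p))
            (Ideal.span (y '' K)) := by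
          refine lspan_induction
            (N := (Submodule.map (Algebra.linearMap B (SuperPoly B p))
              (Ideal.span (y '' K))).comap D) (fun l hl => ?_) ha
          obtain ⟨g, rfl⟩ := List.length_eq_one_iff.1 hl.2
          obtain ⟨j, hj, rfl⟩ := hl.1 g List.mem_cons_self
          rw [Submodule.mem_comap, mon_singleton, hDξ]
          exact ⟨y j, Ideal.subset_span ⟨j, hj, rfl⟩, rfl⟩
        obtain ⟨z, hz, hza⟩ := hDa
        have hyβ : y k * β ∈ Ideal.span (y '' K) := by
          have h1 := congrArg (aug B p) hDc
          rw [← hza, hβ] at h1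
          simp only [map_add, map_smul, map_one, map_zero, smul_eq_mul, mul_one,
            Algebra.linearMap_apply, AlgHom.commutes, Algebra.algebraMap_self,
            RingHom.id_apply] at h1
          rw [eq_neg_of_add_eq_zero_right h1]
          exact neg_mem hz
        obtain ⟨s, hs, hsβ⟩ := hreg K k hk β hyβ
        have hsurj : Submodule.map (Algebra.linearMap B (SuperPoly B p)) (Ideal.span (y '' K)) ≤
            Submodule.map D (lspan B p (IsKoszulWord ξ K (0 + 1))) := by
          rw [Ideal.span, Submodule.map_span_le]
          rintro _ ⟨j, hj, rfl⟩
          refine ⟨gen B p (ξ j), gen_mem_lspan ⟨?_, rfl⟩, hDξ j⟩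
          intro g hg
          exact ⟨j, hj, (List.mem_singleton.1 hg).symm⟩
        obtain ⟨b', hb', e⟩ := hsurj ⟨s * β, hsβ, rfl⟩
        refine ⟨s, hs, b', hb', ?_⟩
        rw [e, hβ, smul_smul, Algebra.linearMap_apply, Algebra.algebraMap_eq_smul_one]
    have ha' : s • a + y k • b' ∈ lspan B p (IsKoszulWord ξ K (m + 1)) :=
      add_mem (Submodule.smul_mem _ _ ha) (Submodule.smul_mem _ _ hb')
    obtain ⟨s', hs', a'', ha'', e⟩ := ih m _ ha' (by
      rw [map_add, map_smul, map_smul, hb's, smul_comm (y k), ← smul_add, hDc, smul_zero])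
    refine ⟨s' * s, S.mul_mem hs' hs, a'' - s' • (b' * gen B p (ξ k)),
      sub_mem (hmono _ ha'') (Submodule.smul_mem _ _ (hmul hb')), ?_⟩
    rw [map_sub, map_smul, hDmul, hb's, e]
    simp only [smul_add, smul_sub, mul_smul, smul_mul_assoc]
    abel

/-- As in `koszul_exact`, with additional generators (in the set `I`) that the differential
annihilates and does not produce. -/
theorem koszul_exact_inert [Finite G] (hξinj : Function.Injective ξ) (hξ : ∀ k, p (ξ k) = 1)
    [Finite κ] (hD : IsRightDer 1 D) (hDp : ∀ g, D (gen B p g) ∈ parityPart B p (p g + 1))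
    (hDξ : ∀ k, D (gen B p (ξ k)) = algebraMap B _ (y k))
    (hreg : ∀ (K : Finset κ) (k : κ), k ∉ K → ∀ f : B, y k * f ∈ Ideal.span (y '' K) →
      ∃ s ∈ S, s * f ∈ Ideal.span (y '' K))
    {I : Set G} (hI : ∀ g ∈ I, D (gen B p g) = 0)
    (hDI : ∀ h, h ∉ I → D (gen B p h) ∈ lspan B p fun l => ∀ g ∈ l, g ∈ Iᶜ)
    {r : G → ℤ} (hrI : ∀ g ∈ I, r g = 0) (hrξ : ∀ k, r (ξ k) = 1) {m : ℤ} (hm : 0 < m)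
    {c : SuperPoly B p} (hc : c ∈ lspan B p fun l => ∀ g ∈ l, g ∈ I ∪ Set.range ξ)
    (hcm : c ∈ wspan B p r {m}) (hDc : D c = 0) : c ∈ satRange S D := by
  classical
  have := Fintype.ofFinite G
  have := Fintype.ofFinite κ
  let s : Finset G := Finset.univ.filter (· ∈ I)
  let w : G → ℤ := fun g => if g ∈ s then 1 else 0
  have hpd (g : G) (hg : g ∈ I) (h : G) : pd B p g (D (gen B p h)) = 0 := by
    by_cases hh : h ∈ I
    · rw [hI h hh, map_zero]
    · refine (isRightDer_pd g).eq_zero_of_mem_lspan (fun k hk => ?_) (hDI h hh)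
      rw [pd_gen, if_neg]
      rintro rfl
      exact hk hg
  have hDw (h : G) : D (gen B p h) ∈ wspan B p w {w h} := by
    by_cases hh : h ∈ I
    · rw [hI h hh]; exact zero_mem _
    · have h0 : ∀ l : List G, (∀ g ∈ l, g ∈ Iᶜ) → (l.map w).sum = 0 := by
        intro l hl
        refine List.sum_eq_zero ?_
        intro x hx
        obtain ⟨g, hg, rfl⟩ := List.mem_map.1 hx
        exact if_neg (by simpa [s] using hl g hg)
      refine lspan_induction (fun l hl => mon_mem_wspan ?_) (hDI h hh)
      rw [h0 l hl]
      exact (if_neg (by simpa [s] using hh)).symm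
  have key (d : ℕ) : ∀ c ∈ lspan B p fun l => ∀ g ∈ l, g ∈ I ∪ Set.range ξ,
      c ∈ wspan B p r {m} → c ∈ wspan B p w {(d : ℤ)} → D c = 0 → c ∈ satRange S D := by
    induction d with
    | zero =>
      intro c hc hcm hcw hDc
      have h1 := mem_lspan_and hcm (mem_lspan_and hcw hc)
      obtain ⟨n, rfl⟩ : ∃ n : ℕ, m = ((n + 1 : ℕ) : ℤ) := ⟨(m - 1).toNat, by omega⟩
      have h2 : c ∈ lspan B p (IsKoszulWord ξ Finset.univ (n + 1)) := by
        refine lspan_mono ?_ h1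
        rintro l ⟨⟨h1, h2⟩, h3⟩
        have hle : ∀ x ∈ l.map w, 0 ≤ x := by
          intro x hx
          obtain ⟨g, -, rfl⟩ := List.mem_map.1 hx
          simp only [w]
          split_ifs <;> simp
        have h4 (g : G) (hg : g ∈ l) : g ∈ ξ '' (Finset.univ : Finset κ) := by
          rcases h1 g hg with hgI | ⟨k, rfl⟩
          · exfalso
            have h5 := List.single_le_sum hle (w g) (List.mem_map_of_mem hg)
            have h6 : w g = 1 := if_pos (by simp [s, hgI])
            rw [show (l.map w).sum = 0 from h2, h6] at h5
            omega
          · exact ⟨k, by simp, rfl⟩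
        refine ⟨h4, ?_⟩
        have h5 : (l.map r).sum = l.length := by
          clear h1 h2 h3 hle
          induction l with
          | nil => simp
          | cons g l ih =>
            obtain ⟨k, -, rfl⟩ := h4 g List.mem_cons_self
            rw [List.map_cons, List.sum_cons, hrξ,
              ih fun g hg => h4 g (List.mem_cons_of_mem _ hg)]
            simp [add_comm]
        have h6 : (l.map r).sum = ((n + 1 : ℕ) : ℤ) := h3
        omega
      obtain ⟨t, ht, b, -, hb⟩ := koszul_exact hξinj hξ hD hDξ hreg Finset.univ n c h2 hDc
      exact ⟨t, ht, b, hb⟩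
    | succ d ih =>
      intro c hc hcm hcw hDc
      have he := eulerOp_of_mem (B := B) (p := p) s (n := ((d + 1 : ℕ) : ℤ)) hcw
      rw [eulerOp_apply] at he
      refine mem_of_zsmul_mem (satRange S D) (n := ((d + 1 : ℕ) : ℤ)) (by positivity) ?_
      rw [← he]
      refine sum_mem fun g hg => ?_
      have hgI : g ∈ I := by simpa [s] using hg
      have hcomm : D (pd B p g c) = 0 := by
        have h1 := (hD.supercomm hDp (isRightDer_pd g) (pd_gen_mem_parity g)).eq_zero (fun h => by
          rw [LinearMap.sub_apply, LinearMap.smul_apply, LinearMap.comp_apply,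
            LinearMap.comp_apply, hpd g hgI h, smul_zero, sub_zero, pd_gen]
          split_ifs
          · exact hD.map_one
          · exact map_zero _)
        have h2 := LinearMap.congr_fun h1 c
        rwa [LinearMap.sub_apply, LinearMap.smul_apply, LinearMap.comp_apply,
          LinearMap.comp_apply, hDc, map_zero, smul_zero, sub_zero] at h2
      obtain ⟨t, ht, b, hb⟩ := ih (pd B p g c)
        ((isRightDer_pd g).mem_lspan (fun h _ => by
          rw [pd_gen]
          split_ifs
          · exact mon_mem_lspan (l := []) (by simp)
          · exact zero_mem _) hc)
        (pd_mem_wspan r g (by rintro _ rfl; simp [hrI g hgI]) hcm)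
        (pd_mem_wspan w g (by
          rintro _ rfl
          have : w g = 1 := if_pos hg
          simp [this]) hcw) hcomm
      refine ⟨t, ht, sgn (p g) • (b * gen B p g), ?_⟩
      rw [map_zsmul, hD, hI g hgI, mul_zero, zero_add, hb, tw_of_mem 1 (gen_mem g), one_mul,
        mul_smul_comm, smul_smul, sgn_mul_self, one_smul, smul_mul_assoc]
  obtain ⟨t, ht⟩ := exists_sum_projU w c
  rw [ht]
  refine sum_mem fun d _ => ?_
  have hw : projU B p w {d} c ∈ wspan B p w {d} := projU_mem _ _
  have hlift := mem_lspan_and hcm hc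
  have hproj : projU B p w {d} c ∈ lspan B p fun l => (∀ g ∈ l, g ∈ I ∪ Set.range ξ) ∧
      (l.map r).sum ∈ ({m} : Set ℤ) := by
    refine lspan_induction (N := (lspan B p fun l => (∀ g ∈ l, g ∈ I ∪ Set.range ξ) ∧
      (l.map r).sum ∈ ({m} : Set ℤ)).comap (projU B p w {d})) (fun l hl => ?_) hlift
    rw [Submodule.mem_comap, projU_mon]
    split_ifs
    · exact mon_mem_lspan hl
    · exact zero_mem _
  by_cases hd : 0 ≤ d
  · lift d to ℕ using hd
    refine key d _ (lspan_mono (fun l hl => hl.1) hproj)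
      (lspan_induction (fun l hl => mon_mem_wspan hl.2) hproj) hw ?_
    have := hD.projU_comm (w := w) (e := 0) (fun g => by simpa using hDw g) {(d : ℤ)} c
    rw [hDc, map_zero] at this
    simpa using this.symm
  · have h0 : projU B p w {d} c = 0 := by
      refine projU_of_disjoint (U := {d | 0 ≤ d}) (by simpa using hd) ?_
      refine wspan_induction (N := wspan B p w {d | 0 ≤ d}) (fun l _ => mon_mem_wspan ?_)
        (mem_wspan_univ B p w c)
      change 0 ≤ (l.map w).sum
      refine List.sum_nonneg ?_
      intro x hx
      obtain ⟨g, -, rfl⟩ := List.mem_map.1 hx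
      simp only [w]
      split_ifs <;> simp
    rw [h0]
    exact zero_mem _

end Koszul

/-! ### Smooth functions with independent differentials form a regular sequence -/

section Regular

open MeasureTheory Filter Topology

variable {E : Type*} [NormedAddCommGroup E] [NormedSpace ℝ E]
  {F : Type*} [NormedAddCommGroup F] [NormedSpace ℝ F]

/-- Integrals over a compact interval depend smoothly on parameters. The integral is viewed as a
convolution, at the point `0`, of the indicator function of `[-1, 0]` with a cut-off integrand. -/
theorem contDiff_integral {h : ℝ × E → F} (hh : ContDiff ℝ ∞ h) :
    ContDiff ℝ ∞ fun x => ∫ t in (0 : ℝ)..1, h (t, x) := by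
  let χ : ContDiffBump (0 : ℝ) := ⟨1, 2, by norm_num, by norm_num⟩
  let f : ℝ → ℝ := Set.indicator (Set.Icc (-1) 0) fun _ => 1
  let g : E → ℝ → F := fun x t => χ t • h (t, x)
  have hg : ContDiffOn ℝ ((⊤ : ℕ∞) : WithTop ℕ∞) ↿g (Set.univ ×ˢ Set.univ) := by
    refine ContDiff.contDiffOn ?_
    change ContDiff ℝ ∞ fun q : E × ℝ => χ q.2 • h (q.2, q.1)
    exact (χ.contDiff.comp contDiff_snd).smul (hh.comp (contDiff_snd.prodMk contDiff_fst))
  have hf : LocallyIntegrable f volume := by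
    refine Integrable.locallyIntegrable ?_
    exact (integrable_indicator_iff measurableSet_Icc).2 (by simp)
  have key := contDiffOn_convolution_right_with_param (μ := volume) (ContinuousLinearMap.lsmul ℝ ℝ)
    isOpen_univ (isCompact_closedBall (0 : ℝ) 2) (g := g) (f := f) (fun x t _ ht => by
      have : χ t = 0 := χ.zero_of_le_dist (by
        rw [Metric.mem_closedBall, not_le] at ht; exact ht.le)
      simp [g, this]) hf hg
  rw [Set.univ_prod_univ, contDiffOn_univ] at key
  convert! key.comp (contDiff_id.prodMk (contDiff_const (c := (0 : ℝ)))) using 1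
  funext x
  symm
  simp only [id, Function.comp_def, convolution_def, ContinuousLinearMap.lsmul_apply, zero_sub, g,
    f]
  rw [← integral_neg_eq_self]
  simp only [neg_neg]
  rw [intervalIntegral.integral_of_le zero_le_one, ← integral_Icc_eq_integral_Ioc,
    ← integral_indicator measurableSet_Icc]
  refine integral_congr_ae (Eventually.of_forall fun t => ?_)
  simp only [Set.indicator_apply, Set.mem_Icc]
  by_cases ht : 0 ≤ t ∧ t ≤ 1
  · have h1 : χ t = 1 := χ.one_of_mem_closedBall (by
      rw [Metric.mem_closedBall, dist_zero_right, Real.norm_eq_abs, abs_of_nonneg ht.1]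
      exact ht.2)
    rw [if_pos ht, if_pos ⟨by linarith [ht.2], by linarith [ht.1]⟩, h1, one_smul, one_smul]
  · rw [if_neg ht, if_neg (fun h => ht ⟨by linarith [h.2], by linarith [h.1]⟩), zero_smul]

variable {κ : Type*} [DecidableEq κ] [CompleteSpace F]

/-- Hadamard's lemma: a smooth function that vanishes where some independent linear functions
vanish is a combination of them. -/
theorem exists_eq_sum_of_linear {A : κ → E →L[ℝ] ℝ} {v : κ → E}
    (hA : ∀ j k, A j (v k) = if j = k then 1 else 0) (K : Finset κ) {f : E → F}
    (hf : ContDiff ℝ ∞ f) (h0 : ∀ x, (∀ i ∈ K, A i x = 0) → f x = 0) :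
    ∃ g : κ → E → F, (∀ i, ContDiff ℝ ∞ (g i)) ∧ ∀ x, f x = ∑ i ∈ K, A i x • g i x := by
  let P : E → E := fun x => ∑ i ∈ K, A i x • v i
  have hP : ContDiff ℝ ∞ P := by
    exact ContDiff.sum fun i _ => (A i).contDiff.smul contDiff_const
  -- The segments from the projection to the common kernel of the `A i`, `i ∈ K`, to the point.
  let γ : ℝ × E → E := fun q => q.2 - P q.2 + q.1 • P q.2
  have hP2 : ContDiff ℝ ∞ fun q : ℝ × E => P q.2 := hP.comp contDiff_snd
  have hγ : ContDiff ℝ ∞ γ := (contDiff_snd.sub hP2).add (contDiff_fst.smul hP2)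
  have hf' : ContDiff ℝ ∞ (fderiv ℝ f) := hf.fderiv_right (by simp)
  have hint (w : E) : ContDiff ℝ ∞ fun q => fderiv ℝ f (γ q) w :=
    (hf'.comp hγ).clm_apply contDiff_const
  refine ⟨fun i x => ∫ t in (0 : ℝ)..1, fderiv ℝ f (γ (t, x)) (v i),
    fun i => contDiff_integral (hint (v i)), fun x => ?_⟩
  have hcont (w : E) : Continuous fun t : ℝ => fderiv ℝ f (γ (t, x)) w :=
    (hint w).continuous.comp (by fun_prop)
  have hder (t : ℝ) : HasDerivAt (fun t => f (γ (t, x))) (fderiv ℝ f (γ (t, x)) (P x)) t := by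
    have h1 : HasDerivAt (fun t => γ (t, x)) (P x) t := by
      have := ((hasDerivAt_id t).smul_const (P x)).const_add (x - P x)
      rw [one_smul] at this
      exact this
    exact ((hf.differentiable (by simp)) (γ (t, x))).hasFDerivAt.comp_hasDerivAt t h1
  have hftc := intervalIntegral.integral_eq_sub_of_hasDerivAt (a := 0) (b := 1)
    (fun t _ => hder t) ((hcont (P x)).intervalIntegrable _ _)
  have e1 : γ (1, x) = x := by simp [γ]
  have e0 : f (γ (0, x)) = 0 := by
    refine h0 _ fun j hj => ?_
    simp [γ, P, hA, hj]
  rw [e1, e0, sub_zero] at hftc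
  rw [← hftc]
  simp only [P, map_sum, map_smul]
  refine (intervalIntegral.integral_finsetSum fun i _ =>
    ((hcont (v i)).const_smul (A i x)).intervalIntegrable _ _).trans ?_
  exact Finset.sum_congr rfl fun i _ => intervalIntegral.integral_smul _ _

/-- Smooth functions `u k` with independent differentials at a point `p` form near `p` a regular
sequence, in any order. In the coordinates given by the inverse function theorem
they are linear, and Hadamard's lemma applies, after multiplication by a bump function. -/
theorem exists_mul_eq_sum [FiniteDimensional ℝ E] {u : κ → E → ℝ} (hu : ∀ k, ContDiff ℝ ∞ (u k))
    [Fintype κ] {p : E} {v : κ → E}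
    (hv : ∀ j k, fderiv ℝ (u j) p (v k) = if j = k then 1 else 0) {K : Finset κ} {k : κ}
    (hk : k ∉ K) {f : E → F} (hf : ContDiff ℝ ∞ f) {g : κ → E → F}
    (hfg : ∀ z, u k z • f z = ∑ i ∈ K, u i z • g i z) :
    ∃ ρ : E → ℝ, ContDiff ℝ ∞ ρ ∧ ρ p ≠ 0 ∧ ∃ h : κ → E → F, (∀ i, ContDiff ℝ ∞ (h i)) ∧
      ∀ z, ρ z • f z = ∑ i ∈ K, u i z • h i z := by
  have : CompleteSpace E := FiniteDimensional.complete ℝ E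
  set A : κ → E →L[ℝ] ℝ := fun j => fderiv ℝ (u j) p
  -- In the new coordinates `Ψ`, the functions `u k` become the linear functions `A k`.
  let Ψ : E → E := fun z => z + ∑ j, (u j z - A j z) • v j
  have hΨ : ContDiff ℝ ∞ Ψ :=
    contDiff_id.add (ContDiff.sum fun j _ => ((hu j).sub (A j).contDiff).smul contDiff_const)
  have hAΨ (j : κ) (z : E) : A j (Ψ z) = u j z := by
    have (i : κ) : A j (v i) = if j = i then 1 else 0 := hv j i
    simp [Ψ, this]
  have hd : HasFDerivAt Ψ ((ContinuousLinearEquiv.refl ℝ E : E ≃L[ℝ] E) : E →L[ℝ] E) p := by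
    have h1 (j : κ) : HasFDerivAt (fun z => (u j z - A j z) • v j) (0 : E →L[ℝ] E) p := by
      have := (((hu j).differentiable (by simp) p).hasFDerivAt.sub
        (A j).hasFDerivAt).smul_const (v j)
      convert! this using 1
      ext w
      simp [A]
    have h2 := (hasFDerivAt_id (𝕜 := ℝ) p).add (HasFDerivAt.fun_sum (u := Finset.univ)
      fun j _ => h1 j)
    convert! h2 using 1
    ext w
    simp
  let e := hΨ.contDiffAt.toOpenPartialHomeomorph Ψ hd (by simp)
  have hesrc : p ∈ e.source :=
    hΨ.contDiffAt.mem_toOpenPartialHomeomorph_source hd (by simp)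
  have heΨ (z : E) : e z = Ψ z := rfl
  -- The derivative of `Ψ` is invertible near `p`.
  let U : Set E := {z | IsUnit (fderiv ℝ Ψ z)}
  have hU : IsOpen U := Units.isOpen.preimage (hΨ.continuous_fderiv (by simp))
  have hpU : p ∈ U := by
    change IsUnit (fderiv ℝ Ψ p)
    rw [hd.fderiv]
    exact isUnit_one
  have hV : IsOpen (e.target ∩ e.symm ⁻¹' U) := e.symm.isOpen_inter_preimage hU
  have hqV : Ψ p ∈ e.target ∩ e.symm ⁻¹' U := by
    refine ⟨e.map_source hesrc, ?_⟩
    rw [Set.mem_preimage, ← heΨ, e.left_inv hesrc]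
    exact hpU
  have hsymm {w : E} (hw : w ∈ e.target ∩ e.symm ⁻¹' U) : ContDiffAt ℝ ∞ e.symm w := by
    obtain ⟨t, ht⟩ := hw.2
    refine e.contDiffAt_symm (f₀' := ContinuousLinearEquiv.unitsEquiv ℝ E t) hw.1 ?_
      hΨ.contDiffAt
    have h1 := (hΨ.differentiable (by simp) (e.symm w)).hasFDerivAt
    rw [← ht] at h1
    exact h1
  obtain ⟨R, hR, hRV⟩ := Metric.isOpen_iff.1 hV _ hqV
  let χ : ContDiffBump (Ψ p) := ⟨R / 4, R / 2, by positivity, by linarith⟩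
  have hχV : tsupport χ ⊆ e.target ∩ e.symm ⁻¹' U := by
    rw [χ.tsupport_eq]
    refine subset_trans ?_ hRV
    refine Metric.closedBall_subset_ball ?_
    change R / 2 < R
    linarith
  -- The function `f` in the new coordinates, cut off.
  let f' : E → F := fun w => χ w • f (e.symm w)
  have hf' : ContDiff ℝ ∞ f' := by
    rw [contDiff_iff_contDiffAt]
    intro w
    by_cases hw : w ∈ tsupport χ
    · exact χ.contDiffAt.smul (hf.contDiffAt.comp w (hsymm (hχV hw)))
    · refine contDiffAt_const (c := (0 : F)) |>.congr_of_eventuallyEq ?_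
      filter_upwards [(isClosed_tsupport χ).isOpen_compl.mem_nhds hw] with w' hw'
      simp only [f', image_eq_zero_of_notMem_tsupport hw', zero_smul]
  have hmul (w : E) (hw : ∀ i ∈ K, A i w = 0) : A k w • f' w = 0 := by
    by_cases hwt : w ∈ tsupport χ
    · have h1 : Ψ (e.symm w) = w := e.right_inv (hχV hwt).1
      have h2 := hfg (e.symm w)
      rw [← hAΨ, h1, Finset.sum_eq_zero (fun i hi => by rw [← hAΨ, h1, hw i hi, zero_smul])] at h2
      simp only [f']
      rw [smul_comm, h2, smul_zero]
    · simp only [f', image_eq_zero_of_notMem_tsupport hwt, zero_smul, smul_zero]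
  have hf0 (w : E) (hw : ∀ i ∈ K, A i w = 0) : f' w = 0 := by
    by_cases hkw : A k w = 0
    · -- Approach `w` along `v k`, where `A k` does not vanish.
      have hcont : Continuous fun t : ℝ => f' (w + t • v k) :=
        hf'.continuous.comp (by fun_prop)
      have hlim : Tendsto (fun t : ℝ => f' (w + t • v k)) (𝓝[≠] 0) (𝓝 (f' w)) := by
        have := hcont.tendsto 0
        rw [zero_smul, add_zero] at this
        exact this.mono_left nhdsWithin_le_nhds
      refine tendsto_nhds_unique hlim (tendsto_const_nhds.congr' ?_)
      filter_upwards [self_mem_nhdsWithin] with t ht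
      have hAv (i : κ) : A i (v k) = if i = k then 1 else 0 := hv i k
      have h1 := hmul (w + t • v k) (fun i hi => by
        rw [map_add, map_smul, hAv, if_neg (fun h : i = k => hk (h ▸ hi)), hw i hi]; simp)
      rw [map_add, map_smul, hAv, if_pos rfl, hkw, zero_add, smul_eq_mul, mul_one] at h1
      exact ((smul_eq_zero.1 h1).resolve_left ht).symm
    · exact (smul_eq_zero.1 (hmul w hw)).resolve_left hkw
  obtain ⟨g', hg', hfg'⟩ := exists_eq_sum_of_linear (A := A) (v := v) hv K hf' hf0
  have hW : e.source ∩ Ψ ⁻¹' Metric.ball (Ψ p) (R / 4) ∈ 𝓝 p :=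
    inter_mem (e.open_source.mem_nhds hesrc)
      (hΨ.continuous.continuousAt.preimage_mem_nhds (Metric.ball_mem_nhds _ (by positivity)))
  obtain ⟨ρ, hρ, -, hρs, -, hρp⟩ := exists_contDiff_tsupport_subset (n := ⊤) hW
  refine ⟨ρ, hρs, by rw [hρp]; exact one_ne_zero, fun i z => ρ z • g' i (Ψ z),
    fun i => hρs.smul ((hg' i).comp hΨ), fun z => ?_⟩
  by_cases hz : z ∈ tsupport ρ
  · have h1 := hfg' (Ψ z)
    have h2 : f' (Ψ z) = f z := by
      simp only [f']
      rw [χ.one_of_mem_closedBall (Metric.ball_subset_closedBall (hρ hz).2), one_smul, ← heΨ,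
        e.left_inv (hρ hz).1]
    rw [← h2, h1, Finset.smul_sum]
    refine Finset.sum_congr rfl fun i _ => ?_
    rw [hAΨ, smul_comm]
  · simp [image_eq_zero_of_notMem_tsupport hz]

end Regular

section

open scoped Matrix

/-! ### The rank of the gauge generators on the stationary surface -/

section NearInverse

variable {B : Type*} [CommRing B] {G : Type*} {p : G → ZMod 2} {κ : Type*} [Fintype κ]
  [DecidableEq κ]

theorem matrix_pow_mem_wspan_Ici {N : Matrix κ κ (SuperPoly B p)}
    (hN : ∀ i j, N i j ∈ wspan B p (fun _ => (1 : ℤ)) (Set.Ici 1)) (k : ℕ) (i j : κ) :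
    (N ^ k) i j ∈ wspan B p (fun _ => (1 : ℤ)) (Set.Ici (k : ℤ)) := by
  induction k generalizing i j with
  | zero =>
    rw [pow_zero, Matrix.one_apply]
    split_ifs
    · exact one_mem_wspan (by simp)
    · exact zero_mem _
  | succ k ih =>
    rw [pow_succ, Matrix.mul_apply]
    refine sum_mem fun l _ => mul_mem_wspan ?_ (ih i l) (hN l j)
    intro u hu u' hu'
    simp only [Set.mem_Ici, Nat.cast_add, Nat.cast_one] at *
    omega

/-- A matrix over the superalgebra of finitely many odd generators is invertible up to a power of
the determinant of its body. -/
theorem exists_mul_eq_det_pow [Algebra ℂ B] [Fintype G] (hp : ∀ g, p g = 1)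
    (M : Matrix κ κ (SuperPoly B p)) :
    ∃ k : ℕ, (∃ X, M * X = algebraMap B _ ((M.map (aug B p)).det ^ k)) ∧
      ∃ Y, Y * M = algebraMap B _ ((M.map (aug B p)).det ^ k) := by
  set k := Fintype.card G + 1
  set f : Matrix κ κ B →+* Matrix κ κ (SuperPoly B p) := (algebraMap B (SuperPoly B p)).mapMatrix
  set M₀ := M.map (aug B p)
  set A := f M₀.adjugate
  set D : Matrix κ κ (SuperPoly B p) := algebraMap B _ M₀.det
  have hD : f (M₀.det • 1) = D := by
    ext i j
    simp [f, D, Matrix.algebraMap_matrix_apply, Matrix.one_apply, apply_ite (algebraMap B _)]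
  have hdiff (i j : κ) : (M - f M₀) i j ∈ wspan B p (fun _ => (1 : ℤ)) (Set.Ici 1) :=
    sub_aug_mem (M i j)
  have hAw (i j : κ) : A i j ∈ wspan B p (fun _ => (1 : ℤ)) {0} := by
    change algebraMap B _ _ ∈ _
    rw [Algebra.algebraMap_eq_smul_one]
    exact Submodule.smul_mem _ _ (one_mem_wspan rfl)
  have hnil {N : Matrix κ κ (SuperPoly B p)}
      (hN : ∀ i j, N i j ∈ wspan B p (fun _ => (1 : ℤ)) (Set.Ici 1)) : N ^ k = 0 := by
    ext i j
    have h := matrix_pow_mem_wspan_Ici hN k i j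
    rw [wspan_Ici_eq_bot hp (by push_cast [k]; omega)] at h
    exact (Submodule.mem_bot _).1 h
  have hcomm (N : Matrix κ κ (SuperPoly B p)) : Commute D N := Algebra.commutes _ _
  refine ⟨k, ?_, ?_⟩
  · have hN : ∀ i j, (-((M - f M₀) * A)) i j ∈ wspan B p (fun _ => (1 : ℤ)) (Set.Ici 1) := by
      intro i j
      rw [Matrix.neg_apply, Matrix.mul_apply]
      refine neg_mem (sum_mem fun l _ => mul_mem_wspan ?_ (hdiff i l) (hAw l j))
      rintro u hu _ rfl
      simpa using hu
    refine ⟨A * ∑ i ∈ Finset.range k, D ^ i * (-((M - f M₀) * A)) ^ (k - 1 - i), ?_⟩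
    have e : M * A = D - -((M - f M₀) * A) := by
      rw [sub_neg_eq_add, sub_mul, ← map_mul f, Matrix.mul_adjugate, hD]; abel
    rw [← mul_assoc, e, (hcomm _).mul_geom_sum₂ k, hnil hN, sub_zero, map_pow]
  · have hN : ∀ i j, (-(A * (M - f M₀))) i j ∈ wspan B p (fun _ => (1 : ℤ)) (Set.Ici 1) := by
      intro i j
      rw [Matrix.neg_apply, Matrix.mul_apply]
      refine neg_mem (sum_mem fun l _ => mul_mem_wspan ?_ (hAw i l) (hdiff l j))
      rintro _ rfl u hu
      simpa using hu
    refine ⟨(∑ i ∈ Finset.range k, D ^ i * (-(A * (M - f M₀))) ^ (k - 1 - i)) * A, ?_⟩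
    have e : A * M = D - -(A * (M - f M₀)) := by
      rw [sub_neg_eq_add, mul_sub, ← map_mul f, Matrix.adjugate_mul, hD]; abel
    rw [mul_assoc, e, (hcomm _).geom_sum₂_mul k, hnil hN, sub_zero, map_pow]

end NearInverse

namespace GaugeTheory

variable {ι₀ ι₁ : Type*} [Fintype ι₀] [DecidableEq ι₀] {p₀ : ι₀ → ZMod 2} {p₁ : ι₁ → ZMod 2}
  {T : GaugeTheory p₀ p₁}

theorem eq_one_of_ne_zero {a : ZMod 2} (h : a ≠ 0) : a = 1 := by
  revert a; decide

theorem derivR_mul (i : ι₀) (F F' : FieldAlg p₀) :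
    derivR p₀ i (F * F') = F * derivR p₀ i F' + derivR p₀ i F * tw _ _ (p₀ i) F' := by
  unfold derivR
  split_ifs with h
  · rw [baseDer_mul, h, tw_zero]
  · rw [rightDer_mul, eq_one_of_ne_zero h, tw_one]

theorem derivL_mul (i : ι₀) (F F' : FieldAlg p₀) :
    derivL p₀ i (F * F') = tw _ _ (p₀ i) F * derivL p₀ i F' + derivL p₀ i F * F' := by
  unfold derivL
  rw [derivR_mul]
  split_ifs with h
  · rw [h, tw_zero, tw_zero]
  · rw [eq_one_of_ne_zero h, map_add, map_mul, map_mul, ← tw_one, tw_tw,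
      show (1 + 1 : ZMod 2) = 0 from rfl, tw_zero]

theorem derivL_zero (i : ι₀) : derivL p₀ i (0 : FieldAlg p₀) = 0 := by
  unfold derivL derivR
  split_ifs <;> simp

theorem derivL_add (i : ι₀) (F F' : FieldAlg p₀) :
    derivL p₀ i (F + F') = derivL p₀ i F + derivL p₀ i F' := by
  unfold derivL derivR
  split_ifs <;> simp

theorem derivL_sum {κ : Type*} (i : ι₀) (s : Finset κ) (F : κ → FieldAlg p₀) :
    derivL p₀ i (∑ k ∈ s, F k) = ∑ k ∈ s, derivL p₀ i (F k) :=
  map_sum (⟨⟨derivL p₀ i, derivL_zero i⟩, derivL_add i⟩ : FieldAlg p₀ →+ FieldAlg p₀) F s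

theorem derivR_S₀_mem (i : ι₀) : derivR p₀ i T.S₀ ∈ parityPart (Smooth p₀) _ (p₀ i) := by
  simpa using derivR_mem_parity p₀ i T.S₀_even

namespace WeaklyZero

theorem zero : T.WeaklyZero 0 := ⟨0, by simp⟩

theorem add {F F' : FieldAlg p₀} (h : T.WeaklyZero F) (h' : T.WeaklyZero F') :
    T.WeaklyZero (F + F') := by
  obtain ⟨g, rfl⟩ := h
  obtain ⟨g', rfl⟩ := h'
  exact ⟨g + g', by simp [mul_add, Finset.sum_add_distrib]⟩

theorem sum {κ : Type*} (s : Finset κ) {F : κ → FieldAlg p₀} (h : ∀ k ∈ s, T.WeaklyZero (F k)) :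
    T.WeaklyZero (∑ k ∈ s, F k) :=
  Finset.sum_induction _ T.WeaklyZero (fun _ _ => add) zero h

theorem mul_right {F : FieldAlg p₀} (h : T.WeaklyZero F) (F' : FieldAlg p₀) :
    T.WeaklyZero (F * F') := by
  obtain ⟨g, rfl⟩ := h
  exact ⟨fun i => g i * F', by simp [Finset.sum_mul, mul_assoc]⟩

theorem mul_left {F : FieldAlg p₀} (h : T.WeaklyZero F) (F' : FieldAlg p₀) :
    T.WeaklyZero (F' * F) := by
  obtain ⟨g, rfl⟩ := h
  refine ⟨fun i => tw _ _ (p₀ i) F' * g i, ?_⟩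
  rw [Finset.mul_sum]
  refine Finset.sum_congr rfl fun i _ => ?_
  rw [← mul_assoc, mul_swap_of_mem (derivR_S₀_mem i), mul_assoc]

theorem derivR_mul (i : ι₀) (F : FieldAlg p₀) : T.WeaklyZero (derivR p₀ i T.S₀ * F) :=
  ⟨fun j => if j = i then F else 0, by simp⟩

theorem body_eq_zero {F : FieldAlg p₀} (h : T.WeaklyZero F) {x : Body p₀}
    (hx : ∀ i, (body p₀ (derivR p₀ i T.S₀)).1 x = 0) : (body p₀ F).1 x = 0 := by
  obtain ⟨g, rfl⟩ := h
  rw [map_sum]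
  have : (∑ i, body p₀ (derivR p₀ i T.S₀ * g i)).1 x =
      ∑ i, (body p₀ (derivR p₀ i T.S₀ * g i)).1 x := by
    simp
  rw [this]
  refine Finset.sum_eq_zero fun i _ => ?_
  rw [map_mul]
  change (body p₀ (derivR p₀ i T.S₀)).1 x * _ = 0
  rw [hx, zero_mul]

end WeaklyZero

/-- The gauge generators are null vectors of the Hessian, up to field equations. -/
theorem weaklyZero_hessian_mul_Z (j : ι₀) (α : ι₁) :
    T.WeaklyZero (∑ i, derivL p₀ j (derivR p₀ i T.S₀) * T.Z i α) := by
  have h := congrArg (derivL p₀ j) (T.gauge_invariant α)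
  rw [derivL_sum, derivL_zero] at h
  simp only [derivL_mul] at h
  rw [Finset.sum_add_distrib] at h
  rw [eq_neg_of_add_eq_zero_right h, ← Finset.sum_neg_distrib]
  refine WeaklyZero.sum _ fun i _ => ?_
  rw [tw_of_mem _ (derivR_S₀_mem i), smul_mul_assoc, ← smul_neg, ← mul_neg, ← mul_smul_comm]
  exact WeaklyZero.derivR_mul i _

/-- Evaluation at a point of the body. -/
def evalAt (x : Body p₀) : Smooth p₀ →ₐ[ℂ] ℂ := (Pi.evalAlgHom ℂ _ x).comp (Smooth p₀).val

omit [DecidableEq ι₀] in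
theorem evalAt_apply (x : Body p₀) (f : Smooth p₀) : evalAt x f = f.1 x := rfl

theorem _root_.Matrix.exists_mul_eq_one_of_mulVecLin_injective {K m n : Type*}
    [_root_.Field K] [Fintype m] [Fintype n] [DecidableEq n] [DecidableEq m] (A : Matrix m n K)
    (h : Function.Injective A.mulVecLin) : ∃ L : Matrix n m K, L * A = 1 := by
  obtain ⟨g, hg⟩ := A.mulVecLin.exists_leftInverse_of_injective (LinearMap.ker_eq_bot.2 h)
  refine ⟨LinearMap.toMatrix' g, ?_⟩
  have := congrArg LinearMap.toMatrix' hg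
  rwa [LinearMap.toMatrix'_comp, ← Matrix.toLin'_apply', LinearMap.toMatrix'_toLin',
    LinearMap.toMatrix'_id] at this

theorem _root_.Matrix.exists_mul_eq_one_of_mulVecLin_surjective {K m n : Type*}
    [_root_.Field K] [Fintype m] [Fintype n] [DecidableEq n] [DecidableEq m] (A : Matrix m n K)
    (h : Function.Surjective A.mulVecLin) : ∃ R : Matrix n m K, A * R = 1 := by
  obtain ⟨g, hg⟩ := A.mulVecLin.exists_rightInverse_of_surjective (LinearMap.range_eq_top.2 h)
  refine ⟨LinearMap.toMatrix' g, ?_⟩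
  have := congrArg LinearMap.toMatrix' hg
  rwa [LinearMap.toMatrix'_comp, ← Matrix.toLin'_apply', LinearMap.toMatrix'_toLin',
    LinearMap.toMatrix'_id] at this

variable [Fintype ι₁]

open Classical in
/-- At a point of the stationary surface, there is a set `I` of fields such that the columns of the
Hessian that correspond to `I` are independent, and the rows of the gauge generators that correspond
to the other fields form an invertible matrix. The fields in `I` index a basis of the column space
of the Hessian; completeness yields surjectivity, and irreducibility injectivity. -/
theorem exists_gauge_split (hirr : T.Irreducible) (hcomp : T.CompleteRegular) {x : Body p₀}
    (hx : ∀ i, (body p₀ (derivR p₀ i T.S₀)).1 x = 0) :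
    ∃ I : Set ι₀, LinearIndepOn ℂ
        (fun i j => (body p₀ (derivL p₀ j (derivR p₀ i T.S₀))).1 x) I ∧
      Function.Bijective (Matrix.mulVecLin (Matrix.of fun (i : {i // i ∉ I}) (α : ι₁) =>
        (body p₀ (T.Z i α)).1 x)) := by
  set h : ι₀ → ι₀ → ℂ := fun i j => (body p₀ (derivL p₀ j (derivR p₀ i T.S₀))).1 x with hh
  obtain ⟨I, -, -, hspan, hI⟩ := exists_linearIndepOn_extension (K := ℂ) (v := h)
    (linearIndepOn_empty ℂ h) (Set.empty_subset Set.univ)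
  refine ⟨I, hI, ?_⟩
  set Zc : Matrix {i // i ∉ I} ι₁ ℂ := Matrix.of fun i α => (body p₀ (T.Z i α)).1 x with hZc
  have hsurj : Function.Surjective Zc.mulVecLin := by
    intro t
    -- Extend `t` to a null vector of the Hessian.
    have hmem : -∑ i : {i // i ∉ I}, t i • h i ∈ Submodule.span ℂ (h '' I) :=
      neg_mem (sum_mem fun i _ => Submodule.smul_mem _ _ (hspan ⟨i, trivial, rfl⟩))
    rw [Set.image_eq_range, Submodule.mem_span_range_iff_exists_fun] at hmem
    obtain ⟨c, hc⟩ := hmem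
    let v : ι₀ → ℂ := fun i => if hi : i ∈ I then c ⟨i, hi⟩ else t ⟨i, hi⟩
    obtain ⟨w, hw⟩ := hcomp x hx v (fun j => by
      rw [← Fintype.sum_subtype_add_sum_subtype (· ∈ I)]
      have h1 := congrFun hc j
      simp only [Finset.sum_apply, Pi.smul_apply, Pi.neg_apply, smul_eq_mul] at h1
      rw [eq_neg_iff_add_eq_zero] at h1
      rw [← h1]
      congr 1
      · refine Fintype.sum_congr _ _ fun i => ?_
        simp only [v, i.2, dif_pos, h]
        exact mul_comm _ _
      · refine Fintype.sum_congr _ _ fun i => ?_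
        simp only [v, i.2, h]
        exact mul_comm _ _)
    refine ⟨w, funext fun i => ?_⟩
    have h1 := hw i
    simp only [v, i.2, dif_neg, not_false_eq_true] at h1
    rw [Matrix.mulVecLin_apply]
    exact h1.symm
  refine ⟨?_, hsurj⟩
  rw [← LinearMap.ker_eq_bot, LinearMap.ker_eq_bot']
  intro w hw
  rw [Matrix.mulVecLin_apply] at hw
  obtain ⟨R, hR⟩ := Zc.exists_mul_eq_one_of_mulVecLin_surjective hsurj
  obtain ⟨L, hL⟩ := Matrix.exists_mul_eq_one_of_mulVecLin_injective
    (Matrix.of fun (j : ι₀) (i : I) => h i j) (by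
      have := Matrix.mulVec_injective_iff.2 (show LinearIndependent ℂ
        (Matrix.of fun (j : ι₀) (i : I) => h i j).col from hI)
      exact this)
  let C : ℂ →+* FieldAlg p₀ := (algebraMap (Smooth p₀) _).comp (algebraMap ℂ _)
  let β : FieldAlg p₀ →+* ℂ := (evalAt x).toRingHom.comp (body p₀).toRingHom
  have hβC : β.comp C = RingHom.id ℂ := by
    ext z
    simp [β, C, evalAt]
  have hβC' (z : ℂ) : β (C z) = z := RingHom.congr_fun hβC z
  have hdet {κ : Type _} [Fintype κ] [DecidableEq κ] (M : Matrix κ κ (FieldAlg p₀))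
      (hM : M.map β = 1) :
      evalAt x (M.map (body p₀)).det = 1 := by
    have h1 := (evalAt x).toRingHom.map_det (M.map (body p₀))
    have h2 : (evalAt x).toRingHom.mapMatrix (M.map (body p₀)) = 1 := by
      rw [← hM]; rfl
    rw [h2, Matrix.det_one] at h1
    exact h1
  -- Solve `Z f = 0` exactly in the rows outside `I`, starting from the constant `w`.
  let Zs : Matrix {i // i ∉ I} ι₁ (FieldAlg p₀) := Matrix.of fun i α => T.Z i α
  obtain ⟨k, ⟨X, hX⟩, -⟩ := exists_mul_eq_det_pow (fun i : {i : ι₀ // p₀ i = 1} => i.2)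
    (Zs * R.map C)
  set ρ := ((Zs * R.map C).map (body p₀)).det ^ k
  change _ = algebraMap _ _ ρ at hX
  have hρ : evalAt x ρ = 1 := by
    rw [map_pow, hdet, one_pow]
    rw [Matrix.map_mul, Matrix.map_map, ← RingHom.coe_comp, hβC]
    exact (congrArg₂ (· * ·) (rfl : Zs.map β = Zc) (Matrix.map_id R)).trans hR
  let f : ι₁ → FieldAlg p₀ := ρ • (C ∘ w) - R.map C *ᵥ (X *ᵥ (Zs *ᵥ (C ∘ w)))
  have hZf : Zs *ᵥ f = 0 := by
    have e : Zs *ᵥ (ρ • (C ∘ w)) = ρ • (Zs *ᵥ (C ∘ w)) := Matrix.mulVec_smul _ _ _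
    rw [Matrix.mulVec_sub, e, Matrix.mulVec_mulVec, Matrix.mulVec_mulVec, hX,
      Algebra.algebraMap_eq_smul_one, Matrix.smul_mulVec, Matrix.one_mulVec, sub_self]
  have hβf (α : ι₁) : β (f α) = w α := by
    have e1 : β (ρ • C (w α)) = w α := by
      rw [Algebra.smul_def, map_mul, hβC']
      have : β (algebraMap _ _ ρ) = evalAt x ρ := by simp [β]
      rw [this, hρ, one_mul]
    have e2 : β ∘ (Zs *ᵥ (C ∘ w)) = 0 := by
      funext i
      rw [Function.comp_apply, RingHom.map_mulVec]
      have : β ∘ C ∘ w = w := by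
        funext α
        exact hβC' _
      rw [this]
      exact congrFun hw i
    change β (ρ • C (w α) - (R.map C *ᵥ (X *ᵥ (Zs *ᵥ (C ∘ w)))) α) = _
    rw [map_sub, e1, RingHom.map_mulVec]
    have : β ∘ (X *ᵥ (Zs *ᵥ (C ∘ w))) = 0 := by
      funext i
      rw [Function.comp_apply, RingHom.map_mulVec, e2, Matrix.mulVec_zero]
    rw [this, Matrix.mulVec_zero, Pi.zero_apply, sub_zero]
  -- By the Noether identities, `Z f` then vanishes weakly in the rows in `I`.
  let g : ι₀ → FieldAlg p₀ := fun i => ∑ α, T.Z i α * f α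
  have hg (i : ι₀) (hi : i ∉ I) : g i = 0 := congrFun hZf ⟨i, hi⟩
  let Hs : Matrix ι₀ I (FieldAlg p₀) := Matrix.of fun j i => derivL p₀ j (derivR p₀ i T.S₀)
  have hHg (j : ι₀) : T.WeaklyZero ((Hs *ᵥ fun i => g i) j) := by
    have e : (Hs *ᵥ fun i => g i) j =
        ∑ α, (∑ i, derivL p₀ j (derivR p₀ i T.S₀) * T.Z i α) * f α := by
      simp only [Finset.sum_mul]
      rw [Finset.sum_comm, ← Fintype.sum_subtype_add_sum_subtype (· ∈ I)]
      have h0 : ∑ i : {i // i ∉ I},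
          ∑ α, derivL p₀ j (derivR p₀ i T.S₀) * T.Z i α * f α = 0 := by
        refine Finset.sum_eq_zero fun i _ => ?_
        simp only [mul_assoc, ← Finset.mul_sum]
        rw [show ∑ α, T.Z i α * f α = 0 from hg i i.2, mul_zero]
      rw [h0, add_zero]
      refine Fintype.sum_congr _ _ fun i => ?_
      simp only [mul_assoc, ← Finset.mul_sum]
      rfl
    rw [e]
    exact WeaklyZero.sum _ fun α _ => (weaklyZero_hessian_mul_Z j α).mul_right _
  obtain ⟨k', -, Y, hY⟩ := exists_mul_eq_det_pow (fun i : {i : ι₀ // p₀ i = 1} => i.2)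
    (L.map C * Hs)
  set ρ' := ((L.map C * Hs).map (body p₀)).det ^ k'
  change _ = algebraMap _ _ ρ' at hY
  have hρ' : evalAt x ρ' = 1 := by
    rw [map_pow, hdet, one_pow]
    rw [Matrix.map_mul, Matrix.map_map, ← RingHom.coe_comp, hβC]
    exact (congrArg₂ (· * ·) (Matrix.map_id L) (rfl : Hs.map β = _)).trans hL
  have hwg (i : ι₀) : T.WeaklyZero (ρ' • g i) := by
    by_cases hi : i ∈ I
    · have e : ρ' • g i = ((Y * L.map C) *ᵥ (Hs *ᵥ fun i => g i)) ⟨i, hi⟩ := by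
        rw [Matrix.mulVec_mulVec, Matrix.mul_assoc, hY, Algebra.algebraMap_eq_smul_one,
          Matrix.smul_mulVec, Matrix.one_mulVec, Pi.smul_apply]
      rw [e]
      exact WeaklyZero.sum _ fun j _ => (hHg j).mul_left _
    · rw [hg i hi, smul_zero]
      exact WeaklyZero.zero
  obtain ⟨f', hf'⟩ := hirr (ρ' • f) (fun i => by
    have := hwg i
    simp only [g, Finset.smul_sum, ← mul_smul_comm] at this
    exact this)
  funext α
  have h1 : (body p₀ ((ρ' • f) α)).1 x = 0 :=
    WeaklyZero.body_eq_zero (T := T) ⟨fun i => f' i α, hf' α⟩ hx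
  rw [← hβf α, ← one_mul (β (f α)), ← hρ']
  rw [Pi.smul_apply, map_smul] at h1
  exact h1

end GaugeTheory

end

section

open scoped Matrix

/-! ### Local data on the stationary surface -/

/-- A matrix with independent columns has an invertible submatrix on all its columns. -/
theorem _root_.Matrix.exists_det_submatrix_ne_zero {K m n : Type*} [_root_.Field K] [Fintype m]
    [Fintype n] [DecidableEq n] [DecidableEq m] (A : Matrix m n K)
    (h : Function.Injective A.mulVecLin) :
    ∃ e : n → m, Function.Injective e ∧ (A.submatrix e id).det ≠ 0 := by
  obtain ⟨L, hL⟩ := A.exists_mul_eq_one_of_mulVecLin_injective h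
  obtain ⟨κ, a, ha, hspan, hli⟩ := exists_linearIndependent' K A.row
  have htop : ⊤ ≤ Submodule.span K (Set.range (A.row ∘ a)) := by
    rw [hspan, ← (Pi.basisFun K n).span_eq, Submodule.span_le]
    rintro _ ⟨i, rfl⟩
    have e : Pi.basisFun K n i = ∑ j, L i j • A.row j := by
      ext k
      have := congrFun (congrFun hL i) k
      rw [Matrix.mul_apply, Matrix.one_apply] at this
      simp only [Pi.basisFun_apply, Finset.sum_apply, Pi.smul_apply, Matrix.row, smul_eq_mul,
        Pi.single_apply]
      rw [this]
      simp only [eq_comm]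
    rw [e]
    exact sum_mem fun j _ => Submodule.smul_mem _ _ (Submodule.subset_span ⟨j, rfl⟩)
  let b := Module.Basis.mk hli htop
  let e := (Pi.basisFun K n).indexEquiv b
  refine ⟨a ∘ e, ha.comp e.injective, ?_⟩
  have : LinearIndependent K (A.submatrix (a ∘ e) id).row := hli.comp e e.injective
  rw [Matrix.linearIndependent_rows_iff_isUnit, Matrix.isUnit_iff_isUnit_det] at this
  exact this.ne_zero

theorem mem_span_image_finset {B κ : Type*} [CommRing B] {y : κ → B} {s : Finset κ} {x : B} :
    x ∈ Ideal.span (y '' s) ↔ ∃ c : κ → B, ∑ i ∈ s, c i * y i = x := by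
  classical
  rw [Ideal.span, Submodule.mem_span_image_finset_iff_exists_fun]
  constructor
  · rintro ⟨c, rfl⟩
    refine ⟨fun i => if h : i ∈ s then c ⟨i, h⟩ else 0, ?_⟩
    rw [← Finset.sum_coe_sort]
    exact Fintype.sum_congr _ _ fun i => by simp
  · rintro ⟨c, rfl⟩
    exact ⟨fun i => c i, by rw [← Finset.sum_coe_sort s]; rfl⟩

namespace GaugeTheory

variable {ι₀ ι₁ : Type*} [Fintype ι₀] [DecidableEq ι₀] {p₀ : ι₀ → ZMod 2} {p₁ : ι₁ → ZMod 2}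

/-- The functions of the even fields that do not vanish at `x`. -/
def nonvanishing (x : Body p₀) : Submonoid (Smooth p₀) :=
  (nonZeroDivisors ℂ).comap (evalAt x)

omit [DecidableEq ι₀] in
theorem mem_nonvanishing {x : Body p₀} {f : Smooth p₀} : f ∈ nonvanishing x ↔ f.1 x ≠ 0 := by
  rw [nonvanishing, Submonoid.mem_comap, mem_nonZeroDivisors_iff_ne_zero, evalAt_apply]

/-- The body of the Hessian of the action. -/
def hess (T : GaugeTheory p₀ p₁) (j i : ι₀) : Smooth p₀ :=
  body p₀ (derivL p₀ j (derivR p₀ i T.S₀))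

/-- The body of the gauge generators. -/
def bodyZ (T : GaugeTheory p₀ p₁) (i : ι₀) (α : ι₁) : Smooth p₀ := body p₀ (T.Z i α)

/-- The left-hand sides of the even field equations, at vanishing odd fields. -/
def bodyEq (T : GaugeTheory p₀ p₁) (i : ι₀) : Smooth p₀ := body p₀ (derivR p₀ i T.S₀)

/-- Local data at a point of the stationary surface: the fields are split into those in `I`, on
which the Hessian is nondegenerate, and the others, on which the gauge generators are. The
inverses are taken up to the common factor `ρ`. For the odd fields, `J` is the set of the
equations that determine the fields in `I`; for the even ones, the equations with label in `I`
form a regular sequence. -/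
structure ShellData [Fintype ι₁] [DecidableEq ι₁] (T : GaugeTheory p₀ p₁) (x : Body p₀) where
  I : Set ι₀
  J : Set {i : ι₀ // p₀ i = 1}
  ρ : Smooth p₀
  K : ι₀ → {i : ι₀ // p₀ i = 1} → Smooth p₀
  W : ι₁ → ι₀ → Smooth p₀
  ρ_mem : ρ ∈ nonvanishing x
  K_eq_zero : ∀ i j, ¬ (i ∈ I ∧ p₀ i = 1 ∧ j ∈ J) → K i j = 0
  W_eq_zero : ∀ α i, ¬ (i ∉ I ∧ p₀ i = p₁ α) → W α i = 0
  K_mul_hess : ∀ i ∈ I, p₀ i = 1 → ∀ i', ∑ j, K i' j * T.hess j i = if i' = i then ρ else 0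
  hess_mul_K : ∀ j ∈ J, ∀ j' ∈ J, ∑ i, T.hess j' i * K i j = if j' = j then ρ else 0
  W_mul_Z : ∀ α β, ∑ i, W α i * T.bodyZ i β = if α = β then ρ else 0
  Z_mul_W : ∀ i ∉ I, ∀ i' ∉ I, ∑ α, T.bodyZ i' α * W α i = if i' = i then ρ else 0
  regular : ∀ (s : Finset {i : ι₀ // i ∈ I ∧ p₀ i = 0}) (k : {i : ι₀ // i ∈ I ∧ p₀ i = 0}),
    k ∉ s → ∀ f : Smooth p₀,
      -T.bodyEq k * f ∈ Ideal.span ((fun i : {i // i ∈ I ∧ p₀ i = 0} => -T.bodyEq i) '' s) →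
      ∃ t ∈ nonvanishing x,
        t * f ∈ Ideal.span ((fun i : {i // i ∈ I ∧ p₀ i = 0} => -T.bodyEq i) '' s)

variable {T : GaugeTheory p₀ p₁}

/-- The Hessian of an even action is even: its body has no entries of mixed parities. -/
theorem hess_eq_zero {i j : ι₀} (h : p₀ i ≠ p₀ j) : T.hess j i = 0 := by
  refine aug_eq_zero_of_mem (c := p₀ j + p₀ i) ?_ (derivL_mem_parity p₀ j (derivR_S₀_mem i))
  revert h
  generalize p₀ i = a
  generalize p₀ j = b
  revert a b
  decide

/-- The body of a gauge generator vanishes unless its field and its gauge parameter have the same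
parity. -/
theorem bodyZ_eq_zero {i : ι₀} {α : ι₁} (h : p₀ i ≠ p₁ α) : T.bodyZ i α = 0 := by
  refine aug_eq_zero_of_mem (c := p₀ i + p₁ α) ?_ (T.Z_parity i α)
  revert h
  generalize p₀ i = a
  generalize p₁ α = b
  revert a b
  decide

open Classical in
/-- The blocks of a Hessian with independent columns have independent columns. -/
theorem hess_block_injective {x : Body p₀} {I : Set ι₀}
    (hI : LinearIndepOn ℂ (fun i j => (T.hess j i).1 x) I) (c : ZMod 2) :
    Function.Injective (Matrix.mulVecLin (Matrix.of
      fun (j : {j : ι₀ // p₀ j = c}) (i : {i : ι₀ // i ∈ I ∧ p₀ i = c}) =>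
        (T.hess j i).1 x)) := by
  have h1 : LinearIndependent ℂ fun (i : {i : ι₀ // i ∈ I ∧ p₀ i = c}) j => (T.hess j i).1 x :=
    hI.comp (fun i : {i : ι₀ // i ∈ I ∧ p₀ i = c} => (⟨i, i.2.1⟩ : I))
      fun i j h => Subtype.ext (congrArg (fun k : I => (k : ι₀)) h)
  rw [← LinearMap.ker_eq_bot, LinearMap.ker_eq_bot']
  intro w hw
  funext i
  refine Fintype.linearIndependent_iff.1 h1 w (funext fun j => ?_) i
  rw [Finset.sum_apply, Pi.zero_apply]
  by_cases hj : p₀ j = c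
  · refine Eq.trans ?_ (congrFun hw ⟨j, hj⟩)
    exact Finset.sum_congr rfl fun i _ => mul_comm _ _
  · refine Finset.sum_eq_zero fun i _ => ?_
    rw [Pi.smul_apply, hess_eq_zero (by rw [i.2.2]; exact Ne.symm hj)]
    exact smul_zero _

omit [DecidableEq ι₀] in
theorem body_baseDer (d : Derivation ℂ (Smooth p₀) (Smooth p₀)) (F : FieldAlg p₀) :
    body p₀ (baseDer d F) = d (body p₀ F) := by
  have hF := mem_wspan_univ (Smooth p₀) (fun i : {i : ι₀ // p₀ i = 1} => p₀ i)
    (fun _ => (0 : ℤ)) F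
  induction hF using Submodule.span_induction with
  | mem x h =>
    obtain ⟨l, -, rfl⟩ := h
    have : baseDer d (l.map (gen (Smooth p₀) fun i : {i : ι₀ // p₀ i = 1} => p₀ i)).prod = 0 := by
      induction l with
      | nil => simp [baseDer]
      | cons k l ih => simp [baseDer_mul, baseDer_gen, ih]
    rw [show baseDer d (mon (Smooth p₀) (fun i : {i : ι₀ // p₀ i = 1} => p₀ i) l) = 0 from this,
      map_zero]
    cases l with
    | nil => simp
    | cons k l => rw [mon_cons, map_mul, body_eq_aug, aug_gen, zero_mul, map_zero]
  | zero => simp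
  | add x y _ _ hx hy => simp only [map_add, hx, hy]
  | smul b x _ hx =>
    rw [Algebra.smul_def, baseDer_mul, baseDer_algebraMap, map_add, map_mul, map_mul, map_mul, hx]
    simp only [AlgHom.commutes, Algebra.algebraMap_self, RingHom.id_apply, Derivation.leibniz,
      smul_eq_mul]
    ring

theorem body_derivR_of_even {i : ι₀} (h : p₀ i = 0) (F : FieldAlg p₀) :
    body p₀ (derivR p₀ i F) = pderiv ⟨i, h⟩ (body p₀ F) := by
  rw [derivR, dif_pos h, body_baseDer]

/-- Partial derivatives of real functions are real. -/
theorem pderiv_ofReal {f : Smooth p₀} {r : Body p₀ → ℝ} (h : ∀ x, f.1 x = r x) :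
    ContDiff ℝ ∞ r ∧ ∀ i x, (pderiv i f).1 x = (fderiv ℝ r x (Pi.single i 1) : ℝ) := by
  have hr : r = fun x => Complex.reCLM (f.1 x) := by
    funext x
    rw [h]
    simp
  have hc : ContDiff ℝ ∞ r := by
    rw [hr]
    exact Complex.reCLM.contDiff.comp (contDiff_smooth f)
  refine ⟨hc, fun i x => ?_⟩
  have hf : f.1 = fun x => Complex.ofRealCLM (r x) := by
    funext x
    rw [h]
    simp
  change fderiv ℝ f.1 x (Pi.single i 1) = _
  rw [hf]
  have := (Complex.ofRealCLM.hasFDerivAt (x := r x)).comp x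
    (hc.differentiable (by simp) x).hasFDerivAt
  rw [show (fun x => Complex.ofRealCLM (r x)) = Complex.ofRealCLM ∘ r from rfl, this.fderiv]
  simp

/-- The even field equations with independent differentials form a regular sequence. -/
theorem regular_of_linearIndepOn {x : Body p₀} {I : Set ι₀}
    (hI : LinearIndepOn ℂ (fun i j => (T.hess j i).1 x) I) :
    ∀ (s : Finset {i : ι₀ // i ∈ I ∧ p₀ i = 0}) (k : {i : ι₀ // i ∈ I ∧ p₀ i = 0}),
      k ∉ s → ∀ f : Smooth p₀,
        -T.bodyEq k * f ∈ Ideal.span ((fun i : {i // i ∈ I ∧ p₀ i = 0} => -T.bodyEq i) '' s) →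
        ∃ t ∈ nonvanishing x,
          t * f ∈ Ideal.span ((fun i : {i // i ∈ I ∧ p₀ i = 0} => -T.bodyEq i) '' s) := by
  classical
  intro s k hk f hf
  -- As `S₀` has a real body, the equations are given by real functions.
  choose r hr using T.S₀_real
  obtain ⟨hrs, hrd⟩ := pderiv_ofReal (f := body p₀ T.S₀) (r := r) (fun x => (hr x).symm)
  let u : {i : ι₀ // i ∈ I ∧ p₀ i = 0} → Body p₀ → ℝ :=
    fun i z => -fderiv ℝ r z (Pi.single ⟨i, i.2.2⟩ 1)
  have hu (i : {i : ι₀ // i ∈ I ∧ p₀ i = 0}) (z : Body p₀) :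
      (-T.bodyEq i : Smooth p₀).1 z = (u i z : ℝ) := by
    have : (T.bodyEq i).1 z = (fderiv ℝ r z (Pi.single ⟨i, i.2.2⟩ 1) : ℝ) := by
      rw [bodyEq, body_derivR_of_even i.2.2, hrd]
    change -(T.bodyEq i).1 z = _
    rw [this]
    simp [u]
  have hud (i : {i : ι₀ // i ∈ I ∧ p₀ i = 0}) (j : {j : ι₀ // p₀ j = 0}) :
      ((fderiv ℝ (u i) x (Pi.single j 1) : ℝ) : ℂ) = -(T.hess j i).1 x := by
    rw [← (pderiv_ofReal (hu i)).2, map_neg]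
    change -(pderiv j (T.bodyEq i)).1 x = _
    rw [hess, body_derivL, body_derivR_of_even j.2]
    rfl
  let M : Matrix {j : ι₀ // p₀ j = 0} {i : ι₀ // i ∈ I ∧ p₀ i = 0} ℝ :=
    Matrix.of fun j i => fderiv ℝ (u i) x (Pi.single j 1)
  have hM : Function.Injective M.mulVecLin := by
    rw [← LinearMap.ker_eq_bot, LinearMap.ker_eq_bot']
    intro w hw
    have h1 := (LinearMap.ker_eq_bot'.1 (LinearMap.ker_eq_bot.2 (hess_block_injective hI 0)))
      (fun i => (w i : ℂ)) (by
        funext j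
        have h2 := congrArg (fun y : ℝ => (y : ℂ)) (congrFun hw j)
        simp only [Matrix.mulVecLin_apply, Matrix.mulVec, dotProduct, M, Matrix.of_apply,
          Complex.ofReal_sum, Complex.ofReal_mul, hud, Pi.zero_apply, Complex.ofReal_zero, neg_mul,
          Finset.sum_neg_distrib, neg_eq_zero] at h2 ⊢
        exact h2)
    funext i
    exact Complex.ofReal_eq_zero.1 (congrFun h1 i)
  obtain ⟨L, hL⟩ := M.exists_mul_eq_one_of_mulVecLin_injective hM
  rw [mem_span_image_finset] at hf
  obtain ⟨g, hg⟩ := hf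
  obtain ⟨t, ht, htx, h, hh, hth⟩ := exists_mul_eq_sum (u := u) (fun i => (pderiv_ofReal (hu i)).1)
    (p := x) (v := fun k j => L k j) (K := s) (k := k) (fun i k => by
      have e : (fun j => L k j) = ∑ j, L k j • (Pi.single j 1 : Body p₀) := by
        ext j
        simp [Finset.sum_apply, Pi.single_apply]
      rw [e, map_sum]
      simp only [map_smul, smul_eq_mul]
      have := congrFun (congrFun hL k) i
      rw [Matrix.mul_apply, Matrix.one_apply] at this
      simp only [eq_comm (a := i)]
      exact this) hk (contDiff_smooth f) (g := fun i => (g i).1) (fun z => by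
      have h1 := congrArg (fun q : Smooth p₀ => q.1 z) hg
      have h2 : (∑ i ∈ s, g i * -T.bodyEq i : Smooth p₀).1 z = ∑ i ∈ s, u i z • (g i).1 z := by
        rw [← evalAt_apply, map_sum]
        refine Finset.sum_congr rfl fun i _ => ?_
        rw [map_mul, mul_comm, evalAt_apply, hu]
        simp [evalAt_apply]
      have h3 : (-T.bodyEq k * f : Smooth p₀).1 z = u k z • f.1 z := by
        rw [← evalAt_apply, map_mul, evalAt_apply, hu]
        simp [evalAt_apply]
      rw [← h3, ← h1]
      exact h2)
  refine ⟨⟨fun z => (t z : ℂ), Complex.ofRealCLM.contDiff.comp ht⟩, ?_, ?_⟩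
  · rw [mem_nonvanishing]
    exact Complex.ofReal_ne_zero.2 htx
  · rw [mem_span_image_finset]
    refine ⟨fun i => ⟨h i, hh i⟩, ?_⟩
    refine Subtype.ext (funext fun z => ?_)
    have h2 : (∑ i ∈ s, (⟨h i, hh i⟩ : Smooth p₀) * -T.bodyEq i : Smooth p₀).1 z =
        ∑ i ∈ s, u i z • h i z := by
      rw [← evalAt_apply, map_sum]
      refine Finset.sum_congr rfl fun i _ => ?_
      rw [map_mul, mul_comm, evalAt_apply, hu]
      simp [evalAt_apply]
    refine h2.trans ((hth z).symm.trans ?_)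
    simp

/-- The odd block of the Hessian has an invertible submatrix on the columns in `I`. -/
theorem exists_odd_inverse {x : Body p₀} {I : Set ι₀}
    (hI : LinearIndepOn ℂ (fun i j => (T.hess j i).1 x) I) :
    ∃ (J : Set {i : ι₀ // p₀ i = 1}) (ρ : Smooth p₀) (K : ι₀ → {i : ι₀ // p₀ i = 1} → Smooth p₀),
      ρ ∈ nonvanishing x ∧ (∀ i j, ¬ (i ∈ I ∧ p₀ i = 1 ∧ j ∈ J) → K i j = 0) ∧
      (∀ i ∈ I, p₀ i = 1 → ∀ i', ∑ j, K i' j * T.hess j i = if i' = i then ρ else 0) ∧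
      ∀ j ∈ J, ∀ j' ∈ J, ∑ i, T.hess j' i * K i j = if j' = j then ρ else 0 := by
  classical
  obtain ⟨e, he, hdet⟩ := Matrix.exists_det_submatrix_ne_zero _ (hess_block_injective hI 1)
  let M : Matrix {i : ι₀ // i ∈ I ∧ p₀ i = 1} {i : ι₀ // i ∈ I ∧ p₀ i = 1} (Smooth p₀) :=
    Matrix.of fun k i => T.hess (e k) i
  let K : ι₀ → {i : ι₀ // p₀ i = 1} → Smooth p₀ := fun i j =>
    if h : (i ∈ I ∧ p₀ i = 1) ∧ j ∈ Set.range e then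
      M.adjugate ⟨i, h.1⟩ ((Equiv.ofInjective e he).symm ⟨j, h.2⟩) else 0
  have hK (i k : {i : ι₀ // i ∈ I ∧ p₀ i = 1}) : K i (e k) = M.adjugate i k := by
    have : (i.1 ∈ I ∧ p₀ i = 1) ∧ e k ∈ Set.range e := ⟨i.2, k, rfl⟩
    simp only [K, dif_pos this]
    congr 1
    exact (Equiv.ofInjective e he).symm_apply_apply k
  have hK0 (i : ι₀) (j : {i : ι₀ // p₀ i = 1}) (h : ¬ (i ∈ I ∧ p₀ i = 1 ∧ j ∈ Set.range e)) :
      K i j = 0 := dif_neg fun h' => h ⟨h'.1.1, h'.1.2, h'.2⟩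
  refine ⟨Set.range e, M.det, K, ?_, hK0, ?_, ?_⟩
  · rw [mem_nonvanishing, ← evalAt_apply]
    have := (evalAt x).toRingHom.map_det M
    exact (this.trans (by rfl)).trans_ne hdet
  · intro i hi hi1 i'
    by_cases hi' : i' ∈ I ∧ p₀ i' = 1
    · have h1 := congrFun (congrFun M.adjugate_mul ⟨i', hi'⟩) ⟨i, hi, hi1⟩
      rw [Matrix.mul_apply, Matrix.smul_apply, Matrix.one_apply, smul_eq_mul, mul_ite, mul_one,
        mul_zero] at h1
      simp only [Subtype.mk.injEq] at h1
      rw [← h1]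
      refine (Fintype.sum_of_injective e he _ _ (fun j hj => ?_) fun k => ?_).symm
      · rw [hK0 _ _ (fun h => hj h.2.2), zero_mul]
      · rw [← hK]
        rfl
    · rw [if_neg (by rintro rfl; exact hi' ⟨hi, hi1⟩)]
      exact Finset.sum_eq_zero fun j _ => by rw [hK0 _ _ (fun h => hi' ⟨h.1, h.2.1⟩), zero_mul]
  · rintro _ ⟨k, rfl⟩ _ ⟨k', rfl⟩
    have h1 := congrFun (congrFun M.mul_adjugate k') k
    rw [Matrix.mul_apply, Matrix.smul_apply, Matrix.one_apply, smul_eq_mul, mul_ite, mul_one,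
      mul_zero] at h1
    simp only [he.eq_iff]
    rw [← h1]
    refine (Fintype.sum_of_injective (fun i : {i : ι₀ // i ∈ I ∧ p₀ i = 1} => (i : ι₀))
      Subtype.val_injective _ _
      (fun i hi => ?_) fun i => ?_).symm
    · rw [hK0 _ _ (fun h => hi ⟨⟨i, h.1, h.2.1⟩, rfl⟩), mul_zero]
    · rw [← hK]
      rfl

/-- The gauge generators of the fields outside `I` form an invertible matrix. Its adjugate is cut to
the entries of matching parities. -/
theorem exists_gauge_inverse [Fintype ι₁] [DecidableEq ι₁] {x : Body p₀} {I : Set ι₀}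
    (hZ : Function.Bijective (Matrix.mulVecLin (Matrix.of fun (i : {i // i ∉ I}) (α : ι₁) =>
        (T.bodyZ i α).1 x))) :
    ∃ (ρ : Smooth p₀) (W : ι₁ → ι₀ → Smooth p₀),
      ρ ∈ nonvanishing x ∧ (∀ α i, ¬ (i ∉ I ∧ p₀ i = p₁ α) → W α i = 0) ∧
      (∀ α β, ∑ i, W α i * T.bodyZ i β = if α = β then ρ else 0) ∧
      ∀ i ∉ I, ∀ i' ∉ I, ∑ α, T.bodyZ i' α * W α i = if i' = i then ρ else 0 := by
  classical
  have hcard : Fintype.card ι₁ = Fintype.card {i // i ∉ I} := by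
    simpa using (LinearEquiv.ofBijective _ hZ).finrank_eq
  let e := Fintype.equivOfCardEq hcard
  let M : Matrix ι₁ ι₁ (Smooth p₀) := Matrix.of fun β α => T.bodyZ (e β) α
  let W : ι₁ → ι₀ → Smooth p₀ := fun α i =>
    if h : i ∉ I ∧ p₀ i = p₁ α then M.adjugate α (e.symm ⟨i, h.1⟩) else 0
  have hW (α β : ι₁) : W α (e β) = if p₀ (e β) = p₁ α then M.adjugate α β else 0 := by
    by_cases h : p₀ (e β) = p₁ α
    · have h' : (e β).1 ∉ I ∧ p₀ (e β) = p₁ α := ⟨(e β).2, h⟩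
      simp only [W, dif_pos h', if_pos h]
      simp
    · simp only [W, dif_neg (fun h' : (e β).1 ∉ I ∧ p₀ (e β) = p₁ α => h h'.2), if_neg h]
  have hW0 (α : ι₁) (i : ι₀) (h : ¬ (i ∉ I ∧ p₀ i = p₁ α)) : W α i = 0 := dif_neg h
  have hentry (α β : ι₁) : (if α = β then M.det else 0) = (M.det • (1 : Matrix ι₁ ι₁ _)) α β := by
    rw [Matrix.smul_apply, Matrix.one_apply, smul_eq_mul, mul_ite, mul_one, mul_zero]
  refine ⟨M.det, W, ?_, hW0, ?_, ?_⟩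
  · rw [mem_nonvanishing, ← evalAt_apply]
    have h1 := (evalAt x).toRingHom.map_det M
    have h2 : IsUnit ((evalAt x).toRingHom.mapMatrix M) := by
      rw [← Matrix.mulVec_injective_iff_isUnit]
      intro w w' h
      refine hZ.1 (funext fun i => ?_)
      have := congrFun h (e.symm i)
      obtain ⟨β, rfl⟩ := e.surjective i
      rw [e.symm_apply_apply] at this
      exact this
    rw [Matrix.isUnit_iff_isUnit_det] at h2
    exact h1.trans_ne h2.ne_zero
  · intro α β
    have e1 : ∑ i, W α i * T.bodyZ i β = ∑ γ, W α (e γ) * M γ β := by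
      refine (Fintype.sum_of_injective (fun γ => (e γ : ι₀))
        (Subtype.val_injective.comp e.injective) _ _ (fun i hi => ?_) fun γ => rfl).symm
      rw [hW0, zero_mul]
      rintro ⟨h, -⟩
      exact hi ⟨e.symm ⟨i, h⟩, by simp⟩
    rw [e1]
    by_cases h : p₁ α = p₁ β
    · rw [hentry, ← M.adjugate_mul, Matrix.mul_apply]
      refine Finset.sum_congr rfl fun γ _ => ?_
      rw [hW]
      split_ifs with h'
      · rfl
      · rw [show M γ β = 0 from bodyZ_eq_zero (h ▸ h'), mul_zero, mul_zero]
    · rw [if_neg (fun h' => h (congrArg p₁ h'))]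
      refine Finset.sum_eq_zero fun γ _ => ?_
      rw [hW]
      split_ifs with h'
      · rw [show M γ β = 0 from bodyZ_eq_zero (h' ▸ h), mul_zero]
      · rw [zero_mul]
  · intro i hi i' hi'
    obtain ⟨β, hβ⟩ := e.surjective ⟨i, hi⟩
    obtain ⟨β', hβ'⟩ := e.surjective ⟨i', hi'⟩
    obtain rfl : (e β : ι₀) = i := congrArg Subtype.val hβ
    obtain rfl : (e β' : ι₀) = i' := congrArg Subtype.val hβ'
    have e1 : ((e β' : ι₀) = e β) = (β' = β) :=
      propext (Subtype.val_injective.comp e.injective).eq_iff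
    simp only [e1]
    by_cases h : p₀ (e β) = p₀ (e β')
    · rw [hentry, ← M.mul_adjugate, Matrix.mul_apply]
      refine Finset.sum_congr rfl fun γ _ => ?_
      rw [hW]
      split_ifs with h'
      · rfl
      · rw [show T.bodyZ (e β') γ = 0 from bodyZ_eq_zero (h ▸ h'),
          show M β' γ = 0 from bodyZ_eq_zero (h ▸ h'), zero_mul, zero_mul]
    · rw [if_neg (by rintro rfl; exact h rfl)]
      refine Finset.sum_eq_zero fun γ _ => ?_
      rw [hW]
      split_ifs with h'
      · rw [bodyZ_eq_zero (fun h'' => h (h'.trans h''.symm)), zero_mul]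
      · rw [mul_zero]

/-- The stationary surface carries local data at each of its points: a maximal set `I` of fields
with independent columns of the Hessian splits the fields. -/
theorem nonempty_shellData [Fintype ι₁] [DecidableEq ι₁] (hirr : T.Irreducible)
    (hcomp : T.CompleteRegular) {x : Body p₀} (hx : ∀ i, (body p₀ (derivR p₀ i T.S₀)).1 x = 0) :
    Nonempty (T.ShellData x) := by
  obtain ⟨I, hI, hZ⟩ := exists_gauge_split hirr hcomp hx
  obtain ⟨J, ρ₁, K, hρ₁, hK0, hK1, hK2⟩ := exists_odd_inverse (T := T) hI
  obtain ⟨ρ₂, W, hρ₂, hW0, hW1, hW2⟩ := exists_gauge_inverse (T := T) hZ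
  have h1 {P : Prop} [Decidable P] : ρ₂ * (if P then ρ₁ else 0) = if P then ρ₁ * ρ₂ else 0 := by
    split_ifs
    · exact mul_comm _ _
    · exact mul_zero _
  have h2 {P : Prop} [Decidable P] : ρ₁ * (if P then ρ₂ else 0) = if P then ρ₁ * ρ₂ else 0 := by
    split_ifs
    · rfl
    · exact mul_zero _
  refine ⟨⟨I, J, ρ₁ * ρ₂, fun i j => ρ₂ * K i j, fun α i => ρ₁ * W α i, mul_mem hρ₁ hρ₂,
    fun i j h => by rw [hK0 i j h, mul_zero], fun α i h => by rw [hW0 α i h, mul_zero], ?_, ?_,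
    ?_, ?_, regular_of_linearIndepOn hI⟩⟩
  · intro i hi hi1 i'
    simp only [mul_assoc, ← Finset.mul_sum, hK1 i hi hi1, h1]
  · intro j hj j' hj'
    simp only [mul_left_comm _ ρ₂, ← Finset.mul_sum, hK2 j hj j' hj', h1]
  · intro α β
    simp only [mul_assoc, ← Finset.mul_sum, hW1, h2]
  · intro i hi i' hi'
    simp only [mul_left_comm _ ρ₁, ← Finset.mul_sum, hW2 i hi i' hi', h2]

end GaugeTheory

end

/-! ### The leading part of the differential at a point of the stationary surface -/

section Eps

variable {M : Type*} [AddCommGroup M]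

theorem sum_eps_smul_sum_eps (a e : Fin 3) (X : Fin 3 → M) :
    ∑ c, eps c a e • ∑ e', eps c a e' • X e' = if e = a then 0 else X e := by
  fin_cases a <;> fin_cases e <;> simp [eps, Fin.sum_univ_three]

theorem sum_eps_smul_sum_eps_first (a c : Fin 3) (X : Fin 3 → M) :
    ∑ e, eps c a e • ∑ c', eps c' a e • X c' = if c = a then 0 else X c := by
  fin_cases a <;> fin_cases c <;> simp [eps, Fin.sum_univ_three]

theorem sum_eps_smul_sum_eps_middle (a d : Fin 3) (X : Fin 3 → M) :
    ∑ e, eps a e d • ∑ c, eps a e c • X c = if d = a then 0 else X d := by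
  fin_cases a <;> fin_cases d <;> simp [eps, Fin.sum_univ_three]

theorem sum_eps_smul_sum_eps_last (a e : Fin 3) (X : Fin 3 → M) :
    ∑ c, eps a e c • ∑ e', eps a e' c • X e' = if e = a then 0 else X e := by
  fin_cases a <;> fin_cases e <;> simp [eps, Fin.sum_univ_three]

end Eps

section Coeff

variable {ι₀ ι₁ : Type*} [Fintype ι₀] {p₀ : ι₀ → ZMod 2} {p₁ : ι₁ → ZMod 2}

theorem coeff_mon (l : List {i : ι₀ // p₀ i = 1}) :
    coeff p₀ p₁ (mon _ _ l) = mon _ _ (l.map Gen.odd) := by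
  induction l with
  | nil => simp
  | cons i l ih => rw [mon_cons, map_mul, coeff_gen, ih, List.map_cons, mon_cons]; rfl

/-- The words of at least two letters do not contribute to the bodies of first derivatives. -/
theorem aug_pd_mon_cons_cons {B : Type*} [CommRing B] {G : Type*} {p : G → ZMod 2} (j g g' : G)
    (l : List G) : aug B p (pd B p j (mon B p (g :: g' :: l))) = 0 := by
  rw [mon_cons g, isRightDer_pd j, tw_mon, map_add, map_mul (aug B p), map_mul (aug B p), aug_gen,
    map_zsmul, mon_cons g', map_mul (aug B p), aug_gen, zero_mul, zero_mul, smul_zero, mul_zero,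
    add_zero]

variable {v : Gen p₀ ι₁ → ℤ}

omit [Fintype ι₀] in
theorem sum_odd_nonneg (hv : ∀ i, 1 ≤ v (.odd i)) (l : List {i : ι₀ // p₀ i = 1}) :
    0 ≤ ((l.map Gen.odd).map v).sum := by
  refine List.sum_nonneg ?_
  intro x hx
  rw [List.map_map] at hx
  obtain ⟨i, -, rfl⟩ := List.mem_map.1 hx
  exact le_trans zero_le_one (hv i)

theorem coeff_mem_Ici_zero (hv : ∀ i, 1 ≤ v (.odd i)) (F : FieldAlg p₀) :
    coeff p₀ p₁ F ∈ wspan (Smooth p₀) (Gen.parity p₀ p₁) v (Set.Ici 0) := by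
  refine wspan_induction (w := fun _ => (0 : ℤ))
    (N := (wspan (Smooth p₀) (Gen.parity p₀ p₁) v (Set.Ici 0)).comap
      (coeff p₀ p₁).toLinearMap) (fun l _ => ?_) (mem_wspan_univ _ _ _ F)
  rw [Submodule.mem_comap, AlgHom.toLinearMap_apply, coeff_mon]
  exact mon_mem_wspan (sum_odd_nonneg hv l)

theorem coeff_sub_body_mem (hv : ∀ i, 1 ≤ v (.odd i)) (F : FieldAlg p₀) :
    coeff p₀ p₁ F - algebraMap _ _ (body p₀ F) ∈
      wspan (Smooth p₀) (Gen.parity p₀ p₁) v (Set.Ici 1) := by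
  refine wspan_induction (w := fun _ => (0 : ℤ))
    (N := (wspan (Smooth p₀) (Gen.parity p₀ p₁) v (Set.Ici 1)).comap
      ((coeff p₀ p₁).toLinearMap - Algebra.linearMap _ _ ∘ₗ (body p₀).toLinearMap))
    (fun l _ => ?_) (mem_wspan_univ _ _ _ F)
  rw [Submodule.mem_comap]
  simp only [LinearMap.sub_apply, LinearMap.comp_apply, AlgHom.toLinearMap_apply,
    Algebra.linearMap_apply, coeff_mon]
  cases l with
  | nil => simp
  | cons i l =>
    rw [mon_cons, map_mul, body_eq_aug, aug_gen, zero_mul, map_zero, sub_zero]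
    refine mon_mem_wspan ?_
    have := sum_odd_nonneg hv l
    have := hv i
    simp only [List.map_cons, List.sum_cons, Set.mem_Ici]
    omega

open Classical in
/-- An odd superfunction, up to terms of order two, when the odd fields outside `J` have order
two. -/
theorem coeff_sub_linear_mem (hv : ∀ i, 1 ≤ v (.odd i)) {J : Set {i : ι₀ // p₀ i = 1}}
    (hJ : ∀ i ∉ J, v (.odd i) = 2) {F : FieldAlg p₀} (hF : F ∈ parityPart (Smooth p₀) _ 1) :
    coeff p₀ p₁ F - ∑ j, (if j ∈ J then body p₀ (pd _ _ j F) • Alg.of p₀ p₁ (.odd j) else 0) ∈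
      wspan (Smooth p₀) (Gen.parity p₀ p₁) v (Set.Ici 2) := by
  let N := wspan (Smooth p₀) (Gen.parity p₀ p₁) v (Set.Ici 2)
  induction hF using Submodule.span_induction with
  | zero =>
    rw [map_zero, Finset.sum_eq_zero fun j _ => by rw [map_zero, map_zero, zero_smul, ite_self],
      sub_zero]
    exact zero_mem _
  | add F F' _ _ h h' =>
    have h2 := add_mem h h'
    rw [sub_add_sub_comm, ← map_add, ← Finset.sum_add_distrib] at h2
    convert h2 using 3 with j
    rw [map_add, map_add, add_smul]
    split_ifs <;> simp
  | smul b F _ h =>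
    have h2 := Submodule.smul_mem _ b h
    rw [smul_sub, ← map_smul, Finset.smul_sum] at h2
    convert h2 using 3 with j
    rw [map_smul, map_smul, smul_assoc]
    split_ifs <;> simp
  | mem F hF =>
    obtain ⟨l, hl, rfl⟩ := hF
    change coeff p₀ p₁ (mon _ _ l) - ∑ j, (if j ∈ J then
      body p₀ (pd _ _ j (mon _ _ l)) • Alg.of p₀ p₁ (.odd j) else 0) ∈ _
    rw [coeff_mon]
    cases l with
    | nil => simp at hl
    | cons i l =>
      cases l with
      | nil =>
        have e (j : {i : ι₀ // p₀ i = 1}) : (if j ∈ J then body p₀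
            (pd _ _ j (mon (Smooth p₀) (fun i : {i : ι₀ // p₀ i = 1} => p₀ i) [i])) •
              Alg.of p₀ p₁ (.odd j) else 0) =
            if j = i then (if i ∈ J then Alg.of p₀ p₁ (.odd i) else 0) else 0 := by
          rw [mon_singleton, pd_gen]
          by_cases h : i = j
          · subst h; simp
          · simp [h, Ne.symm h]
        rw [Finset.sum_congr rfl fun j _ => e j, Finset.sum_ite_eq' Finset.univ i,
          if_pos (Finset.mem_univ i), List.map_cons, List.map_nil, mon_singleton]
        split_ifs with h
        · have : gen (Smooth p₀) (Gen.parity p₀ p₁) (Gen.odd i) -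
            Alg.of p₀ p₁ (.odd i) = 0 := sub_self _
          rw [this]
          exact zero_mem _
        · rw [sub_zero]
          exact gen_mem_wspan (by rw [hJ i h]; exact Set.mem_Ici.2 le_rfl)
      | cons i' l =>
        rw [Finset.sum_eq_zero fun j _ => by
          rw [body_eq_aug, aug_pd_mon_cons_cons, zero_smul, ite_self], sub_zero]
        refine mon_mem_wspan ?_
        have := sum_odd_nonneg hv l
        have := hv i
        have := hv i'
        simp only [List.map_cons, List.sum_cons, Set.mem_Ici]
        omega

end Coeff

namespace GaugeTheory

variable {ι₀ ι₁ : Type*} [Fintype ι₀] [DecidableEq ι₀] {p₀ : ι₀ → ZMod 2} {p₁ : ι₁ → ZMod 2}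
  {T : GaugeTheory p₀ p₁}

theorem derivR_eq_pd (j : {i : ι₀ // p₀ i = 1}) (F : FieldAlg p₀) :
    derivR p₀ j F = pd _ _ j F := by
  have h : p₀ j ≠ 0 := by rw [j.2]; decide
  rw [derivR, dif_neg h]
  have h1 := isRightDer_pd (B := Smooth p₀) (p := fun i : {i : ι₀ // p₀ i = 1} => p₀ i) j
  simp only [j.2] at h1
  refine LinearMap.congr_fun ((isRightDer_rightDer _ _).ext h1 fun i => ?_) F
  rw [rightDer_gen, pd_gen]
  simp only [Subtype.ext_iff]

/-- Left and right derivatives of the action differ by a sign, as the action is even. -/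
theorem derivL_S₀ (i : ι₀) : derivL p₀ i T.S₀ = sgn (p₀ i) • derivR p₀ i T.S₀ := by
  unfold derivL
  split_ifs with h
  · rw [h, sgn_zero, one_smul]
  · exact parityAut_of_mem (derivR_S₀_mem i)

namespace ShellData

variable [Fintype ι₁] [DecidableEq ι₁] {x : Body p₀} (d : T.ShellData x) (a : Fin 3)

open Classical in
/-- The leading terms of the values of `δ_a` on the antifields of type `a`: the even field equations
in `I` at vanishing odd fields, the linear terms of the odd ones, the bodies of the gauge generators
in the rows outside `I`, and the antifields of type `a` in the sources of those of `π_c` and `λ`. -/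
def leadSource : Field ι₀ ι₁ → Alg p₀ p₁
  | .phi i => if i ∈ d.I then
      (if p₀ i = 0 then algebraMap _ _ (-T.bodyEq i)
        else ∑ j, if j ∈ d.J then T.hess j i • Alg.of p₀ p₁ (.odd j) else 0)
      else 0
  | .eta c α => if c = a then
      sgn (p₁ α) • ∑ i, (if i ∈ d.I then 0 else T.bodyZ i α • Alg.of p₀ p₁ (.star a (.phi i)))
      else 0
  | .pi c α => sgn (p₁ α + 1) • ∑ e, eps c a e • Alg.of p₀ p₁ (.star a (.eta e α))
  | .lam α => sgn (p₁ α + 1) • Alg.of p₀ p₁ (.star a (.pi a α))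

/-- The leading terms of the values of `δ_a`. -/
def leadVal : Gen p₀ ι₁ → Alg p₀ p₁
  | .odd _ => 0
  | .ghost _ => 0
  | .star b A => if b = a then d.leadSource a A else 0
  | .bar b A => T.deltaVal a (.bar b A)
  | .tilde A => T.deltaVal a (.tilde A)

/-- The values of the contraction on the antifields of type `a`: inverses, up to the factor `ρ`, of
the pairings in `leadSource`. -/
def contrSource : Field ι₀ ι₁ → Alg p₀ p₁
  | .phi i => ∑ α, sgn (p₁ α) • d.W α i • Alg.of p₀ p₁ (.star a (.eta a α))
  | .eta e α => sgn (p₁ α + 1) • d.ρ • ∑ c, eps c a e • Alg.of p₀ p₁ (.star a (.pi c α))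
  | .pi c α => if c = a then sgn (p₁ α + 1) • d.ρ • Alg.of p₀ p₁ (.star a (.lam α)) else 0
  | .lam _ => 0

/-- The values of the contraction of the leading part of `δ_a`. -/
def contrVal : Gen p₀ ι₁ → Alg p₀ p₁
  | .odd j => ∑ i, d.K i j • Alg.of p₀ p₁ (.star a (.phi i))
  | .ghost _ => 0
  | .star b A => if b = a then d.contrSource a A
      else sgn (A.parity p₀ p₁) • d.ρ • ∑ e, eps a e b • Alg.of p₀ p₁ (.bar e A)
  | .bar b A => if b = a then sgn (A.parity p₀ p₁ + 1) • d.ρ • Alg.of p₀ p₁ (.tilde A) else 0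
  | .tilde _ => 0

open Classical in
/-- The order of the antifields of type `a`, see `order`. The antifields of the fields outside `I`
have order `-1`, which puts their field equations among the terms of higher order. -/
def orderSource : Field ι₀ ι₁ → ℤ
  | .phi i => if i ∈ d.I then (if p₀ i = 0 then 0 else 1) else -1
  | .eta c _ => if c = a then -1 else 0
  | .pi _ _ => 0
  | .lam _ => 0

open Classical in
/-- The order of the generators in the filtration that defines the leading part of `δ_a`. The odd
fields outside `J` have order two, so that of the terms linear in the odd fields only those with
`J` are leading. -/
def order : Gen p₀ ι₁ → ℤ
  | .odd j => if j ∈ d.J then 1 else 2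
  | .ghost _ => 0
  | .star b A => if b = a then d.orderSource a A else 1
  | .bar _ _ => 1
  | .tilde _ => 1

/-- The generators that the leading part of `δ_a` neither changes nor produces. -/
def inert : Set (Gen p₀ ι₁) := {g | (∃ j ∉ d.J, g = .odd j) ∨ ∃ c, g = .ghost c}

/-- The antifields of the even field equations that form a regular sequence. -/
def koszulGen (i : {i : ι₀ // i ∈ d.I ∧ p₀ i = 0}) : Gen p₀ ι₁ := .star a (.phi i)

open Classical in
/-- The generators that the contraction removes: all but the inert ones and those of the Koszul
complex. -/
def count (g : Gen p₀ ι₁) : ℤ := if g ∈ d.inert ∨ g ∈ Set.range (d.koszulGen a) then 0 else 1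

open Classical in
/-- All gradings of the leading part of `δ_a`: the order, the resolution degree, the number of
generators that the contraction removes, the number of inert generators, and the parity. -/
def weight (g : Gen p₀ ι₁) : ℤ × ℤ × ℤ × ℤ × ZMod 2 :=
  (d.order a g, g.res, d.count a g, if g ∈ d.inert then 1 else 0, g.parity p₀ p₁)

end ShellData

end GaugeTheory

/-- The total ghost degrees of fields and ghosts. -/
def Field.deg {ι₀ ι₁ : Type*} : Field ι₀ ι₁ → ℤ
  | .phi _ => 0
  | .eta _ _ => 1
  | .pi _ _ => 2
  | .lam _ => 3

section Res

variable {ι₀ ι₁ : Type*} {p₀ : ι₀ → ZMod 2}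

theorem sum_ite_eq_two (b : Fin 3) : ∑ c : Fin 3, (if c = b then 0 else 1) = 2 := by
  revert b; decide

theorem Field.sum_trigh (A : Field ι₀ ι₁) : ((∑ c, A.trigh c : ℕ) : ℤ) = A.deg := by
  cases A with
  | phi i => simp [Field.trigh, Field.deg]
  | eta c α => simp [Field.trigh, Field.deg]
  | pi c α =>
    simp only [Field.trigh, sum_ite_eq_two, Field.deg]
    rfl
  | lam α => simp [Field.trigh, Field.deg]

theorem Gen.res_star (b : Fin 3) (A : Field ι₀ ι₁) :
    ((Gen.star b A : Gen p₀ ι₁).res : ℤ) = A.deg + 1 := by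
  rw [← Field.sum_trigh]
  simp [Gen.res, Gen.trires, Finset.sum_add_distrib]

theorem Gen.res_bar (b : Fin 3) (A : Field ι₀ ι₁) :
    ((Gen.bar b A : Gen p₀ ι₁).res : ℤ) = A.deg + 2 := by
  rw [← Field.sum_trigh]
  simp only [Gen.res, Gen.trires, Finset.sum_add_distrib, sum_ite_eq_two]
  push_cast
  rfl

theorem Gen.res_tilde (A : Field ι₀ ι₁) :
    ((Gen.tilde A : Gen p₀ ι₁).res : ℤ) = A.deg + 3 := by
  rw [← Field.sum_trigh]
  simp [Gen.res, Gen.trires, Finset.sum_add_distrib]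

theorem Gen.res_odd (j : {i : ι₀ // p₀ i = 1}) : ((Gen.odd j : Gen p₀ ι₁).res : ℤ) = 0 := by
  simp [Gen.res, Gen.trires]

theorem Gen.res_ghost (c : Ghost ι₁) : ((Gen.ghost c : Gen p₀ ι₁).res : ℤ) = 0 := by
  simp [Gen.res, Gen.trires]

theorem smul_gen_mem_wspan {B : Type*} [CommRing B] {G : Type*} {p : G → ZMod 2} {M : Type*}
    [AddCommMonoid M] {w : G → M} {U : Set M} {g : G} {b : B} (h : b ≠ 0 → w g ∈ U) :
    b • gen B p g ∈ wspan B p w U := by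
  by_cases hb : b = 0
  · rw [hb, zero_smul]; exact zero_mem _
  · exact Submodule.smul_mem _ _ (gen_mem_wspan (h hb))

theorem zmod_two_add_add (c : ZMod 2) : c + 1 + 1 = c := by revert c; decide

theorem ne_of_eps_ne_zero {a b c : Fin 3} (h : eps a b c ≠ 0) : b ≠ a ∧ c ≠ a ∧ c ≠ b := by
  revert a b c; decide

end Res

namespace GaugeTheory

variable {ι₀ ι₁ : Type*} [Fintype ι₀] [DecidableEq ι₀] {p₀ : ι₀ → ZMod 2} {p₁ : ι₁ → ZMod 2}
  {T : GaugeTheory p₀ p₁}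

namespace ShellData

variable [Fintype ι₁] [DecidableEq ι₁] {x : Body p₀} (d : T.ShellData x) (a : Fin 3)

theorem odd_mem_inert {j : {i : ι₀ // p₀ i = 1}} : (.odd j : Gen p₀ ι₁) ∈ d.inert ↔ j ∉ d.J := by
  simp only [inert, Set.mem_ofPred_eq, Gen.odd.injEq, reduceCtorEq, exists_false, or_false]
  constructor
  · rintro ⟨_, h, rfl⟩; exact h
  · exact fun h => ⟨j, h, rfl⟩

theorem ghost_mem_inert (c : Ghost ι₁) : (.ghost c : Gen p₀ ι₁) ∈ d.inert := by
  simp [inert]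

theorem star_notMem_inert (b : Fin 3) (A : Field ι₀ ι₁) :
    (.star b A : Gen p₀ ι₁) ∉ d.inert := by
  simp [inert]

theorem bar_notMem_inert (b : Fin 3) (A : Field ι₀ ι₁) :
    (.bar b A : Gen p₀ ι₁) ∉ d.inert := by
  simp [inert]

theorem tilde_notMem_inert (A : Field ι₀ ι₁) : (.tilde A : Gen p₀ ι₁) ∉ d.inert := by
  simp [inert]

theorem star_mem_range {b : Fin 3} {A : Field ι₀ ι₁} :
    .star b A ∈ Set.range (d.koszulGen a) ↔ b = a ∧ ∃ i, A = .phi i ∧ i ∈ d.I ∧ p₀ i = 0 := by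
  simp only [koszulGen, Set.mem_range, Gen.star.injEq, Subtype.exists]
  constructor
  · rintro ⟨i, hi, rfl, rfl⟩
    exact ⟨rfl, i, rfl, hi⟩
  · rintro ⟨rfl, i, rfl, hi⟩
    exact ⟨i, hi, rfl, rfl⟩

open Classical in
theorem count_star (b : Fin 3) (A : Field ι₀ ι₁) : d.count a (.star b A) =
    if b = a ∧ ∃ i, A = .phi i ∧ i ∈ d.I ∧ p₀ i = 0 then 0 else 1 := by
  simp only [count, star_notMem_inert, false_or, star_mem_range]

open Classical in
theorem count_odd (j : {i : ι₀ // p₀ i = 1}) :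
    d.count a (.odd j : Gen p₀ ι₁) = if j ∈ d.J then 1 else 0 := by
  simp only [count, odd_mem_inert, koszulGen, Set.mem_range, reduceCtorEq, exists_false, or_false,
    ite_not]

theorem count_ghost (c : Ghost ι₁) : d.count a (.ghost c) = 0 :=
  if_pos (Or.inl (d.ghost_mem_inert c))

theorem count_bar (b : Fin 3) (A : Field ι₀ ι₁) : d.count a (.bar b A) = 1 := by
  simp [count, bar_notMem_inert, koszulGen]

theorem count_tilde (A : Field ι₀ ι₁) : d.count a (.tilde A) = 1 := by
  simp [count, tilde_notMem_inert, koszulGen]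

/-- The leading part of `δ_a` preserves the order, the numbers of generators of the two types, and
lowers the resolution degree. -/
theorem leadVal_mem (g : Gen p₀ ι₁) : d.leadVal a g ∈
    wspan (Smooth p₀) (Gen.parity p₀ p₁) (d.weight a) {d.weight a g + (0, -1, 0, 0, 1)} := by
  classical
  cases g with
  | odd j => exact zero_mem _
  | ghost c => exact zero_mem _
  | star b A =>
    simp only [leadVal]
    split_ifs with hb
    swap
    · exact zero_mem _
    subst hb
    cases A with
    | phi i =>
      simp only [leadSource]
      split_ifs with hi h0
      · rw [Algebra.algebraMap_eq_smul_one]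
        refine Submodule.smul_mem _ _ (one_mem_wspan ?_)
        simp [weight, order, orderSource, count_star, Gen.res_star, Field.deg, star_notMem_inert,
          hi, h0, Gen.parity, Field.parity, show (1 + 1 : ZMod 2) = 0 from rfl]
        rfl
      · refine sum_mem fun j _ => ?_
        split_ifs with hj
        · refine smul_gen_mem_wspan fun _ => ?_
          have h1 := eq_one_of_ne_zero h0
          simp [weight, order, orderSource, count_star, count_odd, Gen.res_star, Field.deg,
            star_notMem_inert, odd_mem_inert, hi, hj, h1, j.2, Gen.parity, Field.parity,
            zmod_two_add_add, Gen.res_odd]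
        · exact zero_mem _
      · exact zero_mem _
    | eta c α =>
      simp only [leadSource]
      split_ifs with hc
      swap
      · exact zero_mem _
      refine zsmul_mem (sum_mem fun i _ => ?_) _
      split_ifs with hi
      · exact zero_mem _
      · refine smul_gen_mem_wspan fun h => ?_
        have h1 : p₀ i = p₁ α := by
          by_contra h1
          exact h (bodyZ_eq_zero h1)
        simp [weight, order, orderSource, count_star, Gen.res_star, Field.deg, star_notMem_inert,
          hi, hc, h1, Gen.parity, Field.parity, zmod_two_add_add]
    | pi c α =>
      refine zsmul_mem (sum_mem fun e _ => zsmul_of_mem_wspan _ fun h => ?_) _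
      have := (ne_of_eps_ne_zero h).2.2
      simp [weight, order, orderSource, count_star, Gen.res_star, Field.deg, star_notMem_inert,
        this, Gen.parity, Field.parity]
    | lam α =>
      refine zsmul_mem (gen_mem_wspan ?_) _
      simp [weight, order, orderSource, count_star, Gen.res_star, Field.deg, star_notMem_inert,
        Gen.parity, Field.parity, zmod_two_add_add]
  | bar b A =>
    refine zsmul_mem (sum_mem fun c _ => zsmul_of_mem_wspan _ fun h => ?_) _
    have := (ne_of_eps_ne_zero h).2.1
    simp [weight, order, count_star, count_bar, Gen.res_star, Gen.res_bar, star_notMem_inert,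
      bar_notMem_inert, this, Gen.parity]
    ring
  | tilde A =>
    refine zsmul_mem (gen_mem_wspan (U := {_}) ?_) _
    simp [weight, order, count_tilde, count_bar, Gen.res_tilde, Gen.res_bar, tilde_notMem_inert,
      bar_notMem_inert, Gen.parity, zmod_two_add_add]
    ring

theorem contrVal_mem (g : Gen p₀ ι₁) :
    d.contrVal a g ∈ parityPart (Smooth p₀) (Gen.parity p₀ p₁) (g.parity p₀ p₁ + 1) := by
  rw [parityPart, weightPart_eq_wspan]
  cases g with
  | odd j =>
    refine sum_mem fun i _ => smul_gen_mem_wspan fun h => ?_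
    have h1 : p₀ i = 1 := by
      by_contra h1
      exact h (d.K_eq_zero i j fun h' => h1 h'.2.1)
    simp [Gen.parity, Field.parity, h1, j.2]
  | ghost c => exact zero_mem _
  | star b A =>
    simp only [contrVal]
    split_ifs with hb
    · cases A with
      | phi i =>
        refine sum_mem fun α _ => zsmul_mem (smul_gen_mem_wspan fun h => ?_) _
        have h1 : p₀ i = p₁ α := by
          by_contra h1
          exact h (d.W_eq_zero α i fun h' => h1 h'.2)
        simp [Gen.parity, Field.parity, h1]
      | eta e α =>
        refine zsmul_mem (Submodule.smul_mem _ _ (sum_mem fun c _ =>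
          zsmul_of_mem_wspan _ fun _ => ?_)) _
        simp [Gen.parity, Field.parity, zmod_two_add_add]
      | pi c α =>
        simp only [contrSource]
        split_ifs
        · refine zsmul_mem (Submodule.smul_mem _ _ (gen_mem_wspan ?_)) _
          simp [Gen.parity, Field.parity]
        · exact zero_mem _
      | lam α => exact zero_mem _
    · refine zsmul_mem (Submodule.smul_mem _ _ (sum_mem fun c _ =>
        zsmul_of_mem_wspan _ fun _ => ?_)) _
      simp [Gen.parity, zmod_two_add_add]
  | bar b A =>
    simp only [contrVal]
    split_ifs
    · exact zsmul_mem (Submodule.smul_mem _ _ (gen_mem_wspan (by simp [Gen.parity]))) _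
    · exact zero_mem _
  | tilde A => exact zero_mem _

end ShellData

end GaugeTheory

namespace GaugeTheory

variable {ι₀ ι₁ : Type*} [Fintype ι₀] [DecidableEq ι₀] {p₀ : ι₀ → ZMod 2} {p₁ : ι₁ → ZMod 2}
  {T : GaugeTheory p₀ p₁}

/-! ### The filtration -/

theorem body_pd_derivR (j : {i : ι₀ // p₀ i = 1}) (i : ι₀) :
    body p₀ (pd _ _ j (derivR p₀ i T.S₀)) = T.hess j i := by
  rw [hess, body_derivL, derivR_eq_pd]

namespace ShellData

variable [Fintype ι₁] [DecidableEq ι₁] {x : Body p₀} (d : T.ShellData x) (a : Fin 3)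

theorem one_le_order_odd (j : {i : ι₀ // p₀ i = 1}) : 1 ≤ d.order a (.odd j : Gen p₀ ι₁) := by
  simp only [order]
  split_ifs <;> norm_num

theorem of_mul_coeff_mem {g : Gen p₀ ι₁} {k : ℤ} (h : k ≤ d.order a g) (F : FieldAlg p₀) :
    Alg.of p₀ p₁ g * coeff p₀ p₁ F ∈
      wspan (Smooth p₀) (Gen.parity p₀ p₁) (d.order a) (Set.Ici k) := by
  refine mul_mem_wspan (U := Set.Ici k) (U' := Set.Ici 0) ?_ (gen_mem_wspan h)
    (coeff_mem_Ici_zero (d.one_le_order_odd a) F)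
  intro u hu u' hu'
  simp only [Set.mem_Ici] at *
  omega

theorem contractZ_mem_order {y : ι₀ → Gen p₀ ι₁} (hy : ∀ i, 1 ≤ d.order a (y i)) (α : ι₁) :
    T.contractZ y α ∈ wspan (Smooth p₀) (Gen.parity p₀ p₁) (d.order a) (Set.Ici 1) :=
  sum_mem fun i _ => d.of_mul_coeff_mem a (hy i) _

/-- The leading part of `δ_a` consists of its terms of lowest order: the differences have higher
order. -/
theorem deltaVal_sub_leadVal_mem (g : Gen p₀ ι₁) : T.deltaVal a g - d.leadVal a g ∈
    wspan (Smooth p₀) (Gen.parity p₀ p₁) (d.order a) (Set.Ici (d.order a g + 1)) := by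
  classical
  have hodd := d.one_le_order_odd a
  have hstar (b : Fin 3) (hb : b ≠ a) (A : Field ι₀ ι₁) : d.order a (.star b A) = 1 := if_neg hb
  cases g with
  | odd j =>
    rw [show T.deltaVal a (.odd j) - d.leadVal a (.odd j) = 0 from sub_zero 0]; exact zero_mem _
  | ghost c =>
    rw [show T.deltaVal a (.ghost c) - d.leadVal a (.ghost c) = 0 from sub_zero 0]; exact zero_mem _
  | bar b A => rw [leadVal, sub_self]; exact zero_mem _
  | tilde A => rw [leadVal, sub_self]; exact zero_mem _
  | star b A =>
    simp only [leadVal, deltaVal, eq_comm (a := a), order]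
    split_ifs with hb
    swap
    · rw [sub_zero]; exact zero_mem _
    subst hb
    cases A with
    | phi i =>
      simp only [source, leadSource, orderSource]
      split_ifs with hi h0
      · have h := neg_mem (coeff_sub_body_mem (p₁ := p₁) hodd (derivL p₀ i T.S₀))
        rw [body_derivL, neg_sub, ← neg_add_eq_sub] at h
        rw [map_neg, sub_neg_eq_add]
        exact h
      · have h1 := eq_one_of_ne_zero h0
        have h := coeff_sub_linear_mem (p₁ := p₁) hodd (J := d.J)
          (fun j hj => if_neg hj) (h1 ▸ derivR_S₀_mem (T := T) i)
        rw [derivL_S₀, h1, sgn_one, neg_one_smul, map_neg, neg_neg]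
        simp only [body_pd_derivR] at h
        exact h
      · rw [sub_zero]
        exact neg_mem (coeff_mem_Ici_zero hodd _)
    | eta c α =>
      simp only [source, leadSource, orderSource]
      split_ifs with hc
      · subst hc
        rw [← smul_sub, contractZ, ← Finset.sum_sub_distrib]
        refine zsmul_mem (sum_mem fun i _ => ?_) _
        split_ifs with hi
        · rw [sub_zero]
          refine d.of_mul_coeff_mem _ ?_ _
          simp only [order, orderSource, if_pos hi, if_true]
          split_ifs <;> norm_num
        · have e : Alg.of p₀ p₁ (.star c (.phi i)) * coeff p₀ p₁ (T.Z i α) -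
              T.bodyZ i α • Alg.of p₀ p₁ (.star c (.phi i)) = Alg.of p₀ p₁ (.star c (.phi i)) *
                (coeff p₀ p₁ (T.Z i α) - algebraMap _ _ (body p₀ (T.Z i α))) := by
            rw [mul_sub, ← Algebra.commutes, ← Algebra.smul_def]
            rfl
          rw [e]
          refine mul_mem_wspan (U := {-1}) (U' := Set.Ici 1) ?_ (gen_mem_wspan ?_)
            (coeff_sub_body_mem hodd _)
          · rintro _ rfl u hu
            simp only [Set.mem_Ici] at *
            omega
          · simp [order, orderSource, hi]
      · rw [sub_zero]
        exact zsmul_mem (d.contractZ_mem_order b (fun i => (hstar c hc _).ge) α) _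
    | pi c α =>
      simp only [source, leadSource, orderSource]
      rw [← smul_sub, add_sub_right_comm, ← Finset.sum_erase_eq_sub (Finset.mem_univ b)]
      refine zsmul_mem (add_mem (sum_mem fun e he => sum_mem fun f _ => zsmul_mem
        (gen_mem_wspan ?_) _) (d.contractZ_mem_order b (fun i => le_rfl) α)) _
      exact (hstar e (Finset.ne_of_mem_erase he) _).ge
    | lam α =>
      simp only [source, leadSource, orderSource]
      rw [← smul_sub, Finset.sum_add_distrib, sub_right_comm, add_sub_right_comm,
        ← Finset.sum_erase_eq_sub (Finset.mem_univ b)]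
      have h1 : ∑ e ∈ Finset.univ.erase b, Alg.of p₀ p₁ (.star e (.pi e α)) ∈
          wspan (Smooth p₀) (Gen.parity p₀ p₁) (d.order b) (Set.Ici (0 + 1)) :=
        sum_mem fun e he => gen_mem_wspan (hstar e (Finset.ne_of_mem_erase he) _).ge
      have h2 : ∑ e, Alg.of p₀ p₁ (.bar e (.eta e α)) ∈
          wspan (Smooth p₀) (Gen.parity p₀ p₁) (d.order b) (Set.Ici (0 + 1)) :=
        sum_mem fun e _ => gen_mem_wspan (w := d.order b) (g := .bar e (.eta e α))
          (Set.mem_Ici.2 (le_refl (1:ℤ)))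
      have h3 : T.contractZ (fun i => .tilde (.phi i)) α ∈
          wspan (Smooth p₀) (Gen.parity p₀ p₁) (d.order b) (Set.Ici (0 + 1)) :=
        d.contractZ_mem_order b (fun i => le_rfl) α
      exact zsmul_mem (sub_mem (add_mem h1 h2) h3) _

/-- The degrees of the leading part of `δ_a` with respect to a component `f` of `weight`. -/
theorem leadVal_mem_comp {M : Type*} [AddCommMonoid M] (f : ℤ × ℤ × ℤ × ℤ × ZMod 2 →+ M)
    (g : Gen p₀ ι₁) : d.leadVal a g ∈ wspan (Smooth p₀) (Gen.parity p₀ p₁)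
      (fun g => f (d.weight a g)) {f (d.weight a g) + f (0, -1, 0, 0, 1)} := by
  rw [wspan_comp]
  refine wspan_mono ?_ (d.leadVal_mem a g)
  rintro _ rfl
  rw [Set.mem_preimage, map_add]
  rfl

theorem leadVal_mem_parity (g : Gen p₀ ι₁) :
    d.leadVal a g ∈ parityPart (Smooth p₀) (Gen.parity p₀ p₁) (g.parity p₀ p₁ + 1) :=
  d.leadVal_mem_comp a
    ⟨⟨fun u : ℤ × ℤ × ℤ × ℤ × ZMod 2 => u.2.2.2.2, rfl⟩, fun _ _ => rfl⟩ g

/-- The leading part of `δ_a`. -/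
def lead : Alg p₀ p₁ →ₗ[Smooth p₀] Alg p₀ p₁ := rightDer (d.leadVal a) (d.leadVal_mem_parity a)

/-- The contraction of the leading part of `δ_a`. -/
def contr : Alg p₀ p₁ →ₗ[Smooth p₀] Alg p₀ p₁ := rightDer (d.contrVal a) (d.contrVal_mem a)

theorem lead_of (g : Gen p₀ ι₁) : d.lead a (Alg.of p₀ p₁ g) = d.leadVal a g := rightDer_gen _ _ g

theorem contr_of (g : Gen p₀ ι₁) : d.contr a (Alg.of p₀ p₁ g) = d.contrVal a g := rightDer_gen _ _ g

/-- The order is bounded by the number of odd fields and the resolution degree. -/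
theorem order_le (g : Gen p₀ ι₁) : d.order a g ≤ 2 * g.oddCount + g.res := by
  have hdeg (A : Field ι₀ ι₁) : 0 ≤ A.deg := by cases A <;> simp [Field.deg]
  cases g with
  | odd j =>
    simp only [order, Gen.oddCount, Gen.res_odd]
    split_ifs <;> norm_num
  | ghost c => simp [order, Gen.oddCount]
  | star b A =>
    have h1 := hdeg A
    have h2 : d.order a (.star b A) ≤ 1 := by
      cases A <;> simp only [order, orderSource] <;> split_ifs <;> norm_num
    simp only [Gen.oddCount, Gen.res_star]
    omega
  | bar b A =>
    have h1 := hdeg A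
    simp only [order, Gen.oddCount, Gen.res_bar]
    omega
  | tilde A =>
    have h1 := hdeg A
    simp only [order, Gen.oddCount, Gen.res_tilde]
    omega

/-- The filtration is bounded above in each resolution degree, as the odd fields are finite in
number. -/
theorem wspan_order_res_eq_bot (m : ℤ) :
    wspan (Smooth p₀) (Gen.parity p₀ p₁) (fun g : Gen p₀ ι₁ => (d.order a g, (g.res : ℤ)))
      {u | 2 * (Fintype.card ι₀ : ℤ) + m < u.1 ∧ u.2 = m} = ⊥ := by
  rw [eq_bot_iff]
  intro y hy
  refine wspan_induction (fun l hl => ?_) hy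
  have hsum (l : List (Gen p₀ ι₁)) :
      (l.map fun g : Gen p₀ ι₁ => (d.order a g, (g.res : ℤ))).sum =
        ((l.map (d.order a)).sum, (l.map fun g => (g.res : ℤ)).sum) ∧
      (l.map (d.order a)).sum ≤
        2 * (l.map Gen.oddCount).sum + (l.map fun g => (g.res : ℤ)).sum := by
    induction l with
    | nil => exact ⟨rfl, le_rfl⟩
    | cons g l ih =>
      have := d.order_le a g
      simp only [List.map_cons, List.sum_cons, ih.1]
      refine ⟨rfl, ?_⟩
      have := ih.2
      omega
  rw [(hsum l).1] at hl
  obtain ⟨h1, h2⟩ := hl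
  have := (hsum l).2
  simp only at h1 h2
  rw [mon_eq_zero_of_oddCount (by omega)]
  exact zero_mem _

/-- The contraction property for the odd fields, where the contraction is an inverse of the Hessian.
-/
theorem lead_sum_K (j : {i : ι₀ // p₀ i = 1}) :
    d.lead a (d.contrVal a (.odd j)) = d.count a (.odd j) • d.ρ • Alg.of p₀ p₁ (.odd j) := by
  classical
  simp only [contrVal, map_sum, map_smul, lead_of, leadVal, if_true, count_odd]
  split_ifs with hj
  · have e (i : ι₀) : d.K i j • d.leadSource a (.phi i) =
        ∑ j', if j' ∈ d.J then (T.hess j' i * d.K i j) • Alg.of p₀ p₁ (.odd j') else 0 := by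
      by_cases h : i ∈ d.I ∧ p₀ i = 1 ∧ j ∈ d.J
      · have h0 : p₀ i ≠ 0 := by rw [h.2.1]; decide
        simp only [leadSource, if_pos h.1, if_neg h0, Finset.smul_sum]
        refine Finset.sum_congr rfl fun j' _ => ?_
        split_ifs
        · rw [smul_smul, mul_comm]
        · rw [smul_zero]
      · rw [d.K_eq_zero i j h, zero_smul]
        refine (Finset.sum_eq_zero fun j' _ => ?_).symm
        rw [mul_zero, zero_smul, ite_self]
    rw [Finset.sum_congr rfl fun i _ => e i, Finset.sum_comm]
    have e' (j' : {i : ι₀ // p₀ i = 1}) : ∑ i, (if j' ∈ d.J then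
        (T.hess j' i * d.K i j) • Alg.of p₀ p₁ (.odd j') else 0) =
        if j' = j then d.ρ • Alg.of p₀ p₁ (.odd j) else 0 := by
      by_cases hj' : j' ∈ d.J
      · simp only [if_pos hj', ← Finset.sum_smul, d.hess_mul_K j hj j' hj']
        split_ifs with h
        · rw [h]
        · rw [zero_smul]
      · rw [if_neg (by rintro rfl; exact hj' hj)]
        exact Finset.sum_eq_zero fun i _ => if_neg hj'
    rw [Finset.sum_congr rfl fun j' _ => e' j', Finset.sum_ite_eq' Finset.univ j,
      if_pos (Finset.mem_univ j), one_smul]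
  · rw [zero_smul]
    exact Finset.sum_eq_zero fun i _ => by rw [d.K_eq_zero i j fun h => hj h.2.2, zero_smul]

theorem _root_.Sp3.sgn_smul_sgn_smul {M : Type*} [AddCommGroup M] (c : ZMod 2) (y : M) :
    sgn c • sgn c • y = y := by
  rw [smul_smul, sgn_mul_self, one_smul]

end ShellData

end GaugeTheory

namespace GaugeTheory

variable {ι₀ ι₁ : Type*} [Fintype ι₀] [DecidableEq ι₀] {p₀ : ι₀ → ZMod 2} {p₁ : ι₁ → ZMod 2}
  {T : GaugeTheory p₀ p₁}

namespace ShellData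

variable [Fintype ι₁] [DecidableEq ι₁] {x : Body p₀} (d : T.ShellData x) (a : Fin 3)

/-! ### The contraction of the leading part -/

theorem eps_self_outer (b c : Fin 3) : eps b c b = 0 := by revert b c; decide

/-- On the antifields of the odd fields in `I` the contraction inverts the Hessian, on those of the
fields outside `I` it inverts the gauge generators. Those of the even fields in `I` remain: they
generate the Koszul complex. -/
theorem lead_contr_phi (i : ι₀) :
    d.lead a (d.contrSource a (.phi i)) + d.contr a (d.leadSource a (.phi i)) =
      d.count a (.star a (.phi i)) • d.ρ • Alg.of p₀ p₁ (.star a (.phi i)) := by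
  classical
  rw [count_star]
  simp only [contrSource, leadSource, map_sum, map_zsmul, map_smul, lead_of, leadVal, if_true,
    true_and, Field.phi.injEq]
  by_cases hi : i ∈ d.I
  · have hW (α : ι₁) : d.W α i = 0 := d.W_eq_zero α i fun h => h.1 hi
    simp only [hW, zero_smul, smul_zero, Finset.sum_const_zero, zero_add, if_pos hi]
    by_cases h0 : p₀ i = 0
    · rw [if_pos h0, if_pos ⟨i, rfl, hi, h0⟩, zero_smul]
      rw [Algebra.algebraMap_eq_smul_one, map_smul, contr, (isRightDer_rightDer _ _).map_one,
        smul_zero]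
    · have h1 := eq_one_of_ne_zero h0
      rw [if_neg h0, if_neg (by rintro ⟨_, rfl, -, h⟩; exact h0 h), one_smul, map_sum]
      have e (j : {i : ι₀ // p₀ i = 1}) :
          d.contr a (if j ∈ d.J then T.hess j i • Alg.of p₀ p₁ (.odd j) else 0) =
            ∑ i', (d.K i' j * T.hess j i) • Alg.of p₀ p₁ (.star a (.phi i')) := by
        split_ifs with hj
        · simp only [map_smul, contr_of, contrVal, Finset.smul_sum, smul_smul,
            mul_comm (T.hess _ _)]
        · rw [map_zero]
          refine (Finset.sum_eq_zero fun i' _ => ?_).symm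
          rw [d.K_eq_zero i' j fun h => hj h.2.2, zero_mul, zero_smul]
      simp only [e]
      rw [Finset.sum_comm]
      simp only [← Finset.sum_smul, d.K_mul_hess i hi h1, ite_smul, zero_smul,
        Finset.sum_ite_eq', Finset.mem_univ, if_true]
  · rw [if_neg hi, map_zero, add_zero, if_neg (by rintro ⟨_, rfl, h, -⟩; exact hi h), one_smul]
    have e (α : ι₁) : sgn (p₁ α) • d.W α i • sgn (p₁ α) • ∑ i', (if i' ∈ d.I then 0 else
        T.bodyZ i' α • Alg.of p₀ p₁ (.star a (.phi i'))) = ∑ i', if i' ∈ d.I then 0 else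
        (T.bodyZ i' α * d.W α i) • Alg.of p₀ p₁ (.star a (.phi i')) := by
      rw [smul_comm (d.W α i), sgn_smul_sgn_smul, Finset.smul_sum]
      refine Finset.sum_congr rfl fun i' _ => ?_
      split_ifs
      · rw [smul_zero]
      · rw [smul_smul, mul_comm]
    simp only [e]
    rw [Finset.sum_comm]
    have e' (i' : ι₀) : ∑ α, (if i' ∈ d.I then 0 else
        (T.bodyZ i' α * d.W α i) • Alg.of p₀ p₁ (.star a (.phi i'))) =
        if i' = i then d.ρ • Alg.of p₀ p₁ (.star a (.phi i)) else 0 := by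
      by_cases hi' : i' ∈ d.I
      · simp only [if_pos hi', Finset.sum_const_zero]
        rw [if_neg (by rintro rfl; exact hi hi')]
      · simp only [if_neg hi', ← Finset.sum_smul, d.Z_mul_W i hi i' hi']
        split_ifs with h
        · rw [h]
        · rw [zero_smul]
    simp only [e', Finset.sum_ite_eq', Finset.mem_univ, if_true]

/-- On the antifields of the ghosts `η_a`, the contraction inverts the gauge generators; on those of
the other `η_e`, it exchanges them with the antifields of the ghosts `π_c`, `c ≠ a`. -/
theorem lead_contr_eta (e : Fin 3) (α : ι₁) :
    d.lead a (d.contrSource a (.eta e α)) + d.contr a (d.leadSource a (.eta e α)) =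
      d.ρ • Alg.of p₀ p₁ (.star a (.eta e α)) := by
  classical
  have h1 : d.lead a (d.contrSource a (.eta e α)) =
      if e = a then 0 else d.ρ • Alg.of p₀ p₁ (.star a (.eta e α)) := by
    simp only [contrSource, map_zsmul, map_smul, map_sum, lead_of, leadVal, if_true, leadSource]
    simp only [smul_comm (eps _ _ _) (sgn _)]
    rw [← Finset.smul_sum, sum_eps_smul_sum_eps a e fun e' => Alg.of p₀ p₁ (.star a (.eta e' α)),
      smul_comm d.ρ, sgn_smul_sgn_smul]
    split_ifs
    · rw [smul_zero]
    · rfl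
  rw [h1, leadSource]
  split_ifs with he
  · subst he
    rw [zero_add, map_zsmul, map_sum]
    have e (i : ι₀) : d.contr e (if i ∈ d.I then 0 else
        T.bodyZ i α • Alg.of p₀ p₁ (.star e (.phi i))) =
        ∑ β, (sgn (p₁ β) • (d.W β i * T.bodyZ i α)) • Alg.of p₀ p₁ (.star e (.eta e β)) := by
      split_ifs with hi
      · rw [map_zero]
        refine (Finset.sum_eq_zero fun β _ => ?_).symm
        rw [d.W_eq_zero β i fun h => h.1 hi, zero_mul, smul_zero, zero_smul]
      · simp only [map_smul, contr_of, contrVal, contrSource, if_true, Finset.smul_sum]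
        refine Finset.sum_congr rfl fun β _ => ?_
        rw [smul_comm (T.bodyZ i α), smul_smul (T.bodyZ i α), mul_comm, smul_assoc]
    simp only [e]
    rw [Finset.sum_comm]
    simp only [← Finset.sum_smul, ← Finset.smul_sum, d.W_mul_Z]
    rw [Finset.sum_eq_single α]
    · rw [if_pos rfl, smul_assoc, sgn_smul_sgn_smul]
    · intro β _ hβ
      rw [if_neg hβ, smul_zero, zero_smul]
    · exact fun h => absurd (Finset.mem_univ α) h
  · rw [map_zero, add_zero]

/-- The antifields of the ghosts `π_c`, `c ≠ a`, pair with those of the `η_e`, and the antifield of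
`π_a` with that of `λ`. -/
theorem lead_contr_pi (c : Fin 3) (α : ι₁) :
    d.lead a (d.contrSource a (.pi c α)) + d.contr a (d.leadSource a (.pi c α)) =
      d.ρ • Alg.of p₀ p₁ (.star a (.pi c α)) := by
  have h1 : d.contr a (d.leadSource a (.pi c α)) =
      if c = a then 0 else d.ρ • Alg.of p₀ p₁ (.star a (.pi c α)) := by
    simp only [leadSource, map_zsmul, map_sum, contr_of, contrVal, if_true, contrSource]
    simp only [smul_comm (eps _ _ _) (sgn _), smul_comm (eps _ _ _) d.ρ]
    rw [← Finset.smul_sum, ← Finset.smul_sum,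
      sum_eps_smul_sum_eps_first a c fun c' => Alg.of p₀ p₁ (.star a (.pi c' α)), sgn_smul_sgn_smul]
    split_ifs
    · rw [smul_zero]
    · rfl
  rw [h1, contrSource]
  split_ifs with hc
  · subst hc
    simp only [map_zsmul, map_smul, lead_of, leadVal, if_true, leadSource]
    rw [smul_comm d.ρ, sgn_smul_sgn_smul, add_zero]
  · rw [map_zero, zero_add]

theorem lead_contr_lam (α : ι₁) :
    d.lead a (d.contrSource a (.lam α)) + d.contr a (d.leadSource a (.lam α)) =
      d.ρ • Alg.of p₀ p₁ (.star a (.lam α)) := by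
  simp only [leadSource, map_zsmul, contr_of, contrVal, if_true, contrSource, map_zero, zero_add]
  rw [sgn_smul_sgn_smul]

/-- The bar variables pair with the antifields of the types `c ≠ a`, and the bar variable of type
`a` with the tilde variable. -/
theorem lead_contr_bar (b : Fin 3) (A : Field ι₀ ι₁) :
    d.lead a (d.contrVal a (.bar b A)) + d.contr a (d.leadVal a (.bar b A)) =
      d.ρ • Alg.of p₀ p₁ (.bar b A) := by
  have h1 : d.contr a (d.leadVal a (.bar b A)) =
      if b = a then 0 else d.ρ • Alg.of p₀ p₁ (.bar b A) := by
    have e (c : Fin 3) : eps a b c • d.contrVal a (.star c A) =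
        sgn (A.parity p₀ p₁) • d.ρ • eps a b c • ∑ e, eps a e c • Alg.of p₀ p₁ (.bar e A) := by
      by_cases hc : c = a
      · subst hc
        rw [eps_self_outer, zero_smul, zero_smul, smul_zero, smul_zero]
      · rw [contrVal, if_neg hc, smul_comm (eps a b c), smul_comm (eps a b c)]
    simp only [leadVal, deltaVal, map_zsmul, map_sum, contr_of, e]
    rw [← Finset.smul_sum, ← Finset.smul_sum,
      sum_eps_smul_sum_eps_last a b fun e => Alg.of p₀ p₁ (.bar e A), sgn_smul_sgn_smul]
    split_ifs
    · rw [smul_zero]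
    · rfl
  rw [h1, contrVal]
  split_ifs with hb
  · subst hb
    simp only [map_zsmul, map_smul, lead_of, leadVal, deltaVal]
    rw [smul_comm d.ρ, sgn_smul_sgn_smul, add_zero]
  · rw [map_zero, zero_add]

/-- Up to the factor `ρ`, the contraction is a contracting homotopy of the leading part of `δ_a`
on all generators but those of the Koszul complex and the inert ones. -/
theorem lead_contr (g : Gen p₀ ι₁) :
    d.lead a (d.contrVal a g) + d.contr a (d.leadVal a g) =
      d.count a g • d.ρ • Alg.of p₀ p₁ g := by
  classical
  cases g with
  | odd j => rw [lead_sum_K, leadVal, map_zero, add_zero]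
  | ghost c => rw [contrVal, leadVal, map_zero, map_zero, count_ghost, zero_smul, add_zero]
  | star b A =>
    by_cases hb : b = a
    · subst hb
      rw [contrVal, leadVal, if_pos rfl, if_pos rfl]
      cases A with
      | phi i => exact d.lead_contr_phi b i
      | eta e α => rw [lead_contr_eta, count_star, if_neg (by simp), one_smul]
      | pi c α => rw [lead_contr_pi, count_star, if_neg (by simp), one_smul]
      | lam α => rw [lead_contr_lam, count_star, if_neg (by simp), one_smul]
    · rw [count_star, if_neg fun h => hb h.1, one_smul]
      simp only [contrVal, leadVal, if_neg hb, map_zero, add_zero,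
        map_zsmul, map_smul, map_sum, lead_of, deltaVal]
      simp only [smul_comm (eps _ _ _) (sgn _)]
      rw [← Finset.smul_sum, sum_eps_smul_sum_eps_middle a b fun c => Alg.of p₀ p₁ (.star c A),
        smul_comm d.ρ, sgn_smul_sgn_smul, if_neg hb]
  | bar b A => rw [lead_contr_bar, count_bar, one_smul]
  | tilde A =>
    rw [count_tilde, one_smul]
    simp only [contrVal, leadVal, deltaVal, map_zsmul, map_zero, zero_add, contr_of, if_true]
    rw [sgn_smul_sgn_smul]

end ShellData

end GaugeTheory

/-! ### Local exactness on the stationary surface -/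

/-- Words of weight zero, for a nonnegative weight, consist of letters of weight zero. -/
theorem mem_lspan_of_mem_wspan_zero {B : Type*} [CommRing B] {G : Type*} {p : G → ZMod 2}
    {w : G → ℤ} (hw : ∀ g, 0 ≤ w g) {y : SuperPoly B p} (hy : y ∈ wspan B p w {0}) :
    y ∈ lspan B p fun l => ∀ g ∈ l, w g = 0 := by
  refine wspan_induction (fun l hl => mon_mem_lspan fun g hg => ?_) hy
  refine (List.all_zero_of_le_zero_le_of_sum_eq_zero ?_ hl) (List.mem_map_of_mem hg)
  rintro _ hu
  obtain ⟨g, -, rfl⟩ := List.mem_map.1 hu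
  exact hw g

namespace GaugeTheory

variable {ι₀ ι₁ : Type*} [Fintype ι₀] [DecidableEq ι₀] {p₀ : ι₀ → ZMod 2} {p₁ : ι₁ → ZMod 2}
  {T : GaugeTheory p₀ p₁}

namespace ShellData

variable [Fintype ι₁] [DecidableEq ι₁] {x : Body p₀} (d : T.ShellData x) (a : Fin 3)

theorem lead_gen_mem_order_res (g : Gen p₀ ι₁) :
    d.lead a (gen (Smooth p₀) (Gen.parity p₀ p₁) g) ∈
      wspan (Smooth p₀) (Gen.parity p₀ p₁) (fun g => (d.order a g, (g.res : ℤ)))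
        {(d.order a g, (g.res : ℤ) - 1)} := by
  have h := d.leadVal_mem_comp a
    ⟨⟨fun u : ℤ × ℤ × ℤ × ℤ × ZMod 2 => (u.1, u.2.1), rfl⟩, fun _ _ => rfl⟩ g
  rw [← lead_of] at h
  refine wspan_mono ?_ h
  rintro _ rfl
  exact Prod.ext (add_zero _) rfl

/-- The terms of `δ_a` outside its leading part raise the order. -/
theorem delta_sub_lead_mem (g : Gen p₀ ι₁) :
    T.delta a (gen (Smooth p₀) (Gen.parity p₀ p₁) g) -
      d.lead a (gen (Smooth p₀) (Gen.parity p₀ p₁) g) ∈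
      wspan (Smooth p₀) (Gen.parity p₀ p₁) (fun g => (d.order a g, (g.res : ℤ)))
        {u | d.order a g + 1 ≤ u.1 ∧ u.2 = (g.res : ℤ) - 1} := by
  have h1 := d.deltaVal_sub_leadVal_mem a g
  rw [← delta_of, ← lead_of, wspan_fst (fun g : Gen p₀ ι₁ => (d.order a g, (g.res : ℤ)))] at h1
  have h2 := T.delta_gen_mem_res a g
  rw [wspan_snd (fun g : Gen p₀ ι₁ => (d.order a g, (g.res : ℤ)))] at h2
  have h3 : d.lead a (gen (Smooth p₀) (Gen.parity p₀ p₁) g) ∈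
      wspan (Smooth p₀) (Gen.parity p₀ p₁) (fun g => (d.order a g, (g.res : ℤ)))
        {u | u.2 ∈ ({(g.res : ℤ) + -1} : Set ℤ)} := by
    refine wspan_mono ?_ (d.lead_gen_mem_order_res a g)
    rintro _ rfl
    rfl
  have h4 := wspan_inter h1 (sub_mem h2 h3)
  refine wspan_mono ?_ h4
  rintro u ⟨h5, h6⟩
  exact ⟨h5, h6⟩

/-- On the stationary surface the cohomology of `δ_a` vanishes locally in positive resolution
degree: this reduces to the leading part of `δ_a` by the filtration, then to the Koszul complex of
a regular sequence by the contraction. -/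
theorem locallyExactAt (d : T.ShellData x) (a : Fin 3) : T.LocallyExactAt a x := by
  intro m hm c hc hδ
  have hlead : IsRightDer 1 (d.lead a) := isRightDer_rightDer _ _
  have hpar (g : Gen p₀ ι₁) : d.lead a (gen (Smooth p₀) (Gen.parity p₀ p₁) g) ∈
      parityPart (Smooth p₀) (Gen.parity p₀ p₁) (g.parity p₀ p₁ + 1) := by
    rw [← Alg.of, lead_of]
    exact d.leadVal_mem_parity a g
  have hg₀ := d.lead_gen_mem_order_res a
  have hcount (g : Gen p₀ ι₁) : d.lead a (gen (Smooth p₀) (Gen.parity p₀ p₁) g) ∈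
      wspan (Smooth p₀) (Gen.parity p₀ p₁) (d.count a) {d.count a g} := by
    have h := d.leadVal_mem_comp a
      ⟨⟨fun u : ℤ × ℤ × ℤ × ℤ × ZMod 2 => u.2.2.1, rfl⟩, fun _ _ => rfl⟩ g
    rw [← lead_of] at h
    refine wspan_mono ?_ h
    rintro _ rfl
    exact add_zero _
  have hinert (g : Gen p₀ ι₁) (hg : g ∉ d.inert) :
      d.lead a (gen (Smooth p₀) (Gen.parity p₀ p₁) g) ∈
        lspan (Smooth p₀) (Gen.parity p₀ p₁) fun l => ∀ g ∈ l, g ∈ d.inertᶜ := by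
    classical
    have h := d.leadVal_mem_comp a
      ⟨⟨fun u : ℤ × ℤ × ℤ × ℤ × ZMod 2 => u.2.2.2.1, rfl⟩, fun _ _ => rfl⟩ g
    rw [← lead_of] at h
    refine lspan_mono (fun l hl g hg => ?_) (mem_lspan_of_mem_wspan_zero
      (w := fun g => if g ∈ d.inert then (1 : ℤ) else 0) (fun g => ?_) (wspan_mono ?_ h))
    · intro hgi
      have := hl g hg
      rw [if_pos hgi] at this
      exact one_ne_zero this
    · split_ifs <;> norm_num
    · rintro _ rfl
      exact (add_zero _).trans (if_neg hg)
  have hg := d.delta_sub_lead_mem a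
  have hc' := mem_satRange_of_leading (S := nonvanishing x) (T.isRightDer_delta a) hlead
    (T.delta_delta a) hg₀ hg (d.wspan_order_res_eq_bot a m) ?_ hc hδ
  · obtain ⟨s, hs, y, hy⟩ := mem_satRange.1 hc'
    exact ⟨s, mem_nonvanishing.1 hs, y, hy⟩
  · intro k c hc hδ
    refine mem_satRange_of_contraction d.ρ_mem hlead
      (isRightDer_rightDer (d.contrVal a) (d.contrVal_mem a)) (fun g => ?_) (fun g => ?_) hcount
      (fun g => ?_) hδ fun c' hc' hδ' hp => ?_
    · exact hpar g
    · rw [rightDer_gen]; exact d.contrVal_mem a g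
    · rw [rightDer_gen]
      exact (congrArg _ (congrArg (d.contr a) (d.lead_of a g))).trans (d.lead_contr a g)
    · have hres : c' ∈ wspan (Smooth p₀) (Gen.parity p₀ p₁) (fun g => (g.res : ℤ)) {m} := by
        rw [hp, wspan_snd (fun g : Gen p₀ ι₁ => (d.count a g, (g.res : ℤ)))]
        refine wspan_mono (fun u hu => hu.2) (projU_mem_inter (V := {m}) {0} ?_)
        rw [wspan_snd (fun g : Gen p₀ ι₁ => (d.order a g, (g.res : ℤ)))]
        refine wspan_mono ?_ hc
        rintro _ rfl
        rfl
      have hl : c' ∈ lspan (Smooth p₀) (Gen.parity p₀ p₁)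
          fun l => ∀ g ∈ l, g ∈ d.inert ∪ Set.range (d.koszulGen a) := by
        refine lspan_mono (fun l hl g hg => ?_) (mem_lspan_of_mem_wspan_zero (fun g => ?_) hc')
        · by_contra h
          have := hl g hg
          rw [count, if_neg (not_or.2 ⟨fun h' => h (Or.inl h'), fun h' => h (Or.inr h')⟩)] at this
          exact one_ne_zero this
        · rw [count]
          split_ifs <;> norm_num
      have hinertEq (g : Gen p₀ ι₁) (hg : g ∈ d.inert) :
          d.leadVal a g = 0 ∧ (g.res : ℤ) = 0 := by
        obtain ⟨j, -, rfl⟩ | ⟨c, rfl⟩ := hg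
        · exact ⟨rfl, Gen.res_odd j⟩
        · exact ⟨rfl, Gen.res_ghost c⟩
      refine koszul_exact_inert (ξ := d.koszulGen a) (S := nonvanishing x)
        (y := fun i : {i : ι₀ // i ∈ d.I ∧ p₀ i = 0} => -T.bodyEq i) ?_ (fun i => ?_)
        hlead hpar (fun i => ?_) d.regular
        (I := d.inert) (fun g hg => (d.lead_of a g).trans (hinertEq g hg).1) hinert
        (fun g hg => (hinertEq g hg).2) (fun i => ?_) hm hl hres hδ'
      · intro i i' h
        simpa only [koszulGen, Gen.star.injEq, true_and, Field.phi.injEq, Subtype.coe_inj] using h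
      · simp only [koszulGen, Gen.parity, Field.parity, i.2.2, zero_add]
      · refine (d.lead_of a _).trans ?_
        simp only [koszulGen, leadVal, if_true, leadSource, if_pos i.2.1, if_pos i.2.2]
      · rw [koszulGen, Gen.res_star]; rfl

end ShellData

end GaugeTheory

end

end Sp3

/-- The positivity theorem. -/
theorem theorem1 {ι₀ ι₁ : Type*} [Fintype ι₀] [DecidableEq ι₀] [Fintype ι₁]
    (p₀ : ι₀ → ZMod 2) (p₁ : ι₁ → ZMod 2) (T : Sp3.GaugeTheory p₀ p₁)
    (hirr : T.Irreducible) (hreg : T.CompleteRegular)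
    (m : ℕ) (hm : 0 < m) (F : Sp3.Alg p₀ p₁)
    (hF : F ∈ Sp3.algPos p₀ p₁) (hres : F ∈ Sp3.resPart p₀ p₁ m) (hδ : T.totalDelta F = 0) :
    ∃ P ∈ Sp3.algNonneg p₀ p₁, T.totalDelta P = F := by
  classical
  refine T.exists_of_deltaExact (T.deltaExact_of_locally fun a x => ?_) hm hF hres hδ
  by_cases hx : ∀ i, (Sp3.body p₀ (Sp3.derivR p₀ i T.S₀)).1 x = 0
  · exact (Sp3.GaugeTheory.nonempty_shellData hirr hreg hx).some.locallyExactAt a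
  · obtain ⟨i, hi⟩ := not_forall.1 hx
    exact T.locallyExactAt_of_ne a hi
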